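/- Conventions. For $A\subset\mathbb{R}^d$, $|A|$ denotes Lebesgue (outer) measure, and for $\delta>0$, $|A|_\delta$ denotes the least number of balls of radius $\delta$ needed to cover $A$. A set $A\subset\mathbb{R}^d$ is a $(\delta,\kappa,C)$-set if it is a finite union of balls of radius $\delta$ and $|A\cap B(x,r)|\le C r^{\kappa}|A|$ for all $x\in A$ and all $r\ge\delta$. A Borel probability measure $\mu$ on $\mathbb{R}^d$ is a $(\kappa,C)$-measure if $\mu(B(x,r))\le C r^{\kappa}$ for all $x\in\operatorname{spt}\mu$ and all $r>0$. For $\theta\in S^1\subset\mathbb{R}^2$ let $\pi_\theta:\mathbb{R}^2\to\mathbb{R}$, $\pi_\theta(x)=x\cdot\theta$. Balls are closed. Theorem (Bourgain's discretised projection theorem). Let $0<\alpha<2$ and $\beta,\kappa>0$. There exist $\eta>0$ and $\varepsilon,\delta_0\in(0,1]$, depending only on $\alpha,\beta,\kappa$, such that the following holds for all $0<\delta<\delta_0$. Let $\mu$ be a $(\kappa,\delta^{-\varepsilon})$-measure on $\mathbb{R}^2$ with $\operatorname{spt}\mu\subset S^1$, and let $E\subset B(0,\delta^{-\varepsilon})\subset\mathbb{R}^2$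 be a $(\delta,\beta,\delta^{-\varepsilon})$-set with $|E|\le\delta^{2-\alpha}$. Then there is a Borel set $\Theta\subset\operatorname{spt}\mu$ with $\mu(\Theta)>1-\delta^{\varepsilon}$ such that, for every $\theta\in\Theta$, $$|\pi_\theta(G)|_\delta>\delta^{-\eta}\,|E|_\delta^{1/2}\quad\text{for every } G\subset E \text{ with } |G|>\delta^{\varepsilon}|E|.$$ -/

import Mathlib

open MeasureTheory

open scoped ENNReal

noncomputable section

/-- `A ⊆ ℝᵈ` is a `(δ, κ, C)`-set: a finite union of balls of radius `δ` such that
`|A ∩ B(x, r)| ≤ C r ^ κ |A|` for all `x ∈ A` and `r ≥ δ`, where `|·|` is Lebesgue measure. -/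
def IsDeltaSet {d : ℕ} (δ κ C : ℝ) (A : Set (EuclideanSpace ℝ (Fin d))) : Prop :=
  (∃ F : Finset (EuclideanSpace ℝ (Fin d)), A = ⋃ x ∈ F, Metric.closedBall x δ) ∧
    ∀ x ∈ A, ∀ r : ℝ, δ ≤ r →
      volume (A ∩ Metric.closedBall x r) ≤ ENNReal.ofReal (C * r ^ κ) * volume A

/-- A Borel measure `μ` on `ℝᵈ` is a `(κ, C)`-measure: it is a probability measure
(hence automatically Radon) with `μ (B(x, r)) ≤ C r ^ κ` for all `x ∈ spt μ` and `r > 0`. -/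
def IsFrostmanMeasure {d : ℕ} (κ C : ℝ) (μ : Measure (EuclideanSpace ℝ (Fin d))) : Prop :=
  IsProbabilityMeasure μ ∧
    ∀ x ∈ μ.support, ∀ r : ℝ, 0 < r →
      μ (Metric.closedBall x r) ≤ ENNReal.ofReal (C * r ^ κ)

/-- The orthogonal projection of the plane in direction `θ`, `x ↦ x · θ`. -/
def dirProj (θ x : EuclideanSpace ℝ (Fin 2)) : ℝ := inner ℝ x θ

/-- The `δ`-covering number `|A|_δ`: the least number of balls of radius `δ`
(with arbitrary centres) needed to cover `A`, as an extended nonnegative real. -/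
def covNum {X : Type*} [PseudoEMetricSpace X] (δ : ℝ) (A : Set X) : ℝ≥0∞ :=
  ((Metric.externalCoveringNumber δ.toNNReal A : ℕ∞) : ℝ≥0∞)

end

/-!
The proof follows Bourgain. Suppose that the conclusion fails. Cut the plane into squares of side
`δ = 1 / R`; the set `E` becomes a finite set `P` of points of `ℤ × ℤ` and the bad directions
become finitely many slopes `s` with weights, each with a large subset `G s` of `P` on which
`(x, y) ↦ x + s y` takes at most `K √|P|` values up to rounding, where `K` is a tiny power of `R`.
The contradiction (`exists_large_projection`) is reached as follows.

*From projections to multipliers.* Many points lie in `G s` for many `s`, so a large set of points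
lies in `G s₀ ∩ G s₁ ∩ G s₂` for three separated slopes (`exists_separated_slopes`). In the
coordinates `X, Y` given by the slopes `s₀, s₁`, scaled so that the third projection is `X + Y`,
the Balog–Szemerédi–Gowers theorem (`exists_small_sumset`) provides sets `A, B ⊆ ℤ` with
`|A + B| ≲ |A| ≈ |B| ≈ √|P|`. Then `V = A - A` is an approximate subgroup of `ℤ`, it is too small
to be most of an interval of length `R`, and it does not concentrate on shorter intervals because
`P` does not (`SeparatedSlopes.isSmallSpread`). Every further slope `s` that sees a large part of
the point set gives, through one fibre of its projection and Ruzsa covering, a real number `t`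
(a cross ratio of `s₀, s₁, s₂, s`) such that `t V` is covered by few translates of `V`
(`SeparatedSlopes.isMultiplier`); call such a number a multiplier. Since the slopes carry a
Frostman weight, the multipliers have dimension at least `κ` at all scales from `1 / R` to `1`
(`hasSeparated_of_weights`).

*Multipliers cannot have positive dimension* (`exists_no_multipliers`). Multipliers are closed
under ring operations, and under division by numbers that are not too small, with polynomial loss
in the number of translates. On the other hand they are not `1 / R`-dense in `[-1, 1]`, by counting
the pairs `(d, e)` in `(V + V)²` with `x d ≈ e` (`card_multipliers_le`). Let `A` now be a finite set
of multipliers. If the quotients `(a - b) / (c - d)` of elements of `A` were dense in `[0, 1]` at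
a scale `R ^ (-v)`, then digit expansions with boundedly many digits would produce a `1 / R`-dense
set of multipliers, a contradiction (`not_quotientDense_of_small`). So they are not dense, and
then some number `ξ` that comes from one such quotient by halving, after possibly adding `1`, is far
from all of them (`exists_far_quotient`). For such `ξ` the map `(a, b) ↦ a + ξ b` is injective on `A × A` in
a quantitative sense, which turns `A` into a set of multipliers with more separated elements
(`HasSeparated.gain`). Iterating this raises the dimension by `κ / 2` at some scale
(`DimensionExcluded.step`); after finitely many steps the dimension exceeds `1`, which is absurd.

Finally a set of directions `θ` is treated as a set of slopes after a division of the circle into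
four arcs, on each of which one coordinate dominates and has a constant sign
(`measure_badDirections_quadrant_lt`).
-/

open scoped Pointwise

/-! ### Approximate groups and their multipliers -/


/-- A finite set of integers that is symmetric, contains `0`, and whose sumset `V + V` is covered by
at most `K` translates of `V`. -/
structure IsApproxGroup (V : Finset ℤ) (K : ℝ) : Prop where
  zero_mem : 0 ∈ V
  neg_mem : ∀ v ∈ V, -v ∈ V
  add_mem : ∃ F : Finset ℤ, (F.card : ℝ) ≤ K ∧ ∀ u ∈ V, ∀ v ∈ V, ∃ f ∈ F, ∃ w ∈ V, u + v = f + w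

/-- The real number `x` is a multiplier of `V` with loss `L`: every point of `x V` is within `L` of
`V + F` for a set `F` of at most `L` reals, and `|x| ≤ L`. One parameter bounds the number of
translates, the rounding error and the size of `x`, so that the calculus of multipliers only has to
follow powers of `L`. -/
def IsMultiplier (V : Finset ℤ) (L x : ℝ) : Prop :=
  |x| ≤ L ∧ ∃ F : Finset ℝ, (F.card : ℝ) ≤ L ∧
    ∀ v ∈ V, ∃ v' ∈ V, ∃ f ∈ F, |x * v - v' - f| ≤ L

theorem IsApproxGroup.mono {V : Finset ℤ} {K K' : ℝ} (h : IsApproxGroup V K) (hK : K ≤ K') :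
    IsApproxGroup V K' := by
  obtain ⟨F, hF, h'⟩ := h.add_mem
  exact ⟨h.zero_mem, h.neg_mem, F, hF.trans hK, h'⟩

theorem IsApproxGroup.card_add_le {V : Finset ℤ} {K : ℝ} (h : IsApproxGroup V K) :
    ((V + V).card : ℝ) ≤ K * V.card := by
  obtain ⟨F, hF, h'⟩ := h.add_mem
  have : V + V ⊆ F + V := by
    intro z hz
    obtain ⟨u, hu, v, hv, rfl⟩ := Finset.mem_add.1 hz
    obtain ⟨f, hf, w, hw, e⟩ := h' u hu v hv
    rw [e]
    exact Finset.add_mem_add hf hw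
  calc ((V + V).card : ℝ) ≤ (F + V).card := by exact_mod_cast Finset.card_le_card this
    _ ≤ F.card * V.card := by exact_mod_cast Finset.card_add_le
    _ ≤ K * V.card := by gcongr

theorem card_filter_floor_mul_le {q L : ℝ} (hq : q ≠ 0) (hL : |q|⁻¹ ≤ L) (V : Finset ℤ)
    (w : ℤ) : ((V.filter (fun v : ℤ => ⌊q * v⌋ = w)).card : ℝ) ≤ L + 1 := by
  set S := V.filter (fun v : ℤ => ⌊q * v⌋ = w) with hS
  rcases S.eq_empty_or_nonempty with h | h
  · rw [h]; simp
    have : 0 ≤ |q|⁻¹ := by positivity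
    linarith
  · set m := S.min' h
    have hm : m ∈ S := S.min'_mem h
    have hsub : S ⊆ Finset.Icc m (m + ⌊L⌋) := by
      intro v hv
      have h1 : m ≤ v := S.min'_le v hv
      rw [Finset.mem_Icc]
      refine ⟨h1, ?_⟩
      have hv' := (Finset.mem_filter.1 hv).2
      have hm' := (Finset.mem_filter.1 hm).2
      rw [Int.floor_eq_iff] at hv' hm'
      have h2 : |q * (v - m)| < 1 := by
        rw [abs_lt]; constructor <;> linarith [hv'.1, hv'.2, hm'.1, hm'.2]
      have h3 : ((v - m : ℤ) : ℝ) ≤ L := by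
        rw [abs_mul] at h2
        have hq' : 0 < |q| := abs_pos.2 hq
        have : |(v : ℝ) - m| ≤ |q|⁻¹ := by
          rw [← one_div, le_div_iff₀ hq']; linarith
        push_cast
        exact (le_abs_self _).trans (this.trans hL)
      have := Int.le_floor.2 h3
      linarith
    have hc := Finset.card_le_card hsub
    rw [Int.card_Icc] at hc
    have hL0 : (0 : ℝ) ≤ L := le_trans (by positivity) hL
    have h0 : 0 ≤ ⌊L⌋ := Int.floor_nonneg.2 hL0
    have : (S.card : ℝ) ≤ ((⌊L⌋ + 1 : ℤ) : ℝ) := by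
      have : (S.card : ℤ) ≤ ⌊L⌋ + 1 := by omega
      exact_mod_cast this
    push_cast at this
    linarith [Int.floor_le L]

namespace IsMultiplier

variable {V : Finset ℤ} {K L x y : ℝ}

theorem mono {L' : ℝ} (h : IsMultiplier V L x) (hL : L ≤ L') : IsMultiplier V L' x := by
  obtain ⟨h1, F, hF, h2⟩ := h
  refine ⟨h1.trans hL, F, hF.trans hL, fun v hv => ?_⟩
  obtain ⟨v', hv', f, hf, h3⟩ := h2 v hv
  exact ⟨v', hv', f, hf, h3.trans hL⟩

theorem zero (hV : IsApproxGroup V K) (hL : 1 ≤ L) : IsMultiplier V L 0 := by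
  refine ⟨by simp; linarith, {0}, by simpa using hL, fun v hv => ⟨0, hV.zero_mem, 0, by simp, ?_⟩⟩
  simp; linarith

theorem neg (hV : IsApproxGroup V K) (h : IsMultiplier V L x) : IsMultiplier V L (-x) := by
  obtain ⟨h1, F, hF, h2⟩ := h
  refine ⟨by simpa using h1, F, hF, fun v hv => ?_⟩
  obtain ⟨v', hv', f, hf, h3⟩ := h2 (-v) (hV.neg_mem v hv)
  refine ⟨v', hv', f, hf, ?_⟩
  push_cast at h3
  rwa [show -x * (v : ℝ) = x * -v by ring]

theorem add (hV : IsApproxGroup V L) (hL : 2 ≤ L) (hx : IsMultiplier V L x)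
    (hy : IsMultiplier V L y) : IsMultiplier V (L ^ 3) (x + y) := by
  classical
  obtain ⟨x1, F, hF, x2⟩ := hx
  obtain ⟨y1, G, hG, y2⟩ := hy
  obtain ⟨F0, hF0, h0⟩ := hV.add_mem
  have hL3 : 2 * L ≤ L ^ 3 := by nlinarith [mul_self_nonneg L, mul_nonneg (by linarith : 0 ≤ L) (by linarith : 0 ≤ L - 2)]
  refine ⟨(abs_add_le x y).trans (by linarith), F0.image (fun z : ℤ => (z : ℝ)) + (F + G), ?_, ?_⟩
  · calc (((F0.image (fun z : ℤ => (z : ℝ)) + (F + G)).card : ℕ) : ℝ)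
        ≤ ((F0.image (fun z : ℤ => (z : ℝ))).card * (F.card * G.card) : ℕ) := by
          exact_mod_cast Finset.card_add_le.trans (Nat.mul_le_mul_left _ Finset.card_add_le)
      _ ≤ (F0.card * (F.card * G.card) : ℕ) := by
          exact_mod_cast Nat.mul_le_mul_right _ Finset.card_image_le
      _ ≤ L * (L * L) := by push_cast; gcongr
      _ = L ^ 3 := by ring
  · intro v hv
    obtain ⟨a, ha, f, hf, e1⟩ := x2 v hv
    obtain ⟨b, hb, g, hg, e2⟩ := y2 v hv
    obtain ⟨c, hc, w, hw, e3⟩ := h0 a ha b hb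
    refine ⟨w, hw, (c : ℝ) + (f + g), Finset.add_mem_add (Finset.mem_image_of_mem _ hc)
      (Finset.add_mem_add hf hg), ?_⟩
    have e3' : (a : ℝ) + b = c + w := by exact_mod_cast e3
    have : (x + y) * v - w - (c + (f + g)) = (x * v - a - f) + (y * v - b - g) := by linarith
    rw [this]
    exact (abs_add_le _ _).trans (by linarith)

theorem sub (hV : IsApproxGroup V L) (hL : 2 ≤ L) (hx : IsMultiplier V L x)
    (hy : IsMultiplier V L y) : IsMultiplier V (L ^ 3) (x - y) := by
  rw [sub_eq_add_neg]
  exact hx.add hV hL (hy.neg hV)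

theorem mul (hL : 2 ≤ L) (hx : IsMultiplier V L x)
    (hy : IsMultiplier V L y) : IsMultiplier V (L ^ 3) (x * y) := by
  classical
  obtain ⟨x1, F, hF, x2⟩ := hx
  obtain ⟨y1, G, hG, y2⟩ := hy
  have hL0 : 0 ≤ L := by linarith
  have hL2 : L ^ 2 ≤ L ^ 3 := by gcongr <;> linarith
  have hL3 : L + L * L ≤ L ^ 3 := by nlinarith [mul_nonneg hL0 (by linarith : 0 ≤ L - 2)]
  refine ⟨?_, F + G.image (fun g => x * g), ?_, ?_⟩
  · rw [abs_mul]
    calc |x| * |y| ≤ L * L := by gcongr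
      _ ≤ L ^ 3 := by linarith
  · calc (((F + G.image (fun g => x * g)).card : ℕ) : ℝ) ≤ (F.card * G.card : ℕ) := by
          exact_mod_cast Finset.card_add_le.trans (Nat.mul_le_mul_left _ Finset.card_image_le)
      _ ≤ L * L := by push_cast; gcongr
      _ ≤ L ^ 3 := by linarith
  · intro v hv
    obtain ⟨b, hb, g, hg, e2⟩ := y2 v hv
    obtain ⟨a, ha, f, hf, e1⟩ := x2 b hb
    refine ⟨a, ha, f + x * g, Finset.add_mem_add hf (Finset.mem_image_of_mem _ hg), ?_⟩
    have : x * y * v - a - (f + x * g) = (x * b - a - f) + x * (y * v - b - g) := by ring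
    rw [this]
    refine (abs_add_le _ _).trans ?_
    rw [abs_mul]
    have : |x| * |y * v - b - g| ≤ L * L := by gcongr
    linarith

/-- The approximate inclusion `x V ⊆ V + F` can be inverted because `x V`, rounded to integers, is
nearly as large as `V`: hence `V + x V` is not much larger than `x V`, and Ruzsa covering covers `V`
by few translates of `x V - x V`. -/
theorem inv (hV : IsApproxGroup V L) (hL : 2 ≤ L) (hx : IsMultiplier V L x)
    (hx0 : x ≠ 0) (hxL : |x|⁻¹ ≤ L) : IsMultiplier V (L ^ 10) x⁻¹ := by
  classical
  obtain ⟨x1, F, hF, x2⟩ := hx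
  obtain ⟨F0, hF0, h0⟩ := hV.add_mem
  have hL0 : 0 ≤ L := by linarith
  set W : Finset ℤ := V.image (fun v : ℤ => ⌊x * v⌋) with hW
  have hWne : W.Nonempty := ⟨_, Finset.mem_image_of_mem _ hV.zero_mem⟩
  -- `x V` is not much smaller than `V`
  have hVW : (V.card : ℝ) ≤ (L + 1) * W.card := by
    have := Finset.card_eq_sum_card_image (fun v : ℤ => ⌊x * v⌋) V
    rw [this]
    push_cast
    calc (∑ w ∈ W, ((V.filter (fun v : ℤ => ⌊x * v⌋ = w)).card : ℝ)) ≤ ∑ w ∈ W, (L + 1) :=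
          Finset.sum_le_sum fun w _ => card_filter_floor_mul_le hx0 hxL V w
      _ = (L + 1) * W.card := by rw [Finset.sum_const, nsmul_eq_mul]; ring
  -- `V + x V` is covered by few translates of `V`
  have hVWs : ((V + W).card : ℝ) ≤ L * L * (2 * L + 5) * V.card := by
    set I : Finset ℤ := Finset.Icc (-⌊L⌋ - 2) (⌊L⌋ + 2) with hI
    have hsub : V + W ⊆ (F0 + F.image (fun f => ⌊f⌋) + I) + V := by
      intro z hz
      obtain ⟨u, hu, w, hw, rfl⟩ := Finset.mem_add.1 hz
      obtain ⟨v, hv, rfl⟩ := Finset.mem_image.1 hw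
      obtain ⟨v', hv', f, hf, e⟩ := x2 v hv
      obtain ⟨f0, hf0, w', hw', e'⟩ := h0 u hu v' hv'
      refine Finset.mem_add.2 ⟨f0 + ⌊f⌋ + (⌊x * v⌋ - v' - ⌊f⌋), ?_, w', hw', by linarith⟩
      refine Finset.add_mem_add (Finset.add_mem_add hf0 (Finset.mem_image_of_mem _ hf)) ?_
      rw [hI, Finset.mem_Icc]
      rw [abs_le] at e
      have a1 := Int.floor_le (x * v)
      have a2 := Int.lt_floor_add_one (x * v)
      have a3 := Int.floor_le f
      have a4 := Int.lt_floor_add_one f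
      have a5 := Int.lt_floor_add_one L
      have b1 : (-⌊L⌋ - 2 : ℝ) < ((⌊x * v⌋ - v' - ⌊f⌋ : ℤ) : ℝ) + 1 := by
        push_cast; linarith
      have b2 : ((⌊x * v⌋ - v' - ⌊f⌋ : ℤ) : ℝ) < (⌊L⌋ + 2 : ℝ) + 1 := by
        push_cast; linarith
      constructor
      · have : (-⌊L⌋ - 2 : ℤ) < (⌊x * v⌋ - v' - ⌊f⌋ : ℤ) + 1 := by exact_mod_cast b1
        omega
      · have : (⌊x * v⌋ - v' - ⌊f⌋ : ℤ) < (⌊L⌋ + 2) + 1 := by exact_mod_cast b2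
        omega
    have hIc : (I.card : ℝ) ≤ 2 * L + 5 := by
      rw [hI, Int.card_Icc]
      have h0 : 0 ≤ ⌊L⌋ := Int.floor_nonneg.2 hL0
      have : (((⌊L⌋ + 2 + 1 - (-⌊L⌋ - 2)).toNat : ℤ) : ℝ) = 2 * ⌊L⌋ + 5 := by
        rw [Int.toNat_of_nonneg (by omega)]; push_cast; ring
      have h2 := Int.floor_le L
      have : ((⌊L⌋ + 2 + 1 - (-⌊L⌋ - 2)).toNat : ℝ) = 2 * ⌊L⌋ + 5 := by exact_mod_cast this
      linarith
    calc ((V + W).card : ℝ) ≤ ((F0 + F.image (fun f => ⌊f⌋) + I) + V).card := by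
          exact_mod_cast Finset.card_le_card hsub
      _ ≤ ((F0.card * F.card * I.card * V.card : ℕ) : ℝ) := by
          norm_cast
          refine Finset.card_add_le.trans (Nat.mul_le_mul_right _ ?_)
          refine Finset.card_add_le.trans (Nat.mul_le_mul_right _ ?_)
          exact Finset.card_add_le.trans (Nat.mul_le_mul_left _ Finset.card_image_le)
      _ ≤ L * L * (2 * L + 5) * V.card := by push_cast; gcongr
  obtain ⟨F1, -, hF1, hcov⟩ := Finset.ruzsa_covering_add (A := V) (B := W) hWne
    (K := L * L * (2 * L + 5) * (L + 1)) (by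
      refine hVWs.trans ?_
      rw [mul_assoc _ (L + 1)]
      gcongr)
  refine ⟨?_, (F1.image (fun f : ℤ => x⁻¹ * f)) + F0.image (fun f : ℤ => (f : ℝ)), ?_, ?_⟩
  · rw [abs_inv]
    exact hxL.trans (by simpa using pow_le_pow_right₀ (by linarith : 1 ≤ L) (by norm_num : 1 ≤ 10))
  · calc ((((F1.image (fun f : ℤ => x⁻¹ * f)) + F0.image (fun f : ℤ => (f : ℝ))).card : ℕ) : ℝ)
        ≤ ((F1.card * F0.card : ℕ) : ℝ) := by
          exact_mod_cast Finset.card_add_le.trans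
            (Nat.mul_le_mul Finset.card_image_le Finset.card_image_le)
      _ ≤ (L * L * (2 * L + 5) * (L + 1)) * L := by push_cast; gcongr
      _ ≤ (L * L * (L * L * L * L) * (L * L)) * L := by
          gcongr
          · nlinarith [mul_nonneg hL0 (by linarith : 0 ≤ L - 2), mul_nonneg (mul_nonneg hL0 hL0) (by linarith : 0 ≤ L - 2), mul_nonneg (mul_nonneg (mul_nonneg hL0 hL0) hL0) (by linarith : 0 ≤ L - 2)]
          · nlinarith
      _ = L ^ 9 := by ring
      _ ≤ L ^ 10 := by gcongr <;> linarith
  · intro v hv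
    obtain ⟨f1, hf1, d, hd, rfl⟩ := Finset.mem_add.1 (hcov hv)
    obtain ⟨w1, hw1, w2, hw2, rfl⟩ := Finset.mem_sub.1 hd
    obtain ⟨v1, hv1, rfl⟩ := Finset.mem_image.1 hw1
    obtain ⟨v2, hv2, rfl⟩ := Finset.mem_image.1 hw2
    obtain ⟨f0, hf0, w, hw, e⟩ := h0 v1 hv1 (-v2) (hV.neg_mem _ hv2)
    refine ⟨w, hw, x⁻¹ * f1 + f0, Finset.add_mem_add
      (Finset.mem_image_of_mem (fun f : ℤ => x⁻¹ * (f : ℝ)) hf1)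
      (Finset.mem_image_of_mem (fun f : ℤ => (f : ℝ)) hf0), ?_⟩
    have e' : (v1 : ℝ) - v2 = f0 + w := by
      have : v1 - v2 = f0 + w := by linarith
      exact_mod_cast this
    have key : x⁻¹ * ((f1 + (⌊x * v1⌋ - ⌊x * v2⌋) : ℤ) : ℝ) - w - (x⁻¹ * f1 + f0)
        = x⁻¹ * ((⌊x * v1⌋ - x * v1) - (⌊x * v2⌋ - x * v2)) := by
      have : (w : ℝ) = v1 - v2 - f0 := by linarith
      rw [this]; push_cast; field_simp; ring
    rw [key, abs_mul, abs_inv]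
    have a1 := Int.floor_le (x * v1)
    have a2 := Int.lt_floor_add_one (x * v1)
    have a3 := Int.floor_le (x * v2)
    have a4 := Int.lt_floor_add_one (x * v2)
    have : |((⌊x * v1⌋ : ℝ) - x * v1) - (⌊x * v2⌋ - x * v2)| ≤ 1 := by
      rw [abs_le]; constructor <;> linarith
    calc |x|⁻¹ * |((⌊x * v1⌋ : ℝ) - x * v1) - (⌊x * v2⌋ - x * v2)| ≤ L * 1 := by gcongr
      _ ≤ L ^ 10 := by
        rw [mul_one]
        simpa using pow_le_pow_right₀ (by linarith : 1 ≤ L) (by norm_num : 1 ≤ 10)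

theorem div (hV : IsApproxGroup V L) (hL : 2 ≤ L) (hx : IsMultiplier V L x)
    (hy : IsMultiplier V L y) (hy0 : y ≠ 0) (hyL : |y|⁻¹ ≤ L) :
    IsMultiplier V (L ^ 30) (x / y) := by
  have h1 : (1 : ℝ) ≤ L := by linarith
  have hLL : L ≤ L ^ 10 := by simpa using pow_le_pow_right₀ h1 (by norm_num : 1 ≤ 10)
  rw [div_eq_mul_inv]
  have := mul (by linarith) (hx.mono hLL) (hy.inv hV hL hy0 hyL)
  rwa [← pow_mul] at this

end IsMultiplier
/-! ### Counting multipliers -/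


theorem card_le_of_separated {B : Finset ℝ} {σ a ℓ : ℝ} (hσ : 0 < σ)
    (hsep : ∀ x ∈ B, ∀ y ∈ B, x ≠ y → σ ≤ |x - y|) (hB : ∀ x ∈ B, a ≤ x ∧ x ≤ a + ℓ)
    (hℓ : 0 ≤ ℓ) : (B.card : ℝ) ≤ ℓ / σ + 1 := by
  have hmaps : ∀ x ∈ B, ⌊(x - a) / σ⌋ ∈ Finset.Icc (0 : ℤ) ⌊ℓ / σ⌋ := by
    intro x hx
    rw [Finset.mem_Icc]
    constructor
    · exact Int.floor_nonneg.2 (div_nonneg (by linarith [(hB x hx).1]) hσ.le)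
    · exact Int.floor_le_floor (by gcongr; linarith [(hB x hx).2])
  have hinj : Set.InjOn (fun x : ℝ => ⌊(x - a) / σ⌋) B := by
    intro x hx y hy hxy
    by_contra hne
    have h1 := hsep x hx y hy hne
    have h2 := Int.abs_sub_lt_one_of_floor_eq_floor hxy
    rw [← sub_div, abs_div, abs_of_pos hσ, div_lt_one hσ] at h2
    have : x - a - (y - a) = x - y := by ring
    rw [this] at h2
    linarith
  have hc := Finset.card_le_card_of_injOn _ hmaps hinj
  rw [Int.card_Icc] at hc
  have h0 : 0 ≤ ⌊ℓ / σ⌋ := Int.floor_nonneg.2 (by positivity)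
  have : (B.card : ℤ) ≤ ⌊ℓ / σ⌋ + 1 := by omega
  have : (B.card : ℝ) ≤ ⌊ℓ / σ⌋ + 1 := by exact_mod_cast this
  linarith [Int.floor_le (ℓ / σ)]

/-- Pigeonhole principle in the form: some fibre has at least the average size. -/
theorem exists_card_fiber_ge {α β : Type*} [DecidableEq β] (s : Finset α) (t : Finset β)
    (f : α → β) (hf : ∀ a ∈ s, f a ∈ t) (ht : t.Nonempty) :
    ∃ b ∈ t, (s.card : ℝ) ≤ t.card * (s.filter (fun a => f a = b)).card := by
  by_contra! h
  have h1 := Finset.card_eq_sum_card_fiberwise hf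
  have h2 : (∑ b ∈ t, (t.card : ℝ) * (s.filter (fun a => f a = b)).card) < ∑ b ∈ t, (s.card : ℝ) :=
    Finset.sum_lt_sum_of_nonempty ht h
  rw [← Finset.mul_sum, Finset.sum_const, nsmul_eq_mul] at h2
  have h3 : (s.card : ℝ) = ∑ b ∈ t, ((s.filter (fun a => f a = b)).card : ℝ) := by exact_mod_cast h1
  rw [h3] at h2
  exact lt_irrefl _ h2

/-- A separated set of multipliers of `V` is not too large if `V` does not concentrate on intervals of
length `2 ℓ`. This is a double count of the triples of a multiplier `x` and `d, e ∈ V + V` with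
`|d| > ℓ` and `|x d - e| ≤ 2 L`: a multiplier occurs with many pairs `(d, e)`, namely differences of
points that share a translate, whereas `d, e` determine `x` up to an error `2 L / ℓ`. -/
theorem card_multipliers_le {V : Finset ℤ} {L ℓ σ : ℝ} (hV : IsApproxGroup V L) (hL : 1 ≤ L)
    (hσ : 0 < σ) (hℓ : 0 < ℓ)
    (hconc : ∀ x : ℝ, (V.filter (fun v : ℤ => |(v : ℝ) - x| ≤ ℓ)).card * (2 * L ^ 2) ≤ (V.card : ℝ))
    (S : Finset ℝ) (hS : ∀ x ∈ S, IsMultiplier V L x)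
    (hsep : ∀ x ∈ S, ∀ y ∈ S, x ≠ y → σ ≤ |x - y|) :
    (S.card : ℝ) ≤ 2 * L ^ 3 * V.card * (4 * L / (ℓ * σ) + 1) := by
  classical
  have hVpos : (0 : ℝ) < V.card := by exact_mod_cast Finset.card_pos.2 ⟨0, hV.zero_mem⟩
  set W := V + V with hW
  have hWc : (W.card : ℝ) ≤ L * V.card := hV.card_add_le
  -- few small differences
  have hsmall : ((W.filter (fun d : ℤ => |(d : ℝ)| ≤ ℓ)).card : ℝ) * (2 * L) ≤ V.card := by
    obtain ⟨F, hF, hadd⟩ := hV.add_mem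
    have hsub : W.filter (fun d : ℤ => |(d : ℝ)| ≤ ℓ) ⊆
        F.biUnion (fun f => (V.filter (fun v : ℤ => |(v : ℝ) - (-f : ℤ)| ≤ ℓ)).image (fun v => f + v)) := by
      intro d hd
      obtain ⟨hd1, hd2⟩ := Finset.mem_filter.1 hd
      obtain ⟨u, hu, v, hv, rfl⟩ := Finset.mem_add.1 hd1
      obtain ⟨f, hf, w, hw, e⟩ := hadd u hu v hv
      refine Finset.mem_biUnion.2 ⟨f, hf, Finset.mem_image.2 ⟨w, Finset.mem_filter.2 ⟨hw, ?_⟩, e.symm⟩⟩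
      rw [e] at hd2
      push_cast at hd2 ⊢
      rwa [sub_neg_eq_add, add_comm]
    have h1 : ((W.filter (fun d : ℤ => |(d : ℝ)| ≤ ℓ)).card : ℝ) * (2 * L ^ 2) ≤ F.card * V.card := by
      calc ((W.filter (fun d : ℤ => |(d : ℝ)| ≤ ℓ)).card : ℝ) * (2 * L ^ 2)
          ≤ (∑ f ∈ F, ((V.filter (fun v : ℤ => |(v : ℝ) - (-f : ℤ)| ≤ ℓ)).card : ℝ)) * (2 * L ^ 2) := by
            gcongr
            exact_mod_cast (Finset.card_le_card hsub).trans (Finset.card_biUnion_le.trans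
              (Finset.sum_le_sum fun f _ => Finset.card_image_le))
        _ = ∑ f ∈ F, ((V.filter (fun v : ℤ => |(v : ℝ) - (-f : ℤ)| ≤ ℓ)).card : ℝ) * (2 * L ^ 2) := by
            rw [Finset.sum_mul]
        _ ≤ ∑ f ∈ F, (V.card : ℝ) := Finset.sum_le_sum fun f _ => hconc _
        _ = F.card * V.card := by simp
    have h2 : (F.card : ℝ) * V.card ≤ L * V.card := by gcongr
    have h3 : L * (((W.filter (fun d : ℤ => |(d : ℝ)| ≤ ℓ)).card : ℝ) * (2 * L)) ≤ L * V.card := by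
      calc _ = ((W.filter (fun d : ℤ => |(d : ℝ)| ≤ ℓ)).card : ℝ) * (2 * L ^ 2) := by ring
        _ ≤ _ := h1.trans h2
    exact le_of_mul_le_mul_left h3 (by linarith)
  set P : Finset (ℤ × ℤ) := (W ×ˢ W).filter (fun p => ℓ < |(p.1 : ℝ)|) with hP
  let r : ℝ → ℤ × ℤ → Prop := fun x p => |x * p.1 - p.2| ≤ 2 * L
  have key : (S.card : ℝ) * (V.card / (2 * L)) ≤ P.card * (4 * L / (ℓ * σ) + 1) := by
    rw [← nsmul_eq_mul, ← nsmul_eq_mul]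
    refine Finset.card_nsmul_le_card_nsmul r ?_ ?_
    · intro x hx
      obtain ⟨-, F, hF, hx2⟩ := hS x hx
      choose! g hg f hf hgf using hx2
      have hFne : F.Nonempty := ⟨f 0, hf 0 hV.zero_mem⟩
      obtain ⟨b, hb, hcard⟩ := exists_card_fiber_ge V F f hf hFne
      set V' := V.filter (fun v => f v = b) with hV'
      have hVL : (V.card : ℝ) ≤ L * V'.card := hcard.trans (by gcongr)
      have hV'ne : V'.Nonempty := by
        rw [Finset.nonempty_iff_ne_empty]; intro h
        rw [h, Finset.card_empty] at hVL; push_cast at hVL; linarith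
      -- differences `v - v0` of points that use the same translate `b`; the translate cancels
      obtain ⟨v0, hv0⟩ := hV'ne
      have hv0' := Finset.mem_filter.1 hv0
      have hmem : ∀ v ∈ V', ℓ < |((v - v0 : ℤ) : ℝ)| → (v - v0, g v - g v0) ∈ P.bipartiteAbove r x := by
        intro v hv hvl
        have hv' := Finset.mem_filter.1 hv
        rw [Finset.mem_bipartiteAbove]
        refine ⟨?_, ?_⟩
        · rw [hP, Finset.mem_filter, Finset.mem_product]
          refine ⟨⟨?_, ?_⟩, hvl⟩
          · rw [sub_eq_add_neg]; exact Finset.add_mem_add hv'.1 (hV.neg_mem _ hv0'.1)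
          · rw [sub_eq_add_neg]; exact Finset.add_mem_add (hg _ hv'.1) (hV.neg_mem _ (hg _ hv0'.1))
        · show |x * ((v - v0 : ℤ) : ℝ) - ((g v - g v0 : ℤ) : ℝ)| ≤ 2 * L
          have h1 := hgf v hv'.1
          have h2 := hgf v0 hv0'.1
          rw [hv'.2] at h1
          rw [hv0'.2] at h2
          push_cast
          rw [abs_le] at *
          constructor <;> linarith [h1.1, h1.2, h2.1, h2.2]
      have hcount : V'.card ≤ (P.bipartiteAbove r x).card + (W.filter (fun d : ℤ => |(d : ℝ)| ≤ ℓ)).card := by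
        rw [← Finset.card_filter_add_card_filter_not (s := V') (fun v => ℓ < |((v - v0 : ℤ) : ℝ)|)]
        refine add_le_add ?_ ?_
        · refine Finset.card_le_card_of_injOn (fun v => (v - v0, g v - g v0)) ?_ ?_
          · intro v hv
            have := Finset.mem_filter.1 hv
            exact hmem v this.1 this.2
          · intro v _ v' _ h
            have := (Prod.ext_iff.1 h).1
            simpa using this
        · refine Finset.card_le_card_of_injOn (fun v => v - v0) ?_ ?_
          · intro v hv
            have := Finset.mem_filter.1 hv
            refine Finset.mem_coe.2 (Finset.mem_filter.2 ⟨?_, not_lt.1 this.2⟩)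
            show v - v0 ∈ W
            rw [sub_eq_add_neg]
            exact Finset.add_mem_add (Finset.mem_filter.1 this.1).1 (hV.neg_mem _ hv0'.1)
          · intro v _ v' _ h
            simpa using h
      have hcount' : (V'.card : ℝ) ≤ (P.bipartiteAbove r x).card +
          (W.filter (fun d : ℤ => |(d : ℝ)| ≤ ℓ)).card := by exact_mod_cast hcount
      rw [div_le_iff₀ (by linarith)]
      nlinarith
    · intro p hp
      have hp' := (Finset.mem_filter.1 hp).2
      have hpp : 0 < |(p.1 : ℝ)| := hℓ.trans hp'
      have hp0 : (p.1 : ℝ) ≠ 0 := abs_pos.1 hpp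
      have hb : ∀ x ∈ S.bipartiteBelow r p, (p.2 : ℝ) / p.1 - 2 * L / ℓ ≤ x ∧
          x ≤ (p.2 : ℝ) / p.1 - 2 * L / ℓ + 4 * L / ℓ := by
        intro x hx
        have hx' : |x * p.1 - p.2| ≤ 2 * L := ((Finset.mem_bipartiteBelow r).1 hx).2
        have : |x - p.2 / p.1| ≤ 2 * L / ℓ := by
          have e : x - p.2 / p.1 = (x * p.1 - p.2) / p.1 := by field_simp
          rw [e, abs_div]
          gcongr
        rw [abs_le] at this
        have e : 4 * L / ℓ = 2 * L / ℓ + 2 * L / ℓ := by ring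
        constructor <;> linarith [this.1, this.2]
      have := card_le_of_separated (B := S.bipartiteBelow r p) hσ (fun x hx y hy =>
        hsep x ((Finset.mem_bipartiteBelow r).1 hx).1 y ((Finset.mem_bipartiteBelow r).1 hy).1) hb (by positivity)
      rwa [div_div] at this
  have hPc : (P.card : ℝ) ≤ (L * V.card) * (L * V.card) := by
    calc (P.card : ℝ) ≤ ((W ×ˢ W).card : ℝ) := by exact_mod_cast Finset.card_filter_le _ _
      _ = W.card * W.card := by rw [Finset.card_product]; push_cast; ring
      _ ≤ _ := by gcongr
  have h2 : (S.card : ℝ) * (V.card / (2 * L)) ≤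
      (L * V.card) * (L * V.card) * (4 * L / (ℓ * σ) + 1) := by
    refine key.trans ?_
    gcongr
  have h3 : (S.card : ℝ) * (V.card / (2 * L)) * (2 * L / V.card) ≤
      (L * V.card) * (L * V.card) * (4 * L / (ℓ * σ) + 1) * (2 * L / V.card) := by
    gcongr
  have e1 : (S.card : ℝ) * (V.card / (2 * L)) * (2 * L / V.card) = S.card := by
    field_simp
  have e2 : (L * V.card) * (L * V.card) * (4 * L / (ℓ * σ) + 1) * (2 * L / V.card)
     = 2 * L ^ 3 * V.card * (4 * L / (ℓ * σ) + 1) := by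
    field_simp
  linarith
/-! ### Separated sets and quotients -/


/-- The quotients `(a - b) / (c - d)` of elements of `A`, with denominators of size at least `ρ`, are
`s`-dense in `[0, 1]`. -/
def QuotientDense (A : Finset ℝ) (ρ s : ℝ) : Prop :=
  ∀ x : ℝ, 0 ≤ x → x ≤ 1 → ∃ a ∈ A, ∃ b ∈ A, ∃ c ∈ A, ∃ d ∈ A,
    ρ ≤ |c - d| ∧ |x - (a - b) / (c - d)| ≤ s

/-- `A` contains at least `m` points that are pairwise `r`-separated. The bound `m` is real, so that
it can be a power of `r`. -/
def HasSeparated (A : Finset ℝ) (r m : ℝ) : Prop :=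
  ∃ B ⊆ A, m ≤ B.card ∧ ∀ x ∈ B, ∀ y ∈ B, x ≠ y → r ≤ |x - y|

theorem HasSeparated.mono {A A' : Finset ℝ} {r r' m m' : ℝ} (h : HasSeparated A r m)
    (hA : A ⊆ A') (hr : r' ≤ r) (hm : m' ≤ m) : HasSeparated A' r' m' := by
  obtain ⟨B, hB, h1, h2⟩ := h
  exact ⟨B, hB.trans hA, hm.trans h1, fun x hx y hy hxy => hr.trans (h2 x hx y hy hxy)⟩

theorem hasSeparated_one {A : Finset ℝ} {a r m : ℝ} (ha : a ∈ A) (hm : m ≤ 1) :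
    HasSeparated A r m := by
  refine ⟨{a}, by simpa using ha, by simpa using hm, ?_⟩
  intro x hx y hy hxy
  simp only [Finset.mem_singleton] at hx hy
  exact absurd (hx.trans hy.symm) hxy

theorem HasSeparated.le {A : Finset ℝ} {r m L : ℝ} (h : HasSeparated A r m) (hr : 0 < r)
    (hL : 0 ≤ L) (hA : ∀ a ∈ A, |a| ≤ L) : m ≤ 2 * L / r + 1 := by
  obtain ⟨B, hB, h1, h2⟩ := h
  refine h1.trans (card_le_of_separated (a := -L) hr h2 (fun x hx => ?_) (by linarith))
  have := abs_le.1 (hA x (hB hx))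
  constructor <;> linarith

/-- If the quotients of `A` are not dense, then half of some quotient, or of `1` plus some quotient, is
far from all quotients. Otherwise binary expansions would show density: every `x ∈ [0, 1]` is
`(y + e) / 2` with `y ∈ [0, 1]` and `e ∈ {0, 1}`, and the error of approximation halves at each
step, up to an additive `s`. -/
theorem exists_far_quotient {A : Finset ℝ} {ρ s : ℝ} (hs : 0 < s) (hs1 : s ≤ 1 / 2)
    (hA : ∃ c ∈ A, ∃ d ∈ A, ρ ≤ |c - d|) (hd : ¬ QuotientDense A ρ (4 * s)) :
    ∃ a ∈ A, ∃ b ∈ A, ∃ c ∈ A, ∃ d ∈ A, ρ ≤ |c - d| ∧ |(a - b) / (c - d)| ≤ 3 ∧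
      ∃ e : ℝ, (e = 0 ∨ e = 1) ∧ ∀ a' ∈ A, ∀ b' ∈ A, ∀ c' ∈ A, ∀ d' ∈ A, ρ ≤ |c' - d'| →
        s < |((a - b) / (c - d) + e) / 2 - (a' - b') / (c' - d')| := by
  by_contra! hcon
  apply hd
  have key : ∀ n : ℕ, ∀ x : ℝ, 0 ≤ x → x ≤ 1 → ∃ a ∈ A, ∃ b ∈ A, ∃ c ∈ A, ∃ d ∈ A,
      ρ ≤ |c - d| ∧ |x - (a - b) / (c - d)| ≤ (1 / 2) ^ n + 2 * s := by
    intro n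
    induction n with
    | zero =>
      intro x h0 h1
      obtain ⟨c, hc, d, hd, h⟩ := hA
      refine ⟨c, hc, c, hc, c, hc, d, hd, h, ?_⟩
      simp only [sub_self, zero_div, sub_zero, pow_zero]
      rw [abs_of_nonneg h0]; linarith
    | succ n ih =>
      intro x h0 h1
      obtain ⟨e, he, hz0, hz1⟩ : ∃ e : ℝ, (e = 0 ∨ e = 1) ∧ 0 ≤ 2 * x - e ∧ 2 * x - e ≤ 1 := by
        by_cases hx : x ≤ 1 / 2
        · exact ⟨0, Or.inl rfl, by linarith, by linarith⟩
        · exact ⟨1, Or.inr rfl, by linarith, by linarith⟩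
      obtain ⟨a, ha, b, hb, c, hc, d, hd, h, hy⟩ := ih _ hz0 hz1
      have hp : ((1 : ℝ) / 2) ^ n ≤ 1 := pow_le_one₀ (by norm_num) (by norm_num)
      have h3 : |(a - b) / (c - d)| ≤ 3 := by
        rw [abs_le] at hy ⊢
        constructor <;> linarith [hy.1, hy.2]
      obtain ⟨a', ha', b', hb', c', hc', d', hd', h', hy'⟩ := hcon a ha b hb c hc d hd h h3 e he
      refine ⟨a', ha', b', hb', c', hc', d', hd', h', ?_⟩
      rw [pow_succ]
      rw [abs_le] at *
      constructor <;> linarith [hy.1, hy.2, hy'.1, hy'.2]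
  obtain ⟨n, hn⟩ := exists_pow_lt_of_lt_one hs (by norm_num : (1 : ℝ) / 2 < 1)
  intro x h0 h1
  obtain ⟨a, ha, b, hb, c, hc, d, hd, h, hy⟩ := key n x h0 h1
  exact ⟨a, ha, b, hb, c, hc, d, hd, h, by linarith⟩

/-- If `ξ` is far from all quotients of `A`, then the points `x + 2 q (y + ξ z)` with `x, y, z` in
separated subsets of `A` are separated. Indeed the points `y + ξ z` are separated because
`y - y' + ξ (z - z') = (z - z') (ξ - (y' - y) / (z - z'))`, and after scaling by `2 q` they lie in an
interval that is shorter than the gaps between the `x`. -/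
theorem HasSeparated.gain {A : Finset ℝ} {L ρ s r q ξ m₁ m₂ m₃ : ℝ}
    (hA : ∀ a ∈ A, |a| ≤ L) (hq : q ≠ 0) (hξ : |ξ| ≤ 2) (hr : 0 < r) (hrρ : r ≤ ρ * s)
    (hrL : r ≤ L) (hs : 0 ≤ s)
    (hfar : ∀ a ∈ A, ∀ b ∈ A, ∀ c ∈ A, ∀ d ∈ A, ρ ≤ |c - d| → s < |ξ - (a - b) / (c - d)|)
    (h₁ : HasSeparated A (14 * L * |q|) m₁) (h₂ : HasSeparated A r m₂) (h₃ : HasSeparated A ρ m₃)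
    (hm₂ : 0 ≤ m₂) (hm₃ : 0 ≤ m₃) :
    HasSeparated ((A ×ˢ A ×ˢ A).image (fun t => t.1 + 2 * q * (t.2.1 + ξ * t.2.2)))
      (2 * |q| * r) (m₁ * m₂ * m₃) := by
  classical
  obtain ⟨B₁, hB₁, c₁, s₁⟩ := h₁
  obtain ⟨B₂, hB₂, c₂, s₂⟩ := h₂
  obtain ⟨B₃, hB₃, c₃, s₃⟩ := h₃
  have hq' : 0 < |q| := abs_pos.2 hq
  have hL0 : 0 ≤ L := hr.le.trans hrL
  set φ : ℝ × ℝ × ℝ → ℝ := fun t => t.1 + 2 * q * (t.2.1 + ξ * t.2.2) with hφ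
  have hsep : ∀ t ∈ B₁ ×ˢ B₂ ×ˢ B₃, ∀ t' ∈ B₁ ×ˢ B₂ ×ˢ B₃, t ≠ t' → 2 * |q| * r ≤ |φ t - φ t'| := by
    rintro ⟨x, y, z⟩ ht ⟨x', y', z'⟩ ht' hne
    simp only [Finset.mem_product] at ht ht'
    obtain ⟨hx, hy, hz⟩ := ht
    obtain ⟨hx', hy', hz'⟩ := ht'
    simp only [hφ]
    by_cases hxx : x = x'
    · subst hxx
      have e : x + 2 * q * (y + ξ * z) - (x + 2 * q * (y' + ξ * z'))
          = 2 * q * (y - y' + ξ * (z - z')) := by ring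
      rw [e, abs_mul, abs_mul, abs_two]
      refine mul_le_mul_of_nonneg_left ?_ (by positivity)
      by_cases hzz : z = z'
      · subst hzz
        have hyy : y ≠ y' := fun h => hne (by rw [h])
        simpa using s₂ y hy y' hy' hyy
      · have h1 := s₃ z hz z' hz' hzz
        have h2 := hfar y' (hB₂ hy') y (hB₂ hy) z (hB₃ hz) z' (hB₃ hz') h1
        have hz0 : z - z' ≠ 0 := sub_ne_zero.2 hzz
        have e : y - y' + ξ * (z - z') = (z - z') * (ξ - (y' - y) / (z - z')) := by
          field_simp; ring
        rw [e, abs_mul]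
        exact hrρ.trans (mul_le_mul h1 h2.le hs (abs_nonneg _))
    · have h1 := s₁ x hx x' hx' hxx
      have ay := hA y (hB₂ hy)
      have ay' := hA y' (hB₂ hy')
      have az := hA z (hB₃ hz)
      have az' := hA z' (hB₃ hz')
      have e : x + 2 * q * (y + ξ * z) - (x' + 2 * q * (y' + ξ * z'))
          = (x - x') - 2 * q * (-((y - y') + ξ * (z - z'))) := by ring
      have h2 : |2 * q * (-((y - y') + ξ * (z - z')))| ≤ 12 * L * |q| := by
        rw [abs_mul, abs_mul, abs_two, abs_neg]
        have h3 : |y - y' + ξ * (z - z')| ≤ 6 * L := by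
          refine (abs_add_le _ _).trans ?_
          rw [abs_mul]
          have h4 : |y - y'| ≤ 2 * L := (abs_sub _ _).trans (by linarith)
          have h5 : |z - z'| ≤ 2 * L := (abs_sub _ _).trans (by linarith)
          have h6 : |ξ| * |z - z'| ≤ 2 * (2 * L) := by gcongr
          linarith
        calc 2 * |q| * |y - y' + ξ * (z - z')| ≤ 2 * |q| * (6 * L) := by gcongr
          _ = 12 * L * |q| := by ring
      rw [e]
      have h3 := abs_sub_abs_le_abs_sub (x - x') (2 * q * (-((y - y') + ξ * (z - z'))))
      have h4 : |q| * r ≤ |q| * L := by gcongr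
      linarith
  refine ⟨(B₁ ×ˢ B₂ ×ˢ B₃).image φ, ?_, ?_, ?_⟩
  · exact Finset.image_subset_image (Finset.product_subset_product hB₁
      (Finset.product_subset_product hB₂ hB₃))
  · rw [Finset.card_image_of_injOn]
    · rw [Finset.card_product, Finset.card_product]
      push_cast
      rw [mul_assoc]
      gcongr
    · intro t ht t' ht' h
      by_contra hne
      have := hsep t ht t' ht' hne
      simp only [h, sub_self, abs_zero] at this
      have : 0 < 2 * |q| * r := by positivity
      linarith
  · intro u hu v hv huv
    obtain ⟨t, ht, rfl⟩ := Finset.mem_image.1 hu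
    obtain ⟨t', ht', rfl⟩ := Finset.mem_image.1 hv
    exact hsep t ht t' ht' (fun h => huv (by rw [h]))

/-- When the quotients of `A` are not dense, `A` can be enlarged, within the multipliers, to a set with
many more separated points. The factor `q` is the denominator of the quotient that `ξ` comes from:
`2 q ξ = a - b + e q` is a multiplier whose loss does not depend on the size of `q`, so that no
division is needed. -/
theorem exists_gain {V : Finset ℤ} {A : Finset ℝ} {L ρ s r m₂ m₃ : ℝ} (hV : IsApproxGroup V L)
    (hL : 2 ≤ L) (hA : ∀ a ∈ A, IsMultiplier V L a) (h0 : 0 ∈ A)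
    (hρ : 0 < ρ) (hs : 0 < s) (hs1 : s ≤ 1 / 2) (hd : ¬ QuotientDense A ρ (4 * s))
    (hA2 : ∃ c ∈ A, ∃ d ∈ A, ρ ≤ |c - d|)
    (hr : 0 < r) (hrρ : r ≤ ρ * s) (hrL : r ≤ L)
    (h₂ : HasSeparated A r m₂) (h₃ : HasSeparated A ρ m₃) (hm₂ : 0 ≤ m₂) (hm₃ : 0 ≤ m₃) :
    ∃ A' : Finset ℝ, A ⊆ A' ∧ (∀ a ∈ A', IsMultiplier V (L ^ 243) a) ∧ ∃ q : ℝ, ρ ≤ |q| ∧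
      ∀ m₁, HasSeparated A (14 * L * |q|) m₁ → HasSeparated A' (2 * |q| * r) (m₁ * m₂ * m₃) := by
  classical
  obtain ⟨a, ha, b, hb, c, hc, d, hd, hcd, h3, e, he, hfar⟩ := exists_far_quotient hs hs1 hA2 hd
  set q := c - d with hq
  have hq0 : q ≠ 0 := by
    intro h; rw [h, abs_zero] at hcd; linarith
  set ξ := ((a - b) / q + e) / 2 with hξ
  have he' : 0 ≤ e ∧ e ≤ 1 := by rcases he with rfl | rfl <;> norm_num
  refine ⟨(A ×ˢ A ×ˢ A).image (fun t => t.1 + 2 * q * (t.2.1 + ξ * t.2.2)), ?_, ?_, q, hcd, ?_⟩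
  · intro x hx
    refine Finset.mem_image.2 ⟨(x, 0, 0), ?_, by simp⟩
    simp [Finset.mem_product, hx, h0]
  · intro u hu
    obtain ⟨⟨x, y, z⟩, ht, rfl⟩ := Finset.mem_image.1 hu
    simp only [Finset.mem_product] at ht
    obtain ⟨hx, hy, hz⟩ := ht
    have h1 : (1 : ℝ) ≤ L := by linarith
    have m3 : L ≤ L ^ 3 := by simpa using pow_le_pow_right₀ h1 (by norm_num : 1 ≤ 3)
    have hL3 : 2 ≤ L ^ 3 := hL.trans m3
    have up : ∀ n m : ℕ, n ≤ m → L ^ n ≤ L ^ m := fun n m h => pow_le_pow_right₀ h1 h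
    have up1 : ∀ m : ℕ, 1 ≤ m → L ≤ L ^ m := fun m h => by simpa using up 1 m h
    have two : ∀ m : ℕ, 1 ≤ m → 2 ≤ L ^ m := fun m h => hL.trans (up1 m h)
    have Vm : ∀ m : ℕ, 1 ≤ m → IsApproxGroup V (L ^ m) := fun m h => hV.mono (up1 m h)
    have hqm : IsMultiplier V (L ^ 3) q := (hA c hc).sub hV hL (hA d hd)
    have habm : IsMultiplier V (L ^ 3) (a - b) := (hA a ha).sub hV hL (hA b hb)
    have hpm : IsMultiplier V (L ^ 9) (a - b + e * q) := by
      rcases he with rfl | rfl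
      · rw [zero_mul, add_zero]; exact habm.mono (up 3 9 (by norm_num))
      · rw [one_mul]
        have := habm.add (Vm 3 (by norm_num)) (two 3 (by norm_num)) hqm
        rwa [← pow_mul] at this
    have hqq : IsMultiplier V (L ^ 9) (q + q) := by
      have := hqm.add (Vm 3 (by norm_num)) (two 3 (by norm_num)) hqm
      rwa [← pow_mul] at this
    have t1 : IsMultiplier V (L ^ 27) ((q + q) * y) := by
      have := hqq.mul (two 9 (by norm_num)) ((hA y hy).mono (up1 9 (by norm_num)))
      rwa [← pow_mul] at this
    have t2 : IsMultiplier V (L ^ 27) ((a - b + e * q) * z) := by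
      have := hpm.mul (two 9 (by norm_num)) ((hA z hz).mono (up1 9 (by norm_num)))
      rwa [← pow_mul] at this
    have t3 : IsMultiplier V (L ^ 81) ((q + q) * y + (a - b + e * q) * z) := by
      have := t1.add (Vm 27 (by norm_num)) (two 27 (by norm_num)) t2
      rwa [← pow_mul] at this
    have t4 : IsMultiplier V (L ^ 243) (x + ((q + q) * y + (a - b + e * q) * z)) := by
      have := ((hA x hx).mono (up1 81 (by norm_num))).add (Vm 81 (by norm_num))
        (two 81 (by norm_num)) t3
      rwa [← pow_mul] at this
    convert t4 using 1
    simp only [hξ]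
    field_simp
    ring
  · intro m₁ h₁
    refine HasSeparated.gain (fun a ha => (hA a ha).1) hq0 ?_ hr hrρ hrL hs.le hfar h₁ h₂ h₃ hm₂ hm₃
    rw [hξ, abs_div, abs_two]
    have := abs_add_le ((a - b) / q) e
    rw [abs_of_nonneg he'.1] at this
    linarith

/-- Iteration of `exists_gain`. Each step multiplies the number of separated points by `M`, the number
of `ρ`-separated points of the initial set, and also by the power `-κ` of the factor `min |q| 1`
by which the scale shrinks. The scales are not under control, except for the bounds
`ρ ^ n * (ρ * s) ≤ r ≤ ρ * s`. -/
theorem exists_iterated_gain {V : Finset ℤ} {A : Finset ℝ} {L κ ρ s M : ℝ} (k : ℕ)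
    (hV : IsApproxGroup V L) (hL : 2 ≤ L) (hκ : 0 < κ) (hκ1 : κ ≤ 1)
    (hA : ∀ a ∈ A, IsMultiplier V L a) (h0 : 0 ∈ A)
    (hρ : 0 < ρ) (hρ1 : ρ ≤ 1) (hs : 0 < s) (hs1 : s ≤ 1 / 2)
    (hsep : ∀ r : ℝ, ρ * s ≤ r → r ≤ 1 → HasSeparated A r (r ^ (-κ) / L))
    (hM : HasSeparated A ρ M) (hM0 : 1 < M)
    (hd : ∀ A' : Finset ℝ, (∀ a ∈ A', IsMultiplier V (L ^ 243 ^ k) a) → ¬ QuotientDense A' ρ (4 * s)) :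
    ∀ n ≤ k, ∃ A' : Finset ℝ, A ⊆ A' ∧ (∀ a ∈ A', IsMultiplier V (L ^ 243 ^ n) a) ∧ ∃ r : ℝ,
      ρ ^ n * (ρ * s) ≤ r ∧ r ≤ ρ * s ∧
      HasSeparated A' r (M ^ n * r ^ (-κ) / (L ^ 243 ^ n) ^ 6) := by
  have h1L : (1 : ℝ) ≤ L := by linarith
  have hρs : 0 < ρ * s := by positivity
  have hρs1 : ρ * s ≤ 1 := by nlinarith
  intro n
  induction n with
  | zero =>
    intro _
    refine ⟨A, subset_rfl, by simpa using hA, ρ * s, by simp, le_rfl, ?_⟩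
    refine (hsep _ le_rfl hρs1).mono subset_rfl le_rfl ?_
    simp only [pow_zero, pow_one, one_mul]
    have : L ≤ L ^ 6 := by simpa using pow_le_pow_right₀ h1L (by norm_num : 1 ≤ 6)
    have : 0 ≤ (ρ * s) ^ (-κ) := by positivity
    gcongr
  | succ n ih =>
    intro hn
    obtain ⟨A₁, hAA, hA₁, r, hr1, hr2, hr3⟩ := ih (by omega)
    set Ln := L ^ 243 ^ n with hLn
    have hLLn : L ≤ Ln := by
      simpa using pow_le_pow_right₀ h1L (Nat.one_le_pow n 243 (by norm_num))
    have hLn2 : 2 ≤ Ln := hL.trans hLLn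
    have hLn1 : 1 ≤ Ln := by linarith
    have hr0 : 0 < r := lt_of_lt_of_le (by positivity) hr1
    have hsucc : L ^ 243 ^ (n + 1) = Ln ^ 243 := by rw [hLn, ← pow_mul, pow_succ]
    have hle : Ln ≤ L ^ 243 ^ k := pow_le_pow_right₀ h1L (Nat.pow_le_pow_right (by norm_num) (by omega))
    obtain ⟨B, hBA, hBc, hBs⟩ := hM
    have hA2 : ∃ c ∈ A₁, ∃ d ∈ A₁, ρ ≤ |c - d| := by
      have : 1 < B.card := by exact_mod_cast lt_of_lt_of_le hM0 hBc
      obtain ⟨c, hc, d, hd, hcd⟩ := Finset.one_lt_card.1 this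
      exact ⟨c, hAA (hBA hc), d, hAA (hBA hd), hBs c hc d hd hcd⟩
    have hm2 : 0 ≤ M ^ n * r ^ (-κ) / Ln ^ 6 := by positivity
    obtain ⟨A₂, h12, hA₂, q, hρq, hgain⟩ := exists_gain (hV.mono hLLn) hLn2 hA₁ (hAA h0) hρ hs hs1
      (hd A₁ fun a ha => (hA₁ a ha).mono hle) hA2 hr0 hr2 (by linarith) hr3
      (m₃ := M) ⟨B, hBA.trans hAA, hBc, hBs⟩ hm2 (by linarith)
    have hq : 0 < |q| := hρ.trans_le hρq
    -- the scale must not grow, but the new factor `|q|` may exceed `1`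
    set q₁ := min |q| 1 with hq₁
    have hq₁0 : 0 < q₁ := lt_min hq one_pos
    have hq₁1 : q₁ ≤ 1 := min_le_right _ _
    have hρq₁ : ρ ≤ q₁ := le_min hρq hρ1
    have hsep1 : HasSeparated A₁ (14 * Ln * |q|) (q₁ ^ (-κ) / (14 * Ln * L)) := by
      have h14 : 1 ≤ 14 * Ln := by linarith
      have h14κ : (14 * Ln) ^ κ ≤ 14 * Ln := by
        simpa using Real.rpow_le_rpow_of_exponent_le h14 hκ1
      by_cases hc : 14 * Ln * |q| ≤ 1
      · have hq11 : |q| ≤ 1 := by nlinarith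
        have : q₁ = |q| := min_eq_left hq11
        rw [this]
        refine (hsep _ ?_ hc).mono hAA le_rfl ?_
        · have : ρ * s ≤ ρ * 1 := by gcongr; linarith
          nlinarith
        · rw [Real.mul_rpow (by positivity) hq.le, ← div_div]
          refine div_le_div_of_nonneg_right ?_ (by linarith)
          rw [div_eq_mul_inv, mul_comm]
          gcongr
          rw [Real.rpow_neg (by positivity)]
          gcongr
      · have hc' : 1 ≤ 14 * Ln * q₁ := by
          rw [hq₁]
          rcases le_total |q| 1 with h | h
          · rw [min_eq_left h]; linarith
          · rw [min_eq_right h]; linarith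
        refine hasSeparated_one (hAA h0) ?_
        rw [div_le_one (by positivity)]
        have h5 : q₁⁻¹ ≤ 14 * Ln := by
          rw [inv_le_iff_one_le_mul₀ hq₁0]; linarith
        calc q₁ ^ (-κ) = (q₁⁻¹) ^ κ := by rw [Real.rpow_neg hq₁0.le, Real.inv_rpow hq₁0.le]
          _ ≤ (14 * Ln) ^ κ := by gcongr
          _ ≤ 14 * Ln := h14κ
          _ ≤ 14 * Ln * L := by nlinarith
    have hfin := hgain _ hsep1
    refine ⟨A₂, hAA.trans h12, ?_, q₁ * r, ?_, ?_, hfin.mono subset_rfl ?_ ?_⟩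
    · rw [hsucc]; exact hA₂
    · rw [pow_succ]
      calc ρ ^ n * ρ * (ρ * s) = ρ * (ρ ^ n * (ρ * s)) := by ring
        _ ≤ q₁ * r := by gcongr
    · calc q₁ * r ≤ 1 * r := by gcongr
        _ ≤ ρ * s := by linarith
    · calc q₁ * r ≤ |q| * r := by gcongr; exact min_le_left _ _
        _ ≤ 2 * |q| * r := by nlinarith
    · rw [hsucc, Real.mul_rpow hq₁0.le hr0.le]
      have e : q₁ ^ (-κ) / (14 * Ln * L) * (M ^ n * r ^ (-κ) / Ln ^ 6) * M
          = M ^ (n + 1) * (q₁ ^ (-κ) * r ^ (-κ)) / (14 * Ln * L * Ln ^ 6) := by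
        field_simp
        exact (pow_succ M n).symm
      rw [e]
      have hb : 14 * Ln * L * Ln ^ 6 ≤ (Ln ^ 243) ^ 6 := by
        calc 14 * Ln * L * Ln ^ 6 ≤ Ln ^ 4 * Ln * Ln * Ln ^ 6 := by
              gcongr
              calc (14 : ℝ) ≤ 2 ^ 4 := by norm_num
                _ ≤ Ln ^ 4 := by gcongr
          _ = Ln ^ 12 := by ring
          _ ≤ Ln ^ (243 * 6) := pow_le_pow_right₀ hLn1 (by norm_num)
          _ = (Ln ^ 243) ^ 6 := by rw [pow_mul]
      gcongr
/-! ### Dense quotients and digit expansions -/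


/-- If multipliers with loss `L` are `s`-dense in `[-1, 1]`, then multipliers whose loss is a bounded
power of `L` are `(3 s) ^ m`-dense. They are the expansions `y₀ + s₁ y₁ + s₁² y₂ + …` with `m` digits,
where the base `s₁` is a multiplier close to `2 s`. -/
theorem exists_multiplier_near_of_dense {V : Finset ℤ} {L s : ℝ} (hV : IsApproxGroup V L)
    (hL : 2 ≤ L) (hs : 0 < s) (hs1 : s ≤ 1 / 2)
    (hd : ∀ x : ℝ, |x| ≤ 1 → ∃ y, IsMultiplier V L y ∧ |x - y| ≤ s) (m : ℕ) :
    ∀ x : ℝ, |x| ≤ 1 → ∃ y, IsMultiplier V (L ^ 9 ^ m) y ∧ |x - y| ≤ (3 * s) ^ m := by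
  have h1L : (1 : ℝ) ≤ L := by linarith
  -- the base of the expansion lies in `[s, 3 s]`, so a remainder of size `s` rescales to `[-1, 1]`
  obtain ⟨s₁, hs₁, hs₁'⟩ := hd (2 * s) (by rw [abs_of_pos (by linarith)]; linarith)
  have hs₁'' := abs_le.1 hs₁'
  have hpos : 0 < s₁ := by linarith
  induction m with
  | zero => exact fun x hx => ⟨0, IsMultiplier.zero hV (by simpa using h1L), by simpa using hx⟩
  | succ m ih =>
    intro x hx
    have hLm : L ≤ L ^ 9 ^ m := by
      simpa using pow_le_pow_right₀ h1L (Nat.one_le_pow m 9 (by norm_num))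
    set Lm := L ^ 9 ^ m with hLmdef
    have hLm3 : Lm ≤ Lm ^ 3 := by
      simpa using pow_le_pow_right₀ (h1L.trans hLm) (by norm_num : 1 ≤ 3)
    obtain ⟨y₀, hy₀, hy₀'⟩ := hd x hx
    obtain ⟨y, hy, hy'⟩ := ih ((x - y₀) / s₁) (by
      rw [abs_div, abs_of_pos hpos, div_le_one hpos]; linarith)
    refine ⟨y₀ + s₁ * y, ?_, ?_⟩
    · have h2 := IsMultiplier.mul (hL.trans hLm) (hs₁.mono hLm) hy
      have h3 := (hy₀.mono (hLm.trans hLm3)).add (hV.mono (hLm.trans hLm3))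
        (hL.trans (hLm.trans hLm3)) h2
      have e : (Lm ^ 3) ^ 3 = L ^ 9 ^ (m + 1) := by
        rw [hLmdef, ← pow_mul, ← pow_mul, pow_succ 9]
      rwa [e] at h3
    · have e : x - (y₀ + s₁ * y) = s₁ * ((x - y₀) / s₁ - y) := by field_simp; ring
      rw [e, abs_mul, abs_of_pos hpos, pow_succ, mul_comm]
      gcongr
      linarith

/-- Quotients of multipliers are multipliers, so dense quotients make the multipliers dense in
`[-1, 1]`. -/
theorem QuotientDense.exists_multiplier_near {V : Finset ℤ} {A : Finset ℝ} {L ρ s : ℝ}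
    (hV : IsApproxGroup V L) (hL : 2 ≤ L) (hA : ∀ a ∈ A, IsMultiplier V L a)
    (hd : QuotientDense A ρ s) (hρ : 0 < ρ) (hρL : ρ⁻¹ ≤ L) :
    ∀ x : ℝ, |x| ≤ 1 → ∃ y, IsMultiplier V (L ^ 90) y ∧ |x - y| ≤ s := by
  have h1L : (1 : ℝ) ≤ L := by linarith
  have hL3 : L ≤ L ^ 3 := by simpa using pow_le_pow_right₀ h1L (by norm_num : 1 ≤ 3)
  have key : ∀ x : ℝ, 0 ≤ x → x ≤ 1 → ∃ y, IsMultiplier V (L ^ 90) y ∧ |x - y| ≤ s := by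
    intro x h0 h1
    obtain ⟨a, ha, b, hb, c, hc, d, hd, h, h'⟩ := hd x h0 h1
    refine ⟨_, ?_, h'⟩
    have hpos : 0 < |c - d| := hρ.trans_le h
    have := ((hA a ha).sub hV hL (hA b hb)).div (hV.mono hL3) (hL.trans hL3)
      ((hA c hc).sub hV hL (hA d hd)) (abs_pos.1 hpos)
      ((inv_anti₀ hρ h).trans (hρL.trans hL3))
    rwa [← pow_mul] at this
  intro x hx
  rw [abs_le] at hx
  rcases le_total 0 x with h | h
  · exact key x h hx.2
  · obtain ⟨y, hy, hy'⟩ := key (-x) (by linarith) (by linarith)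
    refine ⟨-y, hy.neg hV, ?_⟩
    rw [← abs_neg]
    convert hy' using 2
    ring

/-- If the quotients of a set of multipliers are dense, then there are about `R` multipliers that are
`1 / (2 R)`-separated, and `card_multipliers_le` gives a lower bound for the size of `V`. -/
theorem QuotientDense.le_card {V : Finset ℤ} {A : Finset ℝ} {L Lf ρ s ℓ R : ℝ} {m : ℕ}
    (hV : IsApproxGroup V L) (hL : 2 ≤ L) (hA : ∀ a ∈ A, IsMultiplier V L a)
    (hd : QuotientDense A ρ s) (hρ : 0 < ρ) (hρL : ρ⁻¹ ≤ L) (hs : 0 < s) (hs1 : s ≤ 1 / 2)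
    (hLf : Lf = (L ^ 90) ^ 9 ^ m) (hR : 1 ≤ R) (hm : (3 * s) ^ m ≤ 1 / (4 * R)) (hℓ : 0 < ℓ)
    (hconc : ∀ x : ℝ, (V.filter (fun v : ℤ => |(v : ℝ) - x| ≤ ℓ)).card * (2 * Lf ^ 2) ≤ (V.card : ℝ)) :
    R ≤ 2 * Lf ^ 3 * V.card * (4 * Lf / (ℓ * (1 / (2 * R))) + 1) := by
  classical
  have h1L : (1 : ℝ) ≤ L := by linarith
  have hL90 : L ≤ L ^ 90 := by simpa using pow_le_pow_right₀ h1L (by norm_num : 1 ≤ 90)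
  have hL90f : L ^ 90 ≤ Lf := by
    rw [hLf]
    simpa using pow_le_pow_right₀ (h1L.trans hL90) (Nat.one_le_pow m 9 (by norm_num))
  have h := exists_multiplier_near_of_dense (hV.mono hL90) (hL.trans hL90) hs hs1
    (hd.exists_multiplier_near hV hL hA hρ hρL) m
  rw [← hLf] at h
  have hR0 : 0 < R := by linarith
  choose! y hy hy' using h
  -- multipliers close to the points `j / R` with `0 ≤ j ≤ R`
  set J := Finset.range (⌊R⌋₊ + 1) with hJ
  have hJ1 : ∀ j ∈ J, |(j : ℝ) / R| ≤ 1 := by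
    intro j hj
    rw [abs_of_nonneg (by positivity), div_le_one hR0]
    have : j ≤ ⌊R⌋₊ := by
      have := Finset.mem_range.1 hj; omega
    exact (Nat.cast_le.2 this).trans (Nat.floor_le hR0.le)
  have hsep : ∀ i ∈ J, ∀ j ∈ J, i ≠ j → 1 / (2 * R) ≤ |y (i / R) - y (j / R)| := by
    intro i hi j hj hij
    have h1 := (hy' _ (hJ1 i hi)).trans hm
    have h2 := (hy' _ (hJ1 j hj)).trans hm
    have h3 : 1 / R ≤ |(i : ℝ) / R - j / R| := by
      rw [← sub_div, abs_div, abs_of_pos hR0]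
      gcongr
      have : (1 : ℤ) ≤ |(i : ℤ) - j| := Int.one_le_abs (sub_ne_zero.2 (by exact_mod_cast hij))
      exact_mod_cast this
    have e1 : 1 / R = 1 / (2 * R) + 1 / (4 * R) + 1 / (4 * R) := by field_simp; norm_num
    have e2 : (i : ℝ) / R - j / R = (y (i / R) - y (j / R)) + ((i / R - y (i / R)) - (j / R - y (j / R))) := by ring
    have h4 : |(i : ℝ) / R - j / R| ≤ |y (i / R) - y (j / R)| + (|(i : ℝ) / R - y (i / R)| + |(j : ℝ) / R - y (j / R)|) := by
      rw [e2]
      exact (abs_add_le _ _).trans (add_le_add_right (abs_sub _ _) _)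
    linarith
  have hinj : Set.InjOn (fun j : ℕ => y ((j : ℝ) / R)) J := by
    intro i hi j hj hij
    by_contra hne
    have h1 := hsep i hi j hj hne
    simp only at hij
    rw [hij, sub_self, abs_zero] at h1
    have : 0 < 1 / (2 * R) := by positivity
    linarith
  have key := card_multipliers_le (σ := 1 / (2 * R)) (hV.mono (hL90.trans hL90f))
    (h1L.trans (hL90.trans hL90f)) (by positivity) hℓ hconc
    (J.image (fun j : ℕ => y ((j : ℝ) / R))) (by
      intro x hx
      obtain ⟨j, hj, rfl⟩ := Finset.mem_image.1 hx
      exact hy _ (hJ1 j hj)) (by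
      intro x hx x' hx' hne
      obtain ⟨j, hj, rfl⟩ := Finset.mem_image.1 hx
      obtain ⟨j', hj', rfl⟩ := Finset.mem_image.1 hx'
      exact hsep j hj j' hj' (fun e => hne (by rw [e])))
  refine le_trans ?_ key
  rw [Finset.card_image_of_injOn hinj, hJ, Finset.card_range]
  push_cast
  exact (Nat.lt_floor_add_one R).le
/-! ### Increment of the dimension -/


/-- `V` has at most `R ^ (1 - 2 c₁)` elements, and only a fraction `R ^ (-c₀)` of them lies in any
interval of length `2 R ^ (1 - c₁)`. -/
structure IsSmallSpread (c₀ c₁ R : ℝ) (V : Finset ℤ) : Prop where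
  card_le : (V.card : ℝ) ≤ R ^ (1 - 2 * c₁)
  conc : ∀ x : ℝ, ((V.filter (fun v : ℤ => |(v : ℝ) - x| ≤ R ^ (1 - c₁))).card : ℝ)
    ≤ R ^ (-c₀) * V.card

/-- The quotients of a set of multipliers of a small spread set `V` are not dense: otherwise
`QuotientDense.le_card`, with the concentration radius `ℓ = R ^ (1 - c₁)`, would give
`|V| ≳ R ^ (1 - c₁)`. -/
theorem not_quotientDense_of_small {c₀ c₁ : ℝ} (hc₀ : 0 < c₀) (hc : c₀ ≤ c₁)
    {R : ℝ} {V : Finset ℤ} {A : Finset ℝ} {L ρ s : ℝ} {m : ℕ}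
    (hV : IsApproxGroup V L) (hVs : IsSmallSpread c₀ c₁ R V) (hL : 2 ≤ L)
    (hA : ∀ a ∈ A, IsMultiplier V L a)
    (hρ : 0 < ρ) (hρL : ρ⁻¹ ≤ L) (hs : 0 < s) (hs1 : s ≤ 1 / 2)
    (hR : 1 ≤ R) (hm : (3 * s) ^ m ≤ 1 / (4 * R)) (hLf : L ^ (810 * 9 ^ m) < R ^ c₀) :
    ¬ QuotientDense A ρ s := by
  intro hd
  have hR0 : 0 < R := by linarith
  have h1L : (1 : ℝ) ≤ L := by linarith
  set Lf := (L ^ 90) ^ 9 ^ m with hLfdef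
  have e9 : Lf ^ 9 = L ^ (810 * 9 ^ m) := by
    rw [hLfdef, ← pow_mul, ← pow_mul]; ring_nf
  have hLf2 : 2 ≤ Lf := by
    refine hL.trans ?_
    rw [hLfdef, ← pow_mul]
    simpa using pow_le_pow_right₀ h1L (show 1 ≤ 90 * 9 ^ m from Nat.one_le_iff_ne_zero.2 (by positivity))
  have hLf1 : 1 ≤ Lf := by linarith
  rw [← e9] at hLf
  have hcard := hd.le_card hV hL hA hρ hρL hs hs1 hLfdef hR hm (ℓ := R ^ (1 - c₁)) (by positivity) (by
    intro x
    calc _ ≤ R ^ (-c₀) * V.card * (2 * Lf ^ 2) := by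
          gcongr; exact hVs.conc x
      _ = (R ^ (-c₀) * (2 * Lf ^ 2)) * V.card := by ring
      _ ≤ 1 * V.card := by
          gcongr
          rw [Real.rpow_neg hR0.le, ← div_eq_inv_mul, div_le_one (by positivity)]
          refine le_trans ?_ hLf.le
          calc 2 * Lf ^ 2 ≤ Lf * Lf ^ 2 := by gcongr
            _ = Lf ^ 3 := by ring
            _ ≤ Lf ^ 9 := pow_le_pow_right₀ hLf1 (by norm_num)
      _ = V.card := one_mul _)
  have hRc : 1 ≤ R ^ c₁ := Real.one_le_rpow hR (by linarith)
  have h1 : 4 * Lf / (R ^ (1 - c₁) * (1 / (2 * R))) = 8 * Lf * R ^ c₁ := by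
    rw [Real.rpow_sub hR0, Real.rpow_one]
    field_simp
    norm_num
  rw [h1] at hcard
  have h2 : R ≤ 18 * Lf ^ 4 * (R ^ (1 - 2 * c₁) * R ^ c₁) := by
    calc R ≤ 2 * Lf ^ 3 * V.card * (8 * Lf * R ^ c₁ + 1) := hcard
      _ ≤ 2 * Lf ^ 3 * R ^ (1 - 2 * c₁) * (8 * Lf * R ^ c₁ + Lf * R ^ c₁) := by
          gcongr
          · exact hVs.card_le
          · nlinarith
      _ = _ := by ring
  rw [← Real.rpow_add hR0] at h2
  have h3 : R ^ c₁ ≤ 18 * Lf ^ 4 := by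
    have e : R = R ^ c₁ * R ^ (1 - 2 * c₁ + c₁) := by
      rw [← Real.rpow_add hR0]
      conv_lhs => rw [← Real.rpow_one R]
      congr 1; ring
    have hp : 0 < R ^ (1 - 2 * c₁ + c₁) := by positivity
    refine le_of_mul_le_mul_right ?_ hp
    rw [← e]; exact h2
  have h4 : 18 * Lf ^ 4 ≤ Lf ^ 9 := by
    calc 18 * Lf ^ 4 ≤ 2 ^ 5 * Lf ^ 4 := by gcongr; norm_num
      _ ≤ Lf ^ 5 * Lf ^ 4 := by gcongr
      _ = Lf ^ 9 := by ring
  have h5 : R ^ c₀ ≤ R ^ c₁ := Real.rpow_le_rpow_of_exponent_le hR hc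
  linarith

/-- No set `A` of multipliers that has dimension at least `κ` at all scales from `1 / R` to `1` can
have dimension at least `d` at a single scale `ρ` between `R ^ (-b)` and `R ^ (-b')`. Here `b`
depends only on the parameters, while `b' > 0` is arbitrary; the admissible loss `R ^ γ` and the
threshold `R₀` depend on `b'`, but not on the sets or on the scale. -/
def DimensionExcluded (c₀ c₁ κ d : ℝ) : Prop :=
  ∃ b : ℝ, 0 < b ∧ b ≤ 1 / 2 ∧ ∀ b' : ℝ, 0 < b' → b' ≤ b → ∃ γ : ℝ, 0 < γ ∧ ∃ R₀ : ℝ, 1 ≤ R₀ ∧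
    ∀ R : ℝ, R₀ ≤ R → ∀ L : ℝ, 2 ≤ L → L ≤ R ^ γ → ∀ (V : Finset ℤ) (A : Finset ℝ) (ρ : ℝ),
      IsApproxGroup V L → IsSmallSpread c₀ c₁ R V → (∀ a ∈ A, IsMultiplier V L a) → 0 ∈ A →
      (∀ r : ℝ, 1 / R ≤ r → r ≤ 1 → HasSeparated A r (r ^ (-κ) / L)) →
      R ^ (-b) ≤ ρ → ρ ≤ R ^ (-b') → ¬ HasSeparated A ρ (ρ ^ (-d))

/-- Multipliers lie in `[-L, L]`, so they have at most about `L / ρ` points that are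
`ρ`-separated. -/
theorem dimensionExcluded_of_one_lt (c₀ c₁ κ : ℝ) {d : ℝ} (hd : 1 < d) :
    DimensionExcluded c₀ c₁ κ d := by
  refine ⟨1 / 2, by norm_num, le_rfl, fun b' hb' _ => ?_⟩
  have hγ : 0 < b' * (d - 1) / 2 := by have := sub_pos.2 hd; positivity
  refine ⟨b' * (d - 1) / 2, hγ, max 1 (5 ^ (b' * (d - 1) / 2)⁻¹), le_max_left _ _, ?_⟩
  intro R hR L hL hLR V A ρ hV _ hA _ _ hρ1 hρ2 hsep
  have hR1 : 1 ≤ R := (le_max_left _ _).trans hR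
  have hR0 : 0 < R := by linarith
  have h5 : 5 ≤ R ^ (b' * (d - 1) / 2) := by
    have := Real.rpow_le_rpow (by positivity) ((le_max_right _ _).trans hR) hγ.le
    rwa [← Real.rpow_mul (by norm_num), inv_mul_cancel₀ hγ.ne', Real.rpow_one] at this
  have hρ0 : 0 < ρ := lt_of_lt_of_le (by positivity) hρ1
  have hρ1' : ρ ≤ 1 := hρ2.trans (Real.rpow_le_one_of_one_le_of_nonpos hR1 (by linarith))
  have h1 := hsep.le hρ0 (by linarith) (fun a ha => (hA a ha).1)
  have h2 : ρ ^ (-d) ≤ 3 * L / ρ := by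
    refine h1.trans ?_
    have : 1 ≤ L / ρ := by rw [le_div_iff₀ hρ0]; linarith
    have e : 3 * L / ρ = 2 * L / ρ + L / ρ := by ring
    linarith
  have h3 : ρ ^ (-(d - 1)) ≤ 3 * L := by
    have e : ρ ^ (-(d - 1)) = ρ ^ (-d) * ρ := by
      conv_rhs => rhs; rw [← Real.rpow_one ρ]
      rw [← Real.rpow_add hρ0]; congr 1; ring
    rw [e]
    calc ρ ^ (-d) * ρ ≤ 3 * L / ρ * ρ := by gcongr
      _ = 3 * L := by field_simp
  have h4 : R ^ (b' * (d - 1)) ≤ ρ ^ (-(d - 1)) := by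
    calc R ^ (b' * (d - 1)) = (R ^ (-b')) ^ (-(d - 1)) := by
          rw [← Real.rpow_mul hR0.le]; congr 1; ring
      _ ≤ ρ ^ (-(d - 1)) := Real.rpow_le_rpow_of_nonpos hρ0 hρ2 (by linarith)
  have h6 : R ^ (b' * (d - 1)) = R ^ (b' * (d - 1) / 2) * R ^ (b' * (d - 1) / 2) := by
    rw [← Real.rpow_add hR0]; congr 1; ring
  rw [h6] at h4
  have : 5 * L ≤ R ^ (b' * (d - 1) / 2) * R ^ (b' * (d - 1) / 2) := by gcongr
  linarith

theorem le_rpow_of_le {a x R : ℝ} (ha : 0 ≤ a) (hx : 0 < x) (h : a ^ x⁻¹ ≤ R) : a ≤ R ^ x := by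
  have := Real.rpow_le_rpow (by positivity) h hx.le
  rwa [← Real.rpow_mul ha, inv_mul_cancel₀ hx.ne', Real.rpow_one] at this

set_option maxHeartbeats 1000000 in
/-- Dimension increment. From a set of multipliers with `ρ ^ (-d)` separated points at the scale `ρ`,
`k` applications of `exists_gain`, with `k` of size `v / (κ² x)` where `ρ = R ^ (-x)`, lead to a scale
`r ≥ ρ ^ (k + 1) s` with about `ρ ^ (-d k) r ^ (-κ)` separated points. By the lower bound for `r`
this is at least `(ρ s) ^ d r ^ (-(d + κ))`, and `(ρ s) ^ d` together with the other losses is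
at least `r ^ (κ / 2)`, because the number `k` of steps is so large that `r` is much smaller than
`ρ s`. -/
theorem DimensionExcluded.step {c₀ c₁ κ d : ℝ} (hc₀ : 0 < c₀) (hc : c₀ ≤ c₁)
    (hκ : 0 < κ) (hκ1 : κ ≤ 1) (hd : κ / 2 ≤ d) (h : DimensionExcluded c₀ c₁ κ (d + κ / 2)) :
    DimensionExcluded c₀ c₁ κ d := by
  rcases lt_or_ge 1 d with hd1 | hd1
  · exact dimensionExcluded_of_one_lt _ _ _ hd1
  obtain ⟨b₁, hb₁, hb₁', h⟩ := h
  -- Quotients are tested at the scale `s = R ^ (-v)`. The final scale is at least about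
  -- `R ^ (-12 v / κ²)` and must be at least `R ^ (-b₁)`, which dictates `v`. With `m` digits to a base near
  -- `s` a digit expansion reaches beyond the scale `1 / R`.
  set v := κ ^ 2 * b₁ / 15 with hv
  have hκ2 : κ ^ 2 ≤ 1 := pow_le_one₀ hκ.le hκ1
  have hv0 : 0 < v := by positivity
  have hvb : v ≤ b₁ / 15 := by rw [hv]; gcongr; nlinarith
  set m := ⌈8 / v⌉₊ with hm
  have hmv : 8 ≤ m * v := by
    have := Nat.le_ceil (8 / v)
    rwa [div_le_iff₀ hv0] at this
  have hN : (0 : ℝ) < 1620 * 9 ^ m := by positivity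
  -- dividing by numbers of size `ρ ≥ R ^ (-b)` costs powers of `R ^ b`; those that occur in
  -- `not_quotientDense_of_small` must stay below `R ^ c₀`
  set b := min v (c₀ / (1620 * 9 ^ m)) with hb
  have hb0 : 0 < b := lt_min hv0 (by positivity)
  have hbv : b ≤ v := min_le_left _ _
  have hbc : b * (810 * 9 ^ m) ≤ c₀ / 2 := by
    have : b ≤ c₀ / (1620 * 9 ^ m) := min_le_right _ _
    calc b * (810 * 9 ^ m) ≤ c₀ / (1620 * 9 ^ m) * (810 * 9 ^ m) := by gcongr
      _ = c₀ / 2 := by field_simp; norm_num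
  refine ⟨b, hb0, by linarith, fun b' hb' hb'b => ?_⟩
  obtain ⟨γ₁, hγ₁, R₁, hR₁, h⟩ := h v hv0 (by linarith)
  set kmax := ⌈12 * v / (κ ^ 2 * b')⌉₊ with hkmax
  set g := min γ₁ (min b' (v / 40)) with hg
  have hg0 : 0 < g := lt_min hγ₁ (lt_min hb' (by positivity))
  refine ⟨g / 243 ^ kmax, by positivity, max R₁ (12 ^ (v / 2)⁻¹), hR₁.trans (le_max_left _ _), ?_⟩
  intro R hR L hL hLR V A ρ hV hVs hA h0 hsepA hρ1 hρ2 hsepρ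
  have hR₁R : R₁ ≤ R := (le_max_left _ _).trans hR
  have hR1 : 1 ≤ R := hR₁.trans hR₁R
  have hR0 : 0 < R := by linarith
  have h1L : 1 ≤ L := by linarith
  have h12 : 12 ≤ R ^ (v / 2) := le_rpow_of_le (by norm_num) (by positivity) ((le_max_right _ _).trans hR)
  have hRgt : 1 < R := by
    by_contra hcon
    have : R = 1 := le_antisymm (not_lt.1 hcon) hR1
    rw [this, Real.one_rpow] at h12
    linarith
  have hlogR : 0 < Real.log R := Real.log_pos hRgt
  have mono : ∀ x y : ℝ, x ≤ y → R ^ x ≤ R ^ y := fun x y h => Real.rpow_le_rpow_of_exponent_le hR1 h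
  have hρ0 : 0 < ρ := lt_of_lt_of_le (by positivity) hρ1
  have hρlt : ρ < 1 := lt_of_le_of_lt hρ2 (Real.rpow_lt_one_of_one_lt_of_neg hRgt (by linarith))
  -- write `ρ = R ^ (-x)`
  obtain ⟨x, hx⟩ : ∃ x : ℝ, ρ = R ^ (-x) := by
    refine ⟨-(Real.log ρ / Real.log R), ?_⟩
    rw [neg_neg, Real.rpow_def_of_pos hR0, mul_div_cancel₀ _ hlogR.ne', Real.exp_log hρ0]
  have hxb : x ≤ b := by
    rw [hx, Real.rpow_le_rpow_left_iff hRgt] at hρ1; linarith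
  have hxb' : b' ≤ x := by
    rw [hx, Real.rpow_le_rpow_left_iff hRgt] at hρ2; linarith
  have hx0 : 0 < x := by linarith
  set k := ⌈12 * v / (κ ^ 2 * x)⌉₊ with hk
  have hkk : k ≤ kmax := by
    rw [hk, hkmax]
    gcongr
  have hkx : 12 * v / κ ^ 2 ≤ k * x := by
    have := Nat.le_ceil (12 * v / (κ ^ 2 * x))
    rw [div_le_iff₀ (by positivity)] at this
    rw [div_le_iff₀ (by positivity)]
    linarith
  have hkx' : k * x ≤ 12 * v / κ ^ 2 + x := by
    have := (Nat.ceil_lt_add_one (show 0 ≤ 12 * v / (κ ^ 2 * x) by positivity)).le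
    calc k * x ≤ (12 * v / (κ ^ 2 * x) + 1) * x := by gcongr
      _ = 12 * v / κ ^ 2 + x := by field_simp
  clear_value k
  set Lk := L ^ 243 ^ k with hLk
  have hLkg : Lk ≤ R ^ g := by
    calc Lk ≤ L ^ 243 ^ kmax :=
          pow_le_pow_right₀ h1L (Nat.pow_le_pow_right (by norm_num) hkk)
      _ ≤ (R ^ (g / 243 ^ kmax)) ^ 243 ^ kmax := by gcongr
      _ = R ^ g := by
          rw [← Real.rpow_natCast, ← Real.rpow_mul hR0.le]
          congr 1; push_cast; field_simp
  have hLLk : L ≤ Lk := by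
    simpa using pow_le_pow_right₀ h1L (Nat.one_le_pow k 243 (by norm_num))
  have hLk2 : 2 ≤ Lk := hL.trans hLLk
  have hLk1 : 1 ≤ Lk := by linarith
  have hLkγ : Lk ≤ R ^ γ₁ := hLkg.trans (mono _ _ (min_le_left _ _))
  have hLkb : Lk ≤ R ^ b := hLkg.trans (mono _ _ (((min_le_right _ _).trans (min_le_left _ _)).trans hb'b))
  have hLkv : 4 * Lk ^ 13 ≤ R ^ v := by
    have h1 : Lk ≤ R ^ (v / 40) := hLkg.trans (mono _ _ ((min_le_right _ _).trans (min_le_right _ _)))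
    have h2 : Lk ^ 13 ≤ R ^ (v / 2) := by
      calc Lk ^ 13 ≤ (R ^ (v / 40)) ^ 13 := by gcongr
        _ = R ^ (v / 40 * 13) := by rw [← Real.rpow_natCast, ← Real.rpow_mul hR0.le]; norm_num
        _ ≤ R ^ (v / 2) := mono _ _ (by linarith)
    have e : R ^ v = R ^ (v / 2) * R ^ (v / 2) := by
      rw [← Real.rpow_add hR0]; congr 1; ring
    rw [e]
    gcongr
    linarith
  set s := R ^ (-v) with hs
  have hs0 : 0 < s := by positivity
  have hs12 : s * 12 ≤ R ^ (-(v / 2)) := by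
    calc s * 12 ≤ s * R ^ (v / 2) := by gcongr
      _ = R ^ (-(v / 2)) := by rw [hs, ← Real.rpow_add hR0]; congr 1; ring
  have hR_half : R ^ (-(v / 2)) ≤ 1 := Real.rpow_le_one_of_one_le_of_nonpos hR1 (by linarith)
  have hs1 : 4 * s ≤ 1 / 2 := by linarith
  have hdense : ∀ A' : Finset ℝ, (∀ a ∈ A', IsMultiplier V (L ^ 243 ^ k) a) →
      ¬ QuotientDense A' ρ (4 * s) := by
    intro A' hA'
    refine not_quotientDense_of_small (L := R ^ b) (m := m) hc₀ hc (hV.mono (hLLk.trans hLkb)) hVs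
      (hLk2.trans hLkb) (fun a ha => (hA' a ha).mono hLkb) hρ0 ?_ (by positivity) hs1 hR1 ?_ ?_
    · rw [inv_le_comm₀ hρ0 (by positivity), ← Real.rpow_neg hR0.le]
      exact hρ1
    · have e1 : (3 * (4 * s)) ^ m ≤ (R ^ (-(v / 2))) ^ m := by
        gcongr; linarith
      have e2 : (R ^ (-(v / 2))) ^ m ≤ R ^ (-(1 + v / 2)) := by
        rw [← Real.rpow_natCast, ← Real.rpow_mul hR0.le]
        apply mono
        linarith
      have e3 : R ^ (-(1 + v / 2)) ≤ 1 / (4 * R) := by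
        rw [Real.rpow_neg hR0.le, Real.rpow_add hR0, Real.rpow_one, one_div]
        refine inv_anti₀ (by positivity) ?_
        nlinarith
      exact e1.trans (e2.trans e3)
    · rw [← Real.rpow_natCast, ← Real.rpow_mul hR0.le]
      apply Real.rpow_lt_rpow_of_exponent_lt hRgt
      push_cast
      linarith
  clear_value Lk kmax m g b v s
  have hρs : ρ * s = R ^ (-(x + v)) := by
    rw [hx, hs, ← Real.rpow_add hR0]; congr 1; ring
  have hM1 : 1 < ρ ^ (-d) := Real.one_lt_rpow_of_pos_of_lt_one_of_neg hρ0 hρlt (by linarith)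
  obtain ⟨A', hAA', hA', r, hr1, hr2, hr3⟩ := exists_iterated_gain k hV hL hκ hκ1 hA h0 hρ0 hρlt.le hs0
    (by linarith) (fun r hr hr' => hsepA r (by
      refine le_trans ?_ hr
      rw [hρs, one_div, ← Real.rpow_neg_one]
      exact mono _ _ (by linarith)) hr') hsepρ hM1 hdense k le_rfl
  rw [← hLk] at hA' hr3
  have hr0 : 0 < r := lt_of_lt_of_le (by positivity) hr1
  have hρs1 : ρ * s ≤ s := by nlinarith
  have hs_1 : s ≤ 1 := by linarith
  have hr_1 : r ≤ 1 := by linarith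
  have hMk : (ρ ^ (-d)) ^ k = R ^ (x * d * k) := by
    rw [hx, ← Real.rpow_mul hR0.le, ← Real.rpow_natCast, ← Real.rpow_mul hR0.le]
    congr 1; ring
  rw [hMk] at hr3
  -- the scale `r` is small because `A'` has at most `O(Lk / r)` separated points
  have hupper : R ^ (x * d * k) * r ≤ 4 * Lk ^ 7 := by
    have h1 := hr3.le hr0 (by linarith) (fun a ha => (hA' a ha).1)
    have h2 : R ^ (x * d * k) * r ^ (-κ) / Lk ^ 6 ≤ 4 * Lk / r := by
      refine h1.trans ?_
      have : 1 ≤ Lk / r := by rw [le_div_iff₀ hr0]; linarith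
      have e : 4 * Lk / r = 2 * Lk / r + 2 * (Lk / r) := by ring
      linarith
    rw [div_le_div_iff₀ (by positivity) hr0] at h2
    have h3 : 1 ≤ r ^ (-κ) := Real.one_le_rpow_of_pos_of_le_one_of_nonpos hr0 hr_1 (by linarith)
    calc R ^ (x * d * k) * r = R ^ (x * d * k) * 1 * r := by ring
      _ ≤ R ^ (x * d * k) * r ^ (-κ) * r := by gcongr
      _ ≤ 4 * Lk * Lk ^ 6 := h2
      _ = 4 * Lk ^ 7 := by ring
  have hrκ : Lk ^ 6 * r ^ (κ / 2) ≤ ρ * s := by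
    have h1 : r ≤ 4 * Lk ^ 7 * R ^ (-(x * d * k)) := by
      rw [Real.rpow_neg hR0.le, ← div_eq_mul_inv, le_div_iff₀ (by positivity)]
      linarith
    have h7 : 1 ≤ 4 * Lk ^ 7 := by
      have : 1 ≤ Lk ^ 7 := one_le_pow₀ hLk1
      linarith
    have h2 : r ^ (κ / 2) ≤ 4 * Lk ^ 7 * R ^ (-(3 * v)) := by
      calc r ^ (κ / 2) ≤ (4 * Lk ^ 7 * R ^ (-(x * d * k))) ^ (κ / 2) := by gcongr
        _ = (4 * Lk ^ 7) ^ (κ / 2) * R ^ (-(x * d * k) * (κ / 2)) := by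
            rw [Real.mul_rpow (by positivity) (by positivity), ← Real.rpow_mul hR0.le]
        _ ≤ (4 * Lk ^ 7) ^ (1 : ℝ) * R ^ (-(3 * v)) := by
            gcongr
            · linarith
            · rw [div_le_iff₀ (by positivity)] at hkx
              have h8 : k * x * (κ / 2) * (κ / 2) ≤ k * x * d * (κ / 2) := by gcongr
              nlinarith
        _ = _ := by rw [Real.rpow_one]
    calc Lk ^ 6 * r ^ (κ / 2) ≤ Lk ^ 6 * (4 * Lk ^ 7 * R ^ (-(3 * v))) := by gcongr
      _ = 4 * Lk ^ 13 * R ^ (-(3 * v)) := by ring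
      _ ≤ R ^ v * R ^ (-(3 * v)) := by gcongr
      _ = R ^ (-(2 * v)) := by rw [← Real.rpow_add hR0]; congr 1; ring
      _ ≤ ρ * s := by rw [hρs]; exact mono _ _ (by linarith)
  refine h R hR₁R Lk hLk2 hLkγ V A' r (hV.mono hLLk) hVs hA' (hAA' h0) ?_ ?_ (hr2.trans (hρs1.trans hs.le)) ?_
  · intro r' hr' hr''
    refine (hsepA r' hr' hr'').mono hAA' le_rfl ?_
    have : 0 < r' := lt_of_lt_of_le (by positivity) hr'
    gcongr
  · refine le_trans ?_ hr1
    rw [hρs, hx, ← Real.rpow_natCast, ← Real.rpow_mul hR0.le, ← Real.rpow_add hR0]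
    apply mono
    have e : b₁ = 15 * (v / κ ^ 2) := by rw [hv]; field_simp
    have : v ≤ v / κ ^ 2 := by rw [le_div_iff₀ (by positivity)]; nlinarith
    have e2 : 12 * v / κ ^ 2 = 12 * (v / κ ^ 2) := by ring
    rw [e2] at hkx'
    linarith
  · refine hr3.mono subset_rfl le_rfl ?_
    rw [le_div_iff₀ (by positivity)]
    have hrd : ρ * s * R ^ (-(x * d * k)) ≤ r ^ d := by
      calc ρ * s * R ^ (-(x * d * k)) ≤ (ρ * s) ^ d * R ^ (-(x * d * k)) := by
            gcongr
            have : ρ * s ≤ 1 := by linarith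
            simpa using Real.rpow_le_rpow_of_exponent_ge (by positivity : 0 < ρ * s) this hd1
        _ = (ρ ^ k * (ρ * s)) ^ d := by
            have e : (ρ ^ k) ^ d = R ^ (-(x * d * k)) := by
              rw [hx, ← Real.rpow_natCast, ← Real.rpow_mul hR0.le, ← Real.rpow_mul hR0.le]
              congr 1; ring
            rw [Real.mul_rpow (x := ρ ^ k) (by positivity) (by positivity), e, mul_comm]
        _ ≤ r ^ d := by
            have : 0 ≤ d := by linarith
            gcongr
    have hcmp : Lk ^ 6 * r ^ (κ / 2) ≤ R ^ (x * d * k) * r ^ d := by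
      calc Lk ^ 6 * r ^ (κ / 2) ≤ ρ * s := hrκ
        _ = R ^ (x * d * k) * (ρ * s * R ^ (-(x * d * k))) := by
            rw [Real.rpow_neg hR0.le]; field_simp
        _ ≤ R ^ (x * d * k) * r ^ d := by gcongr
    calc r ^ (-(d + κ / 2)) * Lk ^ 6 = r ^ (-(d + κ)) * (Lk ^ 6 * r ^ (κ / 2)) := by
          have : r ^ (-(d + κ / 2)) = r ^ (-(d + κ)) * r ^ (κ / 2) := by
            rw [← Real.rpow_add hr0]; congr 1; ring
          rw [this]; ring
      _ ≤ r ^ (-(d + κ)) * (R ^ (x * d * k) * r ^ d) := by gcongr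
      _ = R ^ (x * d * k) * r ^ (-κ) := by
          have : r ^ (-κ) = r ^ (-(d + κ)) * r ^ d := by
            rw [← Real.rpow_add hr0]; congr 1; ring
          rw [this]; ring

/-- Downward induction on the dimension: it is excluded when it exceeds `1`, and one step lowers the
excluded dimension by `κ / 2`. -/
theorem dimensionExcluded {c₀ c₁ κ : ℝ} (hc₀ : 0 < c₀) (hc : c₀ ≤ c₁)
    (hκ : 0 < κ) (hκ1 : κ ≤ 1) : DimensionExcluded c₀ c₁ κ (κ / 2) := by
  obtain ⟨J, hJ⟩ := exists_nat_gt (2 / κ)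
  have hJ' : 1 < J * (κ / 2) := by
    rw [div_lt_iff₀ hκ] at hJ; linarith
  have key : ∀ j : ℕ, j ≤ J → DimensionExcluded c₀ c₁ κ ((J - j + 1 : ℝ) * (κ / 2)) := by
    intro j
    induction j with
    | zero =>
      intro _
      apply dimensionExcluded_of_one_lt
      push_cast
      nlinarith
    | succ j ih =>
      intro hj
      have hj' : (j : ℝ) + 1 ≤ J := by exact_mod_cast hj
      apply DimensionExcluded.step hc₀ hc hκ hκ1
      · push_cast
        nlinarith
      · convert ih (by omega) using 1
        push_cast
        ring
  have := key J le_rfl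
  simpa using this

/-- The multipliers of a small spread approximate group do not have dimension `κ` at all scales. -/
theorem exists_no_multipliers {c₀ c₁ κ : ℝ} (hc₀ : 0 < c₀) (hc : c₀ ≤ c₁)
    (hκ : 0 < κ) (hκ1 : κ ≤ 1) :
    ∃ γ : ℝ, 0 < γ ∧ ∃ R₀ : ℝ, 1 ≤ R₀ ∧
    ∀ R : ℝ, R₀ ≤ R → ∀ L : ℝ, 2 ≤ L → L ≤ R ^ γ → ∀ (V : Finset ℤ) (T : Finset ℝ),
      IsApproxGroup V L → IsSmallSpread c₀ c₁ R V → (∀ a ∈ T, IsMultiplier V L a) → 0 ∈ T →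
      ¬ ∀ r : ℝ, 1 / R ≤ r → r ≤ 1 → HasSeparated T r (r ^ (-κ) / L) := by
  obtain ⟨b, hb, hb', h⟩ := dimensionExcluded hc₀ hc hκ hκ1
  obtain ⟨γ, hγ, R₀, hR₀, h⟩ := h b hb le_rfl
  refine ⟨min γ (b * (κ / 2)), lt_min hγ (by positivity), R₀, hR₀, ?_⟩
  intro R hR L hL hLR V T hV hVs hT h0 hsep
  have hR1 : 1 ≤ R := hR₀.trans hR
  have hR0 : 0 < R := by linarith
  refine h R hR L hL (hLR.trans (Real.rpow_le_rpow_of_exponent_le hR1 (min_le_left _ _))) V T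
    (R ^ (-b)) hV hVs hT h0 hsep le_rfl le_rfl ?_
  refine (hsep (R ^ (-b)) ?_ ?_).mono subset_rfl le_rfl ?_
  · rw [one_div, ← Real.rpow_neg_one]
    exact Real.rpow_le_rpow_of_exponent_le hR1 (by linarith)
  · exact Real.rpow_le_one_of_one_le_of_nonpos hR1 (by linarith)
  · rw [le_div_iff₀ (by linarith)]
    calc (R ^ (-b)) ^ (-(κ / 2)) * L ≤ (R ^ (-b)) ^ (-(κ / 2)) * R ^ (b * (κ / 2)) := by
          gcongr
          exact hLR.trans (Real.rpow_le_rpow_of_exponent_le hR1 (min_le_right _ _))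
      _ = (R ^ (-b)) ^ (-κ) := by
          rw [← Real.rpow_mul hR0.le, ← Real.rpow_mul hR0.le, ← Real.rpow_add hR0]
          congr 1; ring
/-! ### The Balog–Szemerédi–Gowers theorem -/


section BalogSzemerediGowers

variable {α β : Type*} [DecidableEq α] [DecidableEq β]

theorem card_filter_eq_sum_left (Γ : Finset (α × β)) (A : Finset α) (B : Finset β) :
    (((A ×ˢ B).filter (· ∈ Γ)).card : ℝ) = ∑ a ∈ A, ((B.filter (fun b => (a, b) ∈ Γ)).card : ℝ) := by
  simp_rw [Finset.card_filter]
  push_cast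
  rw [Finset.sum_product]

theorem card_filter_eq_sum_right (Γ : Finset (α × β)) (A : Finset α) (B : Finset β) :
    (((A ×ˢ B).filter (· ∈ Γ)).card : ℝ) = ∑ b ∈ B, ((A.filter (fun a => (a, b) ∈ Γ)).card : ℝ) := by
  simp_rw [Finset.card_filter]
  push_cast
  rw [Finset.sum_product_right]

/-- In a dense bipartite graph `Γ` some vertex of `B` has a large neighbourhood in which only a small
fraction of the pairs has few common neighbours. It is found by averaging over `B`: pairs with few
common neighbours lie, by definition, in few neighbourhoods. -/
theorem exists_neighbourhood_few_bad (A : Finset α) (B : Finset β) (Γ : Finset (α × β)) {K m : ℝ}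
    (hK : 1 ≤ K) (hm : 0 < m) (hA₀m : (A.card : ℝ) ≤ m) (hB : (B.card : ℝ) ≤ m)
    (hsum0 : m ^ 2 / (2 * K) ≤ ∑ a ∈ A, ((B.filter (fun b => (a, b) ∈ Γ)).card : ℝ)) :
    ∃ A₁ ⊆ A, m / (3 * K) ≤ A₁.card ∧
      32 * K * (((A₁ ×ˢ A₁).filter (fun p => ((B.filter (fun b => (p.1, b) ∈ Γ) ∩
        B.filter (fun b => (p.2, b) ∈ Γ)).card : ℝ) < m / (256 * K ^ 3))).card : ℝ) ≤ (A₁.card : ℝ) ^ 2 := by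
  have hK0 : 0 < K := by linarith
  have hNdef : ∃ N : α → Finset β, ∀ a, N a = B.filter (fun b => (a, b) ∈ Γ) := ⟨_, fun _ => rfl⟩
  obtain ⟨N, hN⟩ := hNdef
  simp_rw [← hN] at hsum0 ⊢
  have hMdef : ∃ M : β → Finset α, ∀ b, M b = A.filter (fun a => (a, b) ∈ Γ) := ⟨_, fun _ => rfl⟩
  obtain ⟨M, hM⟩ := hMdef
  have hsumM : ∑ b ∈ B, ((M b).card : ℝ) = ∑ a ∈ A, ((N a).card : ℝ) := by
    simp_rw [hM, hN]
    rw [← card_filter_eq_sum_left, ← card_filter_eq_sum_right]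
  have hsq : m ^ 3 / (4 * K ^ 2) ≤ ∑ b ∈ B, ((M b).card : ℝ) ^ 2 := by
    have h1 := sq_sum_le_card_mul_sum_sq (s := B) (f := fun b => ((M b).card : ℝ))
    have h2 : (m ^ 2 / (2 * K)) ^ 2 ≤ m * ∑ b ∈ B, ((M b).card : ℝ) ^ 2 := by
      calc (m ^ 2 / (2 * K)) ^ 2 ≤ (∑ b ∈ B, ((M b).card : ℝ)) ^ 2 := by
            rw [hsumM]; exact pow_le_pow_left₀ (by positivity) hsum0 2
        _ ≤ B.card * ∑ b ∈ B, ((M b).card : ℝ) ^ 2 := h1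
        _ ≤ _ := mul_le_mul_of_nonneg_right hB (Finset.sum_nonneg fun _ _ => sq_nonneg _)
    have h3 : (m ^ 2 / (2 * K)) ^ 2 = m * (m ^ 3 / (4 * K ^ 2)) := by field_simp; ring
    rw [h3] at h2
    exact le_of_mul_le_mul_left h2 hm
  -- pairs with few common neighbours
  obtain ⟨badP, hbadP⟩ : ∃ badP : β → Finset (α × α), ∀ b, badP b = (M b ×ˢ M b).filter
      (fun p => ((N p.1 ∩ N p.2).card : ℝ) < m / (256 * K ^ 3)) := ⟨_, fun _ => rfl⟩
  have hbadsum : ∑ b ∈ B, ((badP b).card : ℝ) ≤ m ^ 3 / (256 * K ^ 3) := by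
    have h1 : ∑ b ∈ B, ((badP b).card : ℝ) =
        ∑ p ∈ (A ×ˢ A).filter (fun p => ((N p.1 ∩ N p.2).card : ℝ) < m / (256 * K ^ 3)), ((N p.1 ∩ N p.2).card : ℝ) := by
      have e1 : ∀ b ∈ B, ((badP b).card : ℝ) = ∑ p ∈ (A ×ˢ A).filter (fun p => ((N p.1 ∩ N p.2).card : ℝ) < m / (256 * K ^ 3)),
          (if (p.1, b) ∈ Γ ∧ (p.2, b) ∈ Γ then (1 : ℝ) else 0) := by
        intro b _
        rw [← Finset.sum_filter, Finset.sum_const, nsmul_eq_mul, mul_one]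
        congr 2
        ext p
        rw [hbadP, hM]
        simp only [Finset.mem_filter, Finset.mem_product]
        tauto
      rw [Finset.sum_congr rfl e1, Finset.sum_comm]
      refine Finset.sum_congr rfl fun p _ => ?_
      rw [← Finset.sum_filter, Finset.sum_const, nsmul_eq_mul, mul_one]
      congr 2
      ext b
      rw [hN, hN]
      simp only [Finset.mem_filter, Finset.mem_inter]
      tauto
    rw [h1]
    calc _ ≤ ∑ p ∈ (A ×ˢ A).filter (fun p => ((N p.1 ∩ N p.2).card : ℝ) < m / (256 * K ^ 3)), (m / (256 * K ^ 3)) :=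
          Finset.sum_le_sum fun p hp => (Finset.mem_filter.1 hp).2.le
      _ = ((A ×ˢ A).filter (fun p => ((N p.1 ∩ N p.2).card : ℝ) < m / (256 * K ^ 3))).card * (m / (256 * K ^ 3)) := by
          rw [Finset.sum_const, nsmul_eq_mul]
      _ ≤ (m * m) * (m / (256 * K ^ 3)) := by
          gcongr
          calc (((A ×ˢ A).filter (fun p => ((N p.1 ∩ N p.2).card : ℝ) < m / (256 * K ^ 3))).card : ℝ) ≤ ((A ×ˢ A).card : ℝ) := by
                exact_mod_cast Finset.card_filter_le _ _
            _ = A.card * A.card := by rw [Finset.card_product]; push_cast; ring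
            _ ≤ m * m := by gcongr
      _ = m ^ 3 / (256 * K ^ 3) := by ring
  have hBne : B.Nonempty := by
    rw [Finset.nonempty_iff_ne_empty]
    intro h
    rw [h, Finset.sum_empty] at hsq
    have : 0 < m ^ 3 / (4 * K ^ 2) := by positivity
    linarith
  obtain ⟨b₀, hb₀, hb₀'⟩ : ∃ b ∈ B, m ^ 2 / (8 * K ^ 2) ≤ ((M b).card : ℝ) ^ 2 - 32 * K * (badP b).card := by
    refine Finset.exists_le_of_sum_le hBne ?_
    rw [Finset.sum_const, nsmul_eq_mul, Finset.sum_sub_distrib, ← Finset.mul_sum]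
    have h1 : (B.card : ℝ) * (m ^ 2 / (8 * K ^ 2)) ≤ m * (m ^ 2 / (8 * K ^ 2)) := by gcongr
    have h2 : 32 * K * ∑ b ∈ B, ((badP b).card : ℝ) ≤ 32 * K * (m ^ 3 / (256 * K ^ 3)) := by gcongr
    have h3 : 32 * K * (m ^ 3 / (256 * K ^ 3)) = m ^ 3 / (8 * K ^ 2) := by field_simp; ring
    have h4 : m ^ 3 / (4 * K ^ 2) = m * (m ^ 2 / (8 * K ^ 2)) + m ^ 3 / (8 * K ^ 2) := by
      field_simp; ring
    linarith
  have hbad0 : (0 : ℝ) ≤ (badP b₀).card := Nat.cast_nonneg _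
  have h0 : 0 ≤ m ^ 2 / (8 * K ^ 2) := by positivity
  refine ⟨M b₀, hM b₀ ▸ Finset.filter_subset _ _, ?_, ?_⟩
  · refine le_of_sq_le_sq ?_ (Nat.cast_nonneg _)
    have : (m / (3 * K)) ^ 2 ≤ m ^ 2 / (8 * K ^ 2) := by
      rw [div_pow]
      gcongr
      nlinarith
    have : 0 ≤ 32 * K * ((badP b₀).card : ℝ) := by positivity
    linarith
  · rw [← hbadP]
    linarith

/-- A dense bipartite graph `Γ` contains large sets `A'` and `B'` that still span many edges, such that
every vertex of `A'` is joined to every vertex of `B'` by many paths of length three. -/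
theorem exists_many_paths (A : Finset α) (B : Finset β) (Γ : Finset (α × β)) {K m : ℝ}
    (hΓ : Γ ⊆ A ×ˢ B) (hK : 1 ≤ K) (hm : 0 < m) (hA : (A.card : ℝ) ≤ m) (hB : (B.card : ℝ) ≤ m)
    (hΓc : m ^ 2 ≤ K * Γ.card) :
    ∃ A' ⊆ A, ∃ B' ⊆ B, m ^ 2 / (24 * K ^ 2) ≤ ((A' ×ˢ B').filter (· ∈ Γ)).card ∧
      ∀ a ∈ A', ∀ b ∈ B', m ^ 2 / (12288 * K ^ 5) ≤
        (((A ×ˢ B).filter (fun p => (a, p.2) ∈ Γ ∧ p ∈ Γ ∧ (p.1, b) ∈ Γ)).card : ℝ) := by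
  have hK0 : 0 < K := by linarith
  set N : α → Finset β := fun a => B.filter (fun b => (a, b) ∈ Γ) with hN
  have hNm : ∀ a, ((N a).card : ℝ) ≤ m := fun a =>
    le_trans (by exact_mod_cast Finset.card_filter_le _ _) hB
  -- vertices of large degree
  set A₀ := A.filter (fun a => m / (2 * K) ≤ (N a).card) with hA₀
  have hA₀A : A₀ ⊆ A := Finset.filter_subset _ _
  have hA₀m : (A₀.card : ℝ) ≤ m := le_trans (by exact_mod_cast Finset.card_le_card hA₀A) hA
  have hΓeq : (A ×ˢ B).filter (· ∈ Γ) = Γ := by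
    ext p; simp only [Finset.mem_filter]; exact ⟨fun h => h.2, fun h => ⟨hΓ h, h⟩⟩
  have hsum0 : m ^ 2 / (2 * K) ≤ ∑ a ∈ A₀, ((N a).card : ℝ) := by
    have h1 : (Γ.card : ℝ) = ∑ a ∈ A, ((N a).card : ℝ) := by
      rw [← card_filter_eq_sum_left, hΓeq]
    have h2 := Finset.sum_filter_add_sum_filter_not A (fun a => m / (2 * K) ≤ (N a).card)
      (fun a => ((N a).card : ℝ))
    have h3 : ∑ a ∈ A with ¬ (m / (2 * K) ≤ (N a).card), ((N a).card : ℝ) ≤ m * (m / (2 * K)) := by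
      calc ∑ a ∈ A with ¬ (m / (2 * K) ≤ (N a).card), ((N a).card : ℝ)
          ≤ ∑ a ∈ A with ¬ (m / (2 * K) ≤ (N a).card), (m / (2 * K)) :=
            Finset.sum_le_sum fun a ha => (not_le.1 (Finset.mem_filter.1 ha).2).le
        _ = (A.filter (fun a => ¬ (m / (2 * K) ≤ (N a).card))).card * (m / (2 * K)) := by
            rw [Finset.sum_const, nsmul_eq_mul]
        _ ≤ m * (m / (2 * K)) := by
            gcongr
            exact le_trans (by exact_mod_cast Finset.card_filter_le _ _) hA
    have h4 : m ^ 2 / K ≤ Γ.card := by rw [div_le_iff₀ hK0]; linarith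
    have h5 : m ^ 2 / K = m ^ 2 / (2 * K) + m * (m / (2 * K)) := by field_simp; ring
    linarith
  obtain ⟨A₁, hA₁A₀, hn₁m, hbadle⟩ := exists_neighbourhood_few_bad A₀ B Γ hK hm hA₀m hB hsum0
  set n₁ : ℝ := ((A₁.card : ℕ) : ℝ) with hn₁
  have hn₁0 : 0 ≤ n₁ := Nat.cast_nonneg _
  have hn₁pos : 0 < n₁ := lt_of_lt_of_le (by positivity) hn₁m
  let bad : α → α → Prop := fun a a' => ((N a ∩ N a').card : ℝ) < m / (256 * K ^ 3)
  classical
  set badP : Finset (α × α) := (A₁ ×ˢ A₁).filter (fun p => bad p.1 p.2) with hbadP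
  replace hbadle : 32 * K * (badP.card : ℝ) ≤ n₁ ^ 2 := by
    convert hbadle using 3
  set bc : α → Finset α := fun a => A₁.filter (fun a' => bad a a') with hbc
  -- the vertices that have few common neighbours with only few others
  set A' := A₁.filter (fun a => ((bc a).card : ℝ) ≤ n₁ / (16 * K)) with hA'
  have hA'card : n₁ / 2 ≤ A'.card := by
    have h1 : ((badP).card : ℝ) = ∑ a ∈ A₁, ((bc a).card : ℝ) := by
      simp only [hbadP, hbc]
      simp_rw [Finset.card_filter]
      push_cast
      rw [Finset.sum_product]
    have h2 : ((A₁.filter (fun a => ¬ ((bc a).card : ℝ) ≤ n₁ / (16 * K))).card : ℝ) * (n₁ / (16 * K))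
        ≤ (badP).card := by
      rw [h1, ← nsmul_eq_mul, ← Finset.sum_const]
      refine le_trans (Finset.sum_le_sum fun a ha => (not_le.1 (Finset.mem_filter.1 ha).2).le) ?_
      exact Finset.sum_le_sum_of_subset_of_nonneg (Finset.filter_subset _ _)
        fun _ _ _ => Nat.cast_nonneg _
    have h3 : (A'.card : ℝ) + (A₁.filter (fun a => ¬ ((bc a).card : ℝ) ≤ n₁ / (16 * K))).card = n₁ := by
      rw [hn₁, hA']
      exact_mod_cast Finset.card_filter_add_card_filter_not (s := A₁) _
    generalize ((A₁.filter (fun a => ¬ ((bc a).card : ℝ) ≤ n₁ / (16 * K))).card : ℝ) = u at h2 h3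
    have h4 : u * 2 * n₁ ≤ n₁ * n₁ := by
      calc _ = 32 * K * (u * (n₁ / (16 * K))) := by
            field_simp; ring
        _ ≤ 32 * K * (badP).card := by gcongr
        _ ≤ n₁ * n₁ := by linarith [hbadle, sq n₁]
    have h5 := le_of_mul_le_mul_right h4 hn₁pos
    linarith
  have hA'A₁ : A' ⊆ A₁ := Finset.filter_subset _ _
  have hA'A : A' ⊆ A := hA'A₁.trans (hA₁A₀.trans hA₀A)
  have hA'0 : (0 : ℝ) ≤ A'.card := Nat.cast_nonneg _
  set B' := B.filter (fun b => (A'.card : ℝ) / (4 * K) ≤ (A'.filter (fun a => (a, b) ∈ Γ)).card) with hB'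
  refine ⟨A', hA'A, B', Finset.filter_subset _ _, ?_, ?_⟩
  · have h1 : (A'.card : ℝ) * (m / (2 * K)) ≤ ∑ b ∈ B, ((A'.filter (fun a => (a, b) ∈ Γ)).card : ℝ) := by
      rw [← card_filter_eq_sum_right, card_filter_eq_sum_left, ← nsmul_eq_mul, ← Finset.sum_const]
      exact Finset.sum_le_sum fun a ha => (Finset.mem_filter.1 (hA₁A₀ (hA'A₁ ha))).2
    rw [card_filter_eq_sum_right]
    have h2 := Finset.sum_filter_add_sum_filter_not B
      (fun b => (A'.card : ℝ) / (4 * K) ≤ (A'.filter (fun a => (a, b) ∈ Γ)).card)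
      (fun b => ((A'.filter (fun a => (a, b) ∈ Γ)).card : ℝ))
    have h3 : ∑ b ∈ B with ¬ ((A'.card : ℝ) / (4 * K) ≤ (A'.filter (fun a => (a, b) ∈ Γ)).card),
        ((A'.filter (fun a => (a, b) ∈ Γ)).card : ℝ) ≤ m * ((A'.card : ℝ) / (4 * K)) := by
      refine le_trans (Finset.sum_le_sum fun b hb => (not_le.1 (Finset.mem_filter.1 hb).2).le) ?_
      rw [Finset.sum_const, nsmul_eq_mul]
      gcongr
      exact le_trans (by exact_mod_cast Finset.card_filter_le _ _) hB
    have h4 : (A'.card : ℝ) * (m / (2 * K)) = m * ((A'.card : ℝ) / (4 * K)) + (A'.card : ℝ) * (m / (4 * K)) := by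
      field_simp; ring
    have h5 : m ^ 2 / (24 * K ^ 2) ≤ (A'.card : ℝ) * (m / (4 * K)) := by
      calc m ^ 2 / (24 * K ^ 2) = (m / (3 * K) / 2) * (m / (4 * K)) := by field_simp; ring
        _ ≤ (A'.card : ℝ) * (m / (4 * K)) := by gcongr; linarith
    linarith
  · intro a ha b hb
    have hbΓ := (Finset.mem_filter.1 hb).2
    set S := (A'.filter (fun a₁ => (a₁, b) ∈ Γ)) \ bc a with hS
    have hScard : n₁ / (16 * K) ≤ S.card := by
      have h1 : (A'.filter (fun a₁ => (a₁, b) ∈ Γ)).card ≤ S.card + (bc a).card := by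
        have := Finset.le_card_sdiff (bc a) (A'.filter (fun a₁ => (a₁, b) ∈ Γ))
        rw [hS]
        omega
      have h1' : ((A'.filter (fun a₁ => (a₁, b) ∈ Γ)).card : ℝ) ≤ S.card + (bc a).card := by exact_mod_cast h1
      have h2 := (Finset.mem_filter.1 ha).2
      have h3 : n₁ / (8 * K) ≤ (A'.card : ℝ) / (4 * K) := by
        calc n₁ / (8 * K) = (n₁ / 2) / (4 * K) := by field_simp; ring
          _ ≤ _ := by gcongr
      have h4 : n₁ / (8 * K) = n₁ / (16 * K) + n₁ / (16 * K) := by field_simp; ring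
      linarith
    have hpaths : ∑ a₁ ∈ S, ((N a ∩ N a₁).card : ℝ) ≤
        (((A ×ˢ B).filter (fun p => (a, p.2) ∈ Γ ∧ p ∈ Γ ∧ (p.1, b) ∈ Γ)).card : ℝ) := by
      have : (S.sigma (fun a₁ => N a ∩ N a₁)).card ≤
          ((A ×ˢ B).filter (fun p => (a, p.2) ∈ Γ ∧ p ∈ Γ ∧ (p.1, b) ∈ Γ)).card := by
        refine Finset.card_le_card_of_injOn (fun q => (q.1, q.2)) ?_ ?_
        · rintro ⟨a₁, b₁⟩ hq
          have hq' := Finset.mem_sigma.1 (Finset.mem_coe.1 hq)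
          have h1 := Finset.mem_filter.1 (Finset.mem_sdiff.1 hq'.1).1
          have h2 := Finset.mem_inter.1 hq'.2
          refine Finset.mem_coe.2 (Finset.mem_filter.2 ⟨Finset.mem_product.2 ⟨hA'A h1.1, ?_⟩, ?_, ?_, h1.2⟩)
          · exact (Finset.mem_filter.1 h2.1).1
          · exact (Finset.mem_filter.1 h2.1).2
          · exact (Finset.mem_filter.1 h2.2).2
        · rintro ⟨a₁, b₁⟩ _ ⟨a₂, b₂⟩ _ h
          simp only [Prod.mk.injEq] at h
          obtain ⟨rfl, rfl⟩ := h
          rfl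
      rw [Finset.card_sigma] at this
      exact_mod_cast this
    refine le_trans ?_ hpaths
    have hgood : ∀ a₁ ∈ S, m / (256 * K ^ 3) ≤ ((N a ∩ N a₁).card : ℝ) := by
      intro a₁ ha₁
      have h1 := Finset.mem_sdiff.1 ha₁
      by_contra hcon
      exact h1.2 (Finset.mem_filter.2 ⟨hA'A₁ (Finset.mem_filter.1 h1.1).1, not_le.1 hcon⟩)
    calc m ^ 2 / (12288 * K ^ 5) = (m / (3 * K)) / (16 * K) * (m / (256 * K ^ 3)) := by
          field_simp; ring
      _ ≤ S.card * (m / (256 * K ^ 3)) := by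
          gcongr
          refine le_trans ?_ hScard
          gcongr
      _ = ∑ a₁ ∈ S, (m / (256 * K ^ 3)) := by rw [Finset.sum_const, nsmul_eq_mul]
      _ ≤ _ := Finset.sum_le_sum hgood

end BalogSzemerediGowers

/-- Balog–Szemerédi–Gowers theorem. A path `a, b₁, a₁, b` of length three in `Γ` writes `a + b` as
`(a + b₁) - (a₁ + b₁) + (a₁ + b)`, a combination of three sums along edges; every element of `A' + B'`
has many such representations. The number of edges that remain between `A'` and `B'` is recorded,
since the edges and not only the vertices come from the given points of the plane. -/
theorem exists_small_sumset {G : Type*} [AddCommGroup G] [DecidableEq G] (A B : Finset G)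
    (Γ : Finset (G × G)) {K m : ℝ}
    (hΓ : Γ ⊆ A ×ˢ B) (hK : 1 ≤ K) (hm : 0 < m) (hA : (A.card : ℝ) ≤ m) (hB : (B.card : ℝ) ≤ m)
    (hΓc : m ^ 2 ≤ K * Γ.card)
    (hS : ((Γ.image (fun p => p.1 + p.2)).card : ℝ) ≤ K * m) :
    ∃ A' ⊆ A, ∃ B' ⊆ B, m ^ 2 / (24 * K ^ 2) ≤ ((A' ×ˢ B').filter (· ∈ Γ)).card ∧
      ((A' + B').card : ℝ) ≤ 12288 * K ^ 8 * m := by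
  obtain ⟨A', hA', B', hB', h1, h2⟩ := exists_many_paths A B Γ hΓ hK hm hA hB hΓc
  refine ⟨A', hA', B', hB', h1, ?_⟩
  have hK0 : 0 < K := by linarith
  set S := Γ.image (fun p => p.1 + p.2) with hSdef
  have key : ((A' + B').card : ℝ) * (m ^ 2 / (12288 * K ^ 5)) ≤ (S.card : ℝ) ^ 3 := by
    have h3 : ∀ y ∈ A' + B', m ^ 2 / (12288 * K ^ 5) ≤
        (((S ×ˢ S ×ˢ S).filter (fun t => t.1 - t.2.1 + t.2.2 = y)).card : ℝ) := by
      intro y hy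
      obtain ⟨a, ha, b, hb, rfl⟩ := Finset.mem_add.1 hy
      refine (h2 a ha b hb).trans ?_
      norm_cast
      refine Finset.card_le_card_of_injOn (fun p => (a + p.2, p.1 + p.2, p.1 + b)) ?_ ?_
      · rintro ⟨a₁, b₁⟩ hp
        obtain ⟨-, e1, e2, e3⟩ := Finset.mem_filter.1 (Finset.mem_coe.1 hp)
        refine Finset.mem_coe.2 (Finset.mem_filter.2 ⟨?_, ?_⟩)
        · simp only [Finset.mem_product]
          exact ⟨Finset.mem_image_of_mem _ e1, Finset.mem_image_of_mem _ e2,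
            Finset.mem_image_of_mem _ e3⟩
        · simp only
          abel
      · rintro ⟨a₁, b₁⟩ _ ⟨a₂, b₂⟩ _ h
        simp only [Prod.mk.injEq] at h
        have e1 := add_left_cancel h.1
        have e2 := add_right_cancel h.2.2
        rw [e1, e2]
    have h4 : ((S ×ˢ S ×ˢ S).card : ℝ) = (S.card : ℝ) ^ 3 := by
      rw [Finset.card_product, Finset.card_product]; push_cast; ring
    rw [← h4, ← nsmul_eq_mul, ← Finset.sum_const]
    refine (Finset.sum_le_sum h3).trans ?_
    have := Finset.sum_card_fiberwise_eq_card_filter (S ×ˢ S ×ˢ S) (A' + B')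
      (fun t => t.1 - t.2.1 + t.2.2)
    have h5 := this.le.trans (Finset.card_filter_le _ _)
    exact_mod_cast h5
  have h5 : (S.card : ℝ) ^ 3 ≤ (K * m) ^ 3 := by gcongr
  have h6 : ((A' + B').card : ℝ) * (m ^ 2 / (12288 * K ^ 5)) ≤ (K * m) ^ 3 := key.trans h5
  have h7 : (K * m) ^ 3 = 12288 * K ^ 8 * m * (m ^ 2 / (12288 * K ^ 5)) := by field_simp
  rw [h7] at h6
  exact le_of_mul_le_mul_right h6 (by positivity)
/-! ### Popular points and counting lemmas -/


/-- If the integer `g p` is determined by `f p` up to an error `c`, then `(f, g)` takes at most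
`2 c + 1` times as many values as `f`. -/
theorem card_image_pair_le {γ δ : Type*} [DecidableEq δ] (S : Finset γ) (f : γ → δ) (g : γ → ℤ)
    (φ : δ → ℝ) {c : ℝ} (hc : 0 ≤ c) (h : ∀ p ∈ S, |(g p : ℝ) - φ (f p)| ≤ c) :
    ((S.image (fun p => (f p, g p))).card : ℝ) ≤ (2 * c + 1) * (S.image f).card := by
  set U := (S.image f).sigma (fun d => Finset.Icc ⌈φ d - c⌉ ⌊φ d + c⌋) with hU
  have h1 : (S.image (fun p => (f p, g p))).card ≤ U.card := by
    refine Finset.card_le_card_of_injOn (fun q => ⟨q.1, q.2⟩) ?_ ?_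
    · rintro q hq
      obtain ⟨p, hp, rfl⟩ := Finset.mem_image.1 (Finset.mem_coe.1 hq)
      have := abs_le.1 (h p hp)
      refine Finset.mem_coe.2 (Finset.mem_sigma.2 ⟨Finset.mem_image_of_mem _ hp, Finset.mem_Icc.2 ⟨?_, ?_⟩⟩)
      · exact Int.ceil_le.2 (by linarith)
      · exact Int.le_floor.2 (by linarith)
    · rintro ⟨a, b⟩ _ ⟨a', b'⟩ _ hab
      simp only [Sigma.mk.injEq, heq_eq_eq] at hab
      exact Prod.ext hab.1 hab.2
  have h2 : (U.card : ℝ) ≤ ∑ d ∈ S.image f, (2 * c + 1) := by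
    rw [hU, Finset.card_sigma]
    push_cast
    refine Finset.sum_le_sum fun d _ => ?_
    rw [Int.card_Icc]
    rcases le_total 0 (⌊φ d + c⌋ + 1 - ⌈φ d - c⌉) with h0 | h0
    · have : ((⌊φ d + c⌋ + 1 - ⌈φ d - c⌉).toNat : ℝ) = ⌊φ d + c⌋ + 1 - ⌈φ d - c⌉ := by
        exact_mod_cast congrArg (Int.cast : ℤ → ℝ) (Int.toNat_of_nonneg h0)
      rw [this]
      linarith [Int.floor_le (φ d + c), Int.le_ceil (φ d - c)]
    · rw [Int.toNat_of_nonpos h0]; push_cast; linarith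
  rw [Finset.sum_const, nsmul_eq_mul, mul_comm] at h2
  exact le_trans (by exact_mod_cast h1) h2

theorem card_image_le_of_near {γ δ : Type*} [DecidableEq δ] (S : Finset γ) (f : γ → δ) (g : γ → ℤ)
    (φ : δ → ℝ) {c : ℝ} (hc : 0 ≤ c) (h : ∀ p ∈ S, |(g p : ℝ) - φ (f p)| ≤ c) :
    ((S.image g).card : ℝ) ≤ (2 * c + 1) * (S.image f).card := by
  refine le_trans ?_ (card_image_pair_le S f g φ hc h)
  have : S.image g = (S.image (fun p => (f p, g p))).image Prod.snd := by
    rw [Finset.image_image]; rfl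
  rw [this]
  exact_mod_cast Finset.card_image_le

/-- If every point of `E` lies in `G i` for indices `i` of total weight at least `ω`, then the indices `i`
for which `G i` contains a proportion `ω / 4` of `E` have total weight at least `ω / 4`, even after
removing a set `X` of indices of weight at most `ω / 2`. -/
theorem weight_of_rich_indices {ι γ : Type*} [DecidableEq γ] (J : Finset ι) (w : ι → ℝ)
    (G : ι → Finset γ) (E : Finset γ) {ω : ℝ} (hω : 0 < ω) (hw : ∀ i ∈ J, 0 ≤ w i)
    (hW : ∑ i ∈ J, w i ≤ 1) (hE : ∀ p ∈ E, ω ≤ ∑ i ∈ J with p ∈ G i, w i)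
    (X : ι → Prop) [DecidablePred X] (hX : ∑ i ∈ J with X i, w i ≤ ω / 2) (hEne : E.Nonempty) :
    ω / 4 ≤ ∑ i ∈ J with (¬ X i ∧ ω / 4 * E.card ≤ (E ∩ G i).card), w i := by
  classical
  have hE0 : (0 : ℝ) < E.card := by exact_mod_cast Finset.card_pos.2 hEne
  have h1 : ω * E.card ≤ ∑ i ∈ J, w i * (E ∩ G i).card := by
    calc ω * E.card = ∑ p ∈ E, ω := by rw [Finset.sum_const, nsmul_eq_mul, mul_comm]
      _ ≤ ∑ p ∈ E, ∑ i ∈ J with p ∈ G i, w i := Finset.sum_le_sum hE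
      _ = ∑ p ∈ E, ∑ i ∈ J, (if p ∈ G i then w i else 0) := by simp_rw [Finset.sum_filter]
      _ = ∑ i ∈ J, ∑ p ∈ E, (if p ∈ G i then w i else 0) := Finset.sum_comm
      _ = ∑ i ∈ J, w i * (E ∩ G i).card := by
          refine Finset.sum_congr rfl fun i _ => ?_
          rw [← Finset.sum_filter, Finset.sum_const, nsmul_eq_mul, mul_comm, Finset.filter_mem_eq_inter]
  have h2 : ∀ i ∈ J, w i * (E ∩ G i).card ≤ (if X i then w i else 0) * E.card + w i * (ω / 4 * E.card) +
      (if (¬ X i ∧ ω / 4 * E.card ≤ (E ∩ G i).card) then w i else 0) * E.card := by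
    intro i hi
    have hwi := hw i hi
    have hle : ((E ∩ G i).card : ℝ) ≤ E.card := by
      exact_mod_cast Finset.card_le_card Finset.inter_subset_left
    have h3 : w i * (E ∩ G i).card ≤ w i * E.card := by gcongr
    have h4 : 0 ≤ w i * (ω / 4 * E.card) := by positivity
    have h5 : 0 ≤ w i * E.card := by positivity
    by_cases hXi : X i
    · simp only [hXi, if_true, not_true, false_and, if_false]
      linarith
    · by_cases hc : ω / 4 * E.card ≤ (E ∩ G i).card
      · simp only [hXi, hc, if_false, not_false_iff, true_and, if_true]
        linarith
      · simp only [hXi, hc, if_false, not_false_iff, and_false]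
        have : w i * (E ∩ G i).card ≤ w i * (ω / 4 * E.card) := by
          gcongr; exact (not_le.1 hc).le
        linarith
  have h3 := Finset.sum_le_sum h2
  rw [Finset.sum_add_distrib, Finset.sum_add_distrib, ← Finset.sum_mul, ← Finset.sum_mul,
    ← Finset.sum_mul, ← Finset.sum_filter, ← Finset.sum_filter] at h3
  have h4 : (∑ i ∈ J with X i, w i) * (E.card : ℝ) ≤ ω / 2 * E.card := by gcongr
  have h5 : (∑ i ∈ J, w i) * (ω / 4 * E.card) ≤ 1 * (ω / 4 * E.card) := by gcongr
  have h6 : ω / 4 * E.card ≤ (∑ i ∈ J with (¬ X i ∧ ω / 4 * E.card ≤ (E ∩ G i).card), w i) * E.card := by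
    linarith
  exact le_of_mul_le_mul_right h6 hE0

theorem exists_rich_index {ι γ : Type*} [DecidableEq γ] (J : Finset ι) (w : ι → ℝ)
    (G : ι → Finset γ) (E : Finset γ) {ω : ℝ} (hω : 0 < ω) (hw : ∀ i ∈ J, 0 ≤ w i)
    (hW : ∑ i ∈ J, w i ≤ 1) (hE : ∀ p ∈ E, ω ≤ ∑ i ∈ J with p ∈ G i, w i)
    (X : ι → Prop) (hX : ∀ [DecidablePred X], ∑ i ∈ J with X i, w i ≤ ω / 2) (hEne : E.Nonempty) :
    ∃ i ∈ J, ¬ X i ∧ ω / 4 * E.card ≤ (E ∩ G i).card := by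
  classical
  have h := weight_of_rich_indices J w G E hω hw hW hE X hX hEne
  by_contra hcon
  push Not at hcon
  rw [Finset.filter_false_of_mem (fun i hi h' => absurd (hcon i hi h'.1) (not_lt.2 h'.2)),
    Finset.sum_empty] at h
  linarith

/-- If the sets `G i` are large subsets of `P` and the total weight of the indices is not small, then
many points of `P` lie in `G i` for a substantial weight of indices. -/
theorem exists_popular_points {ι γ : Type*} [DecidableEq γ] (J : Finset ι) (w : ι → ℝ)
    (G : ι → Finset γ) (P : Finset γ) {K : ℝ} (hK : 0 < K) (hw : ∀ i ∈ J, 0 ≤ w i)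
    (hW : ∑ i ∈ J, w i ≤ 1) (hWK : 1 / K ≤ ∑ i ∈ J, w i) (hG : ∀ i ∈ J, G i ⊆ P)
    (hGK : ∀ i ∈ J, (P.card : ℝ) ≤ K * (G i).card) :
    ∃ E ⊆ P, (P.card : ℝ) ≤ 2 * K ^ 2 * E.card ∧
      ∀ p ∈ E, 1 / (2 * K ^ 2) ≤ ∑ i ∈ J with p ∈ G i, w i := by
  classical
  set E := P.filter (fun p => 1 / (2 * K ^ 2) ≤ ∑ i ∈ J with p ∈ G i, w i) with hE
  refine ⟨E, Finset.filter_subset _ _, ?_, fun p hp => (Finset.mem_filter.1 hp).2⟩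
  have h1 : (P.card : ℝ) / K ^ 2 ≤ ∑ i ∈ J, w i * (G i).card := by
    calc (P.card : ℝ) / K ^ 2 = 1 / K * (P.card / K) := by field_simp
      _ ≤ (∑ i ∈ J, w i) * (P.card / K) := by gcongr
      _ = ∑ i ∈ J, w i * (P.card / K) := by rw [Finset.sum_mul]
      _ ≤ ∑ i ∈ J, w i * (G i).card := Finset.sum_le_sum fun i hi => by
          have := hw i hi
          gcongr
          rw [div_le_iff₀ hK]; linarith [hGK i hi]
  have h2 : ∑ i ∈ J, w i * (G i).card = ∑ p ∈ P, ∑ i ∈ J with p ∈ G i, w i := by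
    simp_rw [Finset.sum_filter]
    rw [Finset.sum_comm]
    refine Finset.sum_congr rfl fun i hi => ?_
    rw [← Finset.sum_filter, Finset.sum_const, nsmul_eq_mul, mul_comm, Finset.filter_mem_eq_inter,
      Finset.inter_eq_right.2 (hG i hi)]
  have h3 : ∀ p ∈ P, ∑ i ∈ J with p ∈ G i, w i ≤
      (if 1 / (2 * K ^ 2) ≤ ∑ i ∈ J with p ∈ G i, w i then 1 else 0) + 1 / (2 * K ^ 2) := by
    intro p _
    have hle : ∑ i ∈ J with p ∈ G i, w i ≤ 1 :=
      (Finset.sum_le_sum_of_subset_of_nonneg (Finset.filter_subset _ _) fun i hi _ => hw i hi).trans hW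
    have : 0 ≤ 1 / (2 * K ^ 2) := by positivity
    split_ifs with h
    · linarith
    · linarith [not_le.1 h]
  have h4 := Finset.sum_le_sum h3
  rw [← h2, Finset.sum_add_distrib, ← Finset.sum_filter, Finset.sum_const, Finset.sum_const,
    nsmul_eq_mul, nsmul_eq_mul, mul_one] at h4
  have h5 : (P.card : ℝ) / K ^ 2 = P.card * (1 / (2 * K ^ 2)) + P.card / (2 * K ^ 2) := by
    field_simp; norm_num
  have h6 : (P.card : ℝ) / (2 * K ^ 2) ≤ E.card := by linarith
  rw [div_le_iff₀ (by positivity)] at h6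
  linarith

theorem exists_maximal_separated {α : Type*} [DecidableEq α] (T : Finset α) (d : α → α → ℝ)
    (hsymm : ∀ x y, d x y = d y x) (r : ℝ) (h0 : ∀ x, d x x < r) :
    ∃ B ⊆ T, (∀ x ∈ B, ∀ y ∈ B, x ≠ y → r ≤ d x y) ∧ ∀ t ∈ T, ∃ b ∈ B, d t b < r := by
  classical
  induction T using Finset.induction_on with
  | empty => exact ⟨∅, by simp⟩
  | insert a T _ ih =>
    obtain ⟨B, hB, h1, h2⟩ := ih
    by_cases h : ∃ b ∈ B, d a b < r
    · refine ⟨B, hB.trans (Finset.subset_insert _ _), h1, ?_⟩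
      intro t ht
      rcases Finset.mem_insert.1 ht with rfl | ht
      · exact h
      · exact h2 t ht
    · push Not at h
      refine ⟨insert a B, Finset.insert_subset_insert _ hB, ?_, ?_⟩
      · intro x hx y hy hxy
        rcases Finset.mem_insert.1 hx with hxa | hxB <;>
          rcases Finset.mem_insert.1 hy with hya | hyB
        · exact absurd (hxa.trans hya.symm) hxy
        · rw [hxa]; exact h y hyB
        · rw [hya, hsymm]; exact h x hxB
        · exact h1 x hxB y hyB hxy
      · intro t ht
        rcases Finset.mem_insert.1 ht with rfl | ht
        · exact ⟨t, Finset.mem_insert_self _ _, h0 t⟩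
        · obtain ⟨b, hb, h3⟩ := h2 t ht
          exact ⟨b, Finset.mem_insert_of_mem hb, h3⟩
/-! ### Sets of integers with small sumset -/


/-- Two sets of integers whose sizes and whose sumset are comparable to `n` up to factors `Q`. Upper
bounds for `|A|` and `|B|` follow from the one for `|A + B|`. -/
structure SmallSumset (A B : Finset ℤ) (Q n : ℝ) : Prop where
  pos : 0 < n
  left_le : n ≤ Q * A.card
  right_le : n ≤ Q * B.card
  sum_le : ((A + B).card : ℝ) ≤ Q * n

namespace SmallSumset

variable {A B : Finset ℤ} {Q n : ℝ}

theorem left_nonempty (h : SmallSumset A B Q n) : A.Nonempty := by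
  rw [Finset.nonempty_iff_ne_empty]; rintro rfl
  have := h.left_le
  have := h.pos
  simp at *
  linarith

theorem right_nonempty (h : SmallSumset A B Q n) : B.Nonempty := by
  rw [Finset.nonempty_iff_ne_empty]; rintro rfl
  have := h.right_le
  have := h.pos
  simp at *
  linarith

theorem left_card_le (h : SmallSumset A B Q n) : (A.card : ℝ) ≤ Q * n :=
  le_trans (by exact_mod_cast Finset.card_le_card_add_right h.right_nonempty) h.sum_le

theorem right_card_le (h : SmallSumset A B Q n) : (B.card : ℝ) ≤ Q * n :=
  le_trans (by exact_mod_cast Finset.card_le_card_add_left h.left_nonempty) h.sum_le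

theorem iterated_card_le (h : SmallSumset A B Q n) (hQ : 1 ≤ Q) (i j : ℕ) :
    ((i • A - j • A).card : ℝ) ≤ Q ^ (2 * (i + j) + 2) * A.card := by
  have hB := h.right_nonempty
  have h1 := Finset.pluennecke_ruzsa_inequality_nsmul_sub_nsmul_add hB A i j
  have h2 : ((i • A - j • A).card : ℝ) ≤ (((B + A).card : ℝ) / B.card) ^ (i + j) * B.card := by
    have h5 := (NNRat.cast_le (K := ℝ)).2 h1
    push_cast at h5
    exact h5
  have hB0 : (0 : ℝ) < B.card := by exact_mod_cast hB.card_pos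
  have hQ0 : 0 ≤ Q := by linarith
  have h3 : ((B + A).card : ℝ) / B.card ≤ Q ^ 2 := by
    rw [div_le_iff₀ hB0, add_comm]
    calc ((A + B).card : ℝ) ≤ Q * n := h.sum_le
      _ ≤ Q * (Q * B.card) := by gcongr; exact h.right_le
      _ = Q ^ 2 * B.card := by ring
  have h4 : (B.card : ℝ) ≤ Q ^ 2 * A.card := by
    calc (B.card : ℝ) ≤ Q * n := h.right_card_le
      _ ≤ Q * (Q * A.card) := by gcongr; exact h.left_le
      _ = Q ^ 2 * A.card := by ring
  calc _ ≤ (((B + A).card : ℝ) / B.card) ^ (i + j) * B.card := h2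
    _ ≤ (Q ^ 2) ^ (i + j) * (Q ^ 2 * A.card) := by gcongr
    _ = Q ^ (2 * (i + j) + 2) * A.card := by rw [← pow_mul]; ring

theorem card_sub_add_sub_add_right_le (h : SmallSumset A B Q n) (hQ : 1 ≤ Q) :
    (((A - A) + B).card : ℝ) ≤ Q ^ 14 * n := by
  have hQ0 : 0 ≤ Q := by linarith
  obtain ⟨F, -, hF, hcov⟩ := Finset.ruzsa_covering_add (A := B) (B := A) h.left_nonempty (K := Q ^ 2) (by
    rw [add_comm]
    calc ((A + B).card : ℝ) ≤ Q * n := h.sum_le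
      _ ≤ Q * (Q * A.card) := by gcongr; exact h.left_le
      _ = Q ^ 2 * A.card := by ring)
  have h1 : (A - A) + B ⊆ F + (2 • A - 2 • A) := by
    have e : F + (2 • A - 2 • A) = (A - A) + (F + (A - A)) := by
      simp only [two_nsmul, sub_eq_add_neg, neg_add]; ac_rfl
    rw [e]
    exact Finset.add_subset_add_left hcov
  have h2 := h.iterated_card_le hQ 2 2
  calc (((A - A) + B).card : ℝ) ≤ (F + (2 • A - 2 • A)).card := by
        exact_mod_cast Finset.card_le_card h1
    _ ≤ F.card * (2 • A - 2 • A).card := by exact_mod_cast Finset.card_add_le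
    _ ≤ Q ^ 2 * (Q ^ (2 * (2 + 2) + 2) * A.card) := by gcongr
    _ ≤ Q ^ 2 * (Q ^ (2 * (2 + 2) + 2) * (Q * n)) := by gcongr; exact h.left_card_le
    _ = Q ^ 13 * n := by ring
    _ ≤ Q ^ 14 * n := by
        have := h.pos
        gcongr
        norm_num

theorem isApproxGroup (h : SmallSumset A B Q n) (hQ : 1 ≤ Q) : IsApproxGroup (A - A) (Q ^ 12) := by
  obtain ⟨a, ha⟩ := h.left_nonempty
  refine ⟨Finset.mem_sub.2 ⟨a, ha, a, ha, sub_self a⟩, ?_, ?_⟩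
  · intro v hv
    obtain ⟨x, hx, y, hy, rfl⟩ := Finset.mem_sub.1 hv
    exact Finset.mem_sub.2 ⟨y, hy, x, hx, by ring⟩
  · obtain ⟨F, -, hF, hcov⟩ := Finset.ruzsa_covering_add (A := 2 • A - 2 • A) (B := A)
      h.left_nonempty (K := Q ^ 12) (by
        have e : 2 • A - 2 • A + A = 3 • A - 2 • A := by
          rw [succ_nsmul A 2, sub_eq_add_neg, sub_eq_add_neg]; ac_rfl
        rw [e]
        exact h.iterated_card_le hQ 3 2)
    refine ⟨F, hF, fun u hu v hv => ?_⟩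
    have : u + v ∈ 2 • A - 2 • A := by
      have e : 2 • A - 2 • A = (A - A) + (A - A) := by
        simp only [two_nsmul, sub_eq_add_neg, neg_add]; ac_rfl
      rw [e]
      exact Finset.add_mem_add hu hv
    obtain ⟨f, hf, w, hw, e⟩ := Finset.mem_add.1 (hcov this)
    exact ⟨f, hf, w, hw, e.symm⟩

theorem card_sub_le (h : SmallSumset A B Q n) (hQ : 1 ≤ Q) : ((A - A).card : ℝ) ≤ Q ^ 7 * n := by
  have := h.iterated_card_le hQ 1 1
  rw [one_nsmul] at this
  calc ((A - A).card : ℝ) ≤ Q ^ (2 * (1 + 1) + 2) * A.card := this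
    _ ≤ Q ^ (2 * (1 + 1) + 2) * (Q * n) := by gcongr; exact h.left_card_le
    _ = Q ^ 7 * n := by ring

/-- If `t b + φ b` is nearly constant for `b` in a large subset `D` of `B`, with `φ b ∈ A`, then `t` is a
multiplier of `A - A`: Ruzsa covering covers `A - A` by few translates of `D - D`, and
`t (b - b')` is close to `φ b' - φ b ∈ A - A`. -/
theorem isMultiplier (h : SmallSumset A B Q n) (hQ : 2 ≤ Q) {t z : ℝ} (ht : |t| ≤ Q)
    (D : Finset ℤ) (hDB : D ⊆ B) (hD : n ≤ Q * D.card) (φ : ℤ → ℤ) (hφ : ∀ b ∈ D, φ b ∈ A)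
    (hz : ∀ b ∈ D, |t * b + φ b - z| ≤ Q) : IsMultiplier (A - A) (Q ^ 15) t := by
  classical
  have hQ1 : 1 ≤ Q := by linarith
  have hDne : D.Nonempty := by
    rw [Finset.nonempty_iff_ne_empty]; rintro rfl
    have := h.pos
    simp at hD
    linarith
  obtain ⟨F, -, hF, hcov⟩ := Finset.ruzsa_covering_add (A := A - A) (B := D) hDne (K := Q ^ 15) (by
    calc ((A - A + D).card : ℝ) ≤ (A - A + B).card := by
          exact_mod_cast Finset.card_le_card (Finset.add_subset_add_left hDB)
      _ ≤ Q ^ 14 * n := h.card_sub_add_sub_add_right_le hQ1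
      _ ≤ Q ^ 14 * (Q * D.card) := by gcongr
      _ = Q ^ 15 * D.card := by ring)
  have hQQ : 2 * Q ≤ Q ^ 15 := by
    calc 2 * Q ≤ Q * Q := by gcongr
      _ = Q ^ 2 := by ring
      _ ≤ Q ^ 15 := pow_le_pow_right₀ hQ1 (by norm_num)
  refine ⟨ht.trans (by linarith), F.image (fun f : ℤ => t * f), ?_, ?_⟩
  · exact le_trans (by exact_mod_cast Finset.card_image_le) hF
  · intro v hv
    obtain ⟨f, hf, d, hd, rfl⟩ := Finset.mem_add.1 (hcov hv)
    obtain ⟨b, hb, b', hb', rfl⟩ := Finset.mem_sub.1 hd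
    refine ⟨φ b' - φ b, Finset.sub_mem_sub (hφ _ hb') (hφ _ hb), t * f,
      Finset.mem_image_of_mem (fun f : ℤ => t * (f : ℝ)) hf, ?_⟩
    have h1 := hz b hb
    have h2 := hz b' hb'
    have e : t * ((f + (b - b') : ℤ) : ℝ) - ((φ b' - φ b : ℤ) : ℝ) - t * f
        = (t * b + φ b - z) - (t * b' + φ b' - z) := by push_cast; ring
    rw [e]
    exact (abs_sub _ _).trans (by linarith)

/-- If `W` lies in an interval of length `2 ℓ`, then translates of `W` by points of `S` from different
cells of length `ℓ` overlap boundedly often, so `|W + S|` is at least about `|W|` times the number of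
cells of `S`. -/
theorem card_cells_mul_le {S W : Finset ℤ} {x ℓ : ℝ} (hℓ : 0 < ℓ)
    (hW : ∀ w ∈ W, |(w : ℝ) - x| ≤ ℓ) :
    ((S.image (fun a : ℤ => ⌊(a : ℝ) / ℓ⌋)).card : ℝ) * W.card ≤ 5 * (W + S).card := by
  classical
  set q : ℤ → ℤ := fun a : ℤ => ⌊(a : ℝ) / ℓ⌋ with hq
  have hex : ∀ c ∈ S.image q, ∃ a ∈ S, q a = c := fun c hc => Finset.mem_image.1 hc
  choose! g hgS hgq using hex
  set U := (S.image q) ×ˢ W with hU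
  have h1 := card_image_pair_le U (fun p => p.2 + g p.1) (fun p => p.1)
    (fun z : ℤ => ((z : ℝ) - x) / ℓ) (c := 2) (by norm_num) (by
      rintro ⟨c, w⟩ hp
      obtain ⟨hc, hw⟩ := Finset.mem_product.1 hp
      simp only at hc hw ⊢
      have e := hgq c hc
      simp only [hq] at e
      rw [Int.floor_eq_iff] at e
      have h2 := hW w hw
      have e2 : (((w + g c : ℤ) : ℝ) - x) / ℓ = (g c : ℝ) / ℓ + ((w : ℝ) - x) / ℓ := by
        push_cast; ring
      have h3 : |((w : ℝ) - x) / ℓ| ≤ 1 := by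
        rw [abs_div, abs_of_pos hℓ, div_le_one hℓ]; exact h2
      rw [e2]
      rw [abs_le] at h3 ⊢
      constructor <;> linarith [e.1, e.2, h3.1, h3.2])
  have h2 : (U.image (fun p => (p.2 + g p.1, p.1))).card = U.card := by
    refine Finset.card_image_of_injective _ ?_
    rintro ⟨c, w⟩ ⟨c', w'⟩ hpp
    simp only [Prod.mk.injEq] at hpp
    obtain ⟨e1, rfl⟩ := hpp
    have := add_right_cancel e1
    rw [this]
  have h3 : U.image (fun p => p.2 + g p.1) ⊆ W + S := by
    intro z hz
    obtain ⟨p, hp, rfl⟩ := Finset.mem_image.1 hz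
    obtain ⟨hc, hw⟩ := Finset.mem_product.1 hp
    exact Finset.add_mem_add hw (hgS _ hc)
  rw [h2, hU, Finset.card_product] at h1
  push_cast at h1
  refine h1.trans ?_
  have h4 : ((U.image (fun p => p.2 + g p.1)).card : ℝ) ≤ (W + S).card := by
    exact_mod_cast Finset.card_le_card h3
  rw [hU] at h4
  linarith

/-- If a proportion `θ` of `A - A` is concentrated on an interval of length `2 ℓ`, then `A` and `B` are
contained in about `1 / θ` intervals of length `ℓ`. -/
theorem card_cells_le (h : SmallSumset A B Q n) (hQ : 5 ≤ Q) {x ℓ θ : ℝ} (hℓ : 0 < ℓ) (hθ : 0 < θ)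
    (hconc : θ * ((A - A).card : ℝ) < ((A - A).filter (fun v : ℤ => |(v : ℝ) - x| ≤ ℓ)).card) :
    ((A.image (fun a : ℤ => ⌊(a : ℝ) / ℓ⌋)).card : ℝ) ≤ Q ^ 16 / θ ∧
    ((B.image (fun a : ℤ => ⌊(a : ℝ) / ℓ⌋)).card : ℝ) ≤ Q ^ 16 / θ := by
  classical
  have hQ1 : 1 ≤ Q := by linarith
  set W := (A - A).filter (fun v : ℤ => |(v : ℝ) - x| ≤ ℓ) with hW
  have hWA : W ⊆ A - A := Finset.filter_subset _ _
  have hn : n ≤ Q * (A - A).card := by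
    refine h.left_le.trans (mul_le_mul_of_nonneg_left ?_ (by linarith))
    rw [sub_eq_add_neg]
    exact_mod_cast Finset.card_le_card_add_right (s := A) (t := -A) h.left_nonempty.neg
  have hWn : θ * n ≤ Q * W.card := by
    calc θ * n ≤ θ * (Q * (A - A).card) := by gcongr
      _ = Q * (θ * (A - A).card) := by ring
      _ ≤ Q * W.card := by gcongr
  have key : ∀ S : Finset ℤ, ((A - A + S).card : ℝ) ≤ Q ^ 14 * n →
      ((S.image (fun a : ℤ => ⌊(a : ℝ) / ℓ⌋)).card : ℝ) ≤ Q ^ 16 / θ := by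
    intro S hS
    have h1 := card_cells_mul_le (S := S) (W := W) (x := x) hℓ (fun w hw => (Finset.mem_filter.1 hw).2)
    have h2 : ((W + S).card : ℝ) ≤ Q ^ 14 * n :=
      le_trans (by exact_mod_cast Finset.card_le_card (Finset.add_subset_add_right hWA)) hS
    set N : ℝ := ((S.image (fun a : ℤ => ⌊(a : ℝ) / ℓ⌋)).card : ℝ) with hN
    have hN0 : 0 ≤ N := Nat.cast_nonneg _
    rw [le_div_iff₀ hθ]
    have h3 : N * θ * n ≤ Q ^ 16 * n := by
      calc N * θ * n = N * (θ * n) := by ring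
        _ ≤ N * (Q * W.card) := by gcongr
        _ = Q * (N * W.card) := by ring
        _ ≤ Q * (5 * (W + S).card) := by gcongr
        _ ≤ Q * (Q * (Q ^ 14 * n)) := by gcongr
        _ = Q ^ 16 * n := by ring
    exact le_of_mul_le_mul_right h3 h.pos
  refine ⟨key A ?_, key B (h.card_sub_add_sub_add_right_le hQ1)⟩
  have h1 := h.iterated_card_le hQ1 2 1
  have e : 2 • A - 1 • A = A - A + A := by
    rw [two_nsmul, one_nsmul, sub_eq_add_neg, sub_eq_add_neg]; ac_rfl
  rw [e] at h1
  calc ((A - A + A).card : ℝ) ≤ Q ^ (2 * (2 + 1) + 2) * A.card := h1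
    _ ≤ Q ^ (2 * (2 + 1) + 2) * (Q * n) := by gcongr; exact h.left_card_le
    _ = Q ^ 9 * n := by ring
    _ ≤ Q ^ 14 * n := by
        have := h.pos
        gcongr
        norm_num

end SmallSumset
/-! ### Coordinates given by separated slopes -/


/-- If both coordinates of `p` are determined by `f p` up to an error `c`, then the fibres of `f` have at
most `(2 c + 1) ^ 2` points. -/
theorem card_le_mul_card_image {δ : Type*} [DecidableEq δ] (S : Finset (ℤ × ℤ)) (f : ℤ × ℤ → δ)
    (φ ψ : δ → ℝ) {c : ℝ} (hc : 0 ≤ c) (hφ : ∀ p ∈ S, |(p.1 : ℝ) - φ (f p)| ≤ c)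
    (hψ : ∀ p ∈ S, |(p.2 : ℝ) - ψ (f p)| ≤ c) :
    (S.card : ℝ) ≤ (2 * c + 1) ^ 2 * (S.image f).card := by
  have h1 := card_image_pair_le S f (fun p => p.1) φ hc hφ
  have h2 := card_image_pair_le S (fun p => (f p, p.1)) (fun p => p.2) (fun q => ψ q.1) hc hψ
  have h3 : (S.image (fun p => ((f p, p.1), p.2))).card = S.card := by
    refine Finset.card_image_of_injective _ ?_
    rintro ⟨x, y⟩ ⟨x', y'⟩ h
    simp only [Prod.mk.injEq] at h ⊢
    exact ⟨h.1.2, h.2⟩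
  rw [h3] at h2
  calc (S.card : ℝ) ≤ (2 * c + 1) * _ := h2
    _ ≤ (2 * c + 1) * ((2 * c + 1) * (S.image f).card) := by gcongr
    _ = _ := by ring

/-- A point of the plane is determined by its projections with two separated slopes. -/
theorem abs_sub_le_of_two_projections {D c s s' u u' x y : ℝ} (hs : |s| ≤ 1)
    (hD : 1 / D ≤ |s - s'|) (hD0 : 0 < D) (hu : |x + s * y - u| ≤ c) (hu' : |x + s' * y - u'| ≤ c) :
    |x - (u - s * ((u - u') / (s - s')))| ≤ c + 2 * c * D ∧ |y - (u - u') / (s - s')| ≤ 2 * c * D := by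
  have hss : 0 < |s - s'| := lt_of_lt_of_le (by positivity) hD
  have hne : s - s' ≠ 0 := abs_pos.1 hss
  have hy : |y - (u - u') / (s - s')| ≤ 2 * c * D := by
    have e : y - (u - u') / (s - s') = ((x + s * y - u) - (x + s' * y - u')) / (s - s') := by
      field_simp; ring
    rw [e, abs_div, div_le_iff₀ hss]
    have h1 : 1 ≤ D * |s - s'| := by rwa [div_le_iff₀' hD0] at hD
    have hc : 0 ≤ c := (abs_nonneg _).trans hu
    calc _ ≤ |x + s * y - u| + |x + s' * y - u'| := abs_sub _ _
      _ ≤ 2 * c * 1 := by linarith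
      _ ≤ 2 * c * (D * |s - s'|) := by gcongr
      _ = _ := by ring
  refine ⟨?_, hy⟩
  have e : x - (u - s * ((u - u') / (s - s'))) = (x + s * y - u) - s * (y - (u - u') / (s - s')) := by
    ring
  rw [e]
  calc _ ≤ |x + s * y - u| + |s * (y - (u - u') / (s - s'))| := abs_sub _ _
    _ ≤ c + 1 * (2 * c * D) := by
        rw [abs_mul]; gcongr
    _ = _ := by ring

theorem abs_sub_floor_le (x : ℝ) : |x - ⌊x⌋| ≤ 1 := by
  rw [abs_le]; constructor <;> linarith [Int.floor_le x, Int.lt_floor_add_one x]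

/-- Three slopes in `[-1, 1]` that are pairwise separated by `1 / D`. The lower bound for `D` allows
numerical constants to be absorbed into powers of `D`. -/
structure SeparatedSlopes (D s₀ s₁ s₂ : ℝ) : Prop where
  le : 64 ≤ D
  abs₀ : |s₀| ≤ 1
  abs₁ : |s₁| ≤ 1
  abs₂ : |s₂| ≤ 1
  sep₀₁ : 1 / D ≤ |s₀ - s₁|
  sep₀₂ : 1 / D ≤ |s₀ - s₂|
  sep₁₂ : 1 / D ≤ |s₁ - s₂|

/-- The projection of `p` with slope `s`, rounded down after a scaling for which
`slopeCoord s s' t p + slopeCoord s' s t p` is approximately the projection of `p` with slope `t`. -/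
noncomputable def slopeCoord (s s' t : ℝ) (p : ℤ × ℤ) : ℤ :=
  ⌊(s' - t) / (s' - s) * (p.1 + s * p.2)⌋

namespace SeparatedSlopes

variable {D s₀ s₁ s₂ : ℝ}

theorem swap (h : SeparatedSlopes D s₀ s₁ s₂) : SeparatedSlopes D s₁ s₀ s₂ :=
  ⟨h.le, h.abs₁, h.abs₀, h.abs₂, by rw [abs_sub_comm]; exact h.sep₀₁, h.sep₁₂, h.sep₀₂⟩

theorem pos (h : SeparatedSlopes D s₀ s₁ s₂) : 0 < D := by linarith [h.le]

theorem abs_sub_le_two {a b : ℝ} (ha : |a| ≤ 1) (hb : |b| ≤ 1) : |a - b| ≤ 2 :=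
  (abs_sub _ _).trans (by linarith)

theorem abs_ratio_le {a b : ℝ} (hD : 0 < D) (ha : |a| ≤ 2) (hb : 1 / D ≤ |b|) :
    |a / b| ≤ 2 * D := by
  have hb0 : 0 < |b| := lt_of_lt_of_le (by positivity) hb
  have h1 : 1 ≤ D * |b| := by rwa [div_le_iff₀' hD] at hb
  rw [abs_div, div_le_iff₀ hb0]
  nlinarith

theorem ne₀₁ (h : SeparatedSlopes D s₀ s₁ s₂) : s₀ - s₁ ≠ 0 :=
  abs_pos.1 (lt_of_lt_of_le (one_div_pos.2 h.pos) h.sep₀₁)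

theorem ne₀₂ (h : SeparatedSlopes D s₀ s₁ s₂) : s₀ - s₂ ≠ 0 :=
  abs_pos.1 (lt_of_lt_of_le (one_div_pos.2 h.pos) h.sep₀₂)

theorem ne₁₂ (h : SeparatedSlopes D s₀ s₁ s₂) : s₁ - s₂ ≠ 0 :=
  abs_pos.1 (lt_of_lt_of_le (one_div_pos.2 h.pos) h.sep₁₂)

theorem abs_sub_slopeCoord_le (h : SeparatedSlopes D s₀ s₁ s₂) {p : ℤ × ℤ} {X : ℝ} {c : ℝ}
    (hX : |(s₁ - s₂) / (s₁ - s₀) * (p.1 + s₀ * p.2) - X| ≤ c) :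
    |(p.1 : ℝ) + s₀ * p.2 - (s₁ - s₀) / (s₁ - s₂) * X| ≤ 2 * D * c := by
  have h1 := h.ne₁₂
  have h2 : s₁ - s₀ ≠ 0 := by have := h.ne₀₁; contrapose! this; linarith
  have e : (p.1 : ℝ) + s₀ * p.2 - (s₁ - s₀) / (s₁ - s₂) * X =
      (s₁ - s₀) / (s₁ - s₂) * ((s₁ - s₂) / (s₁ - s₀) * (p.1 + s₀ * p.2) - X) := by
    field_simp
  rw [e, abs_mul]
  have := abs_ratio_le h.pos (abs_sub_le_two h.abs₁ h.abs₀) h.sep₁₂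
  have := h.pos
  gcongr

theorem card_image_slopeCoord_le (h : SeparatedSlopes D s₀ s₁ s₂) (S : Finset (ℤ × ℤ)) :
    ((S.image (slopeCoord s₀ s₁ s₂)).card : ℝ) ≤
      D ^ 2 * (S.image (fun p => ⌊(p.1 : ℝ) + s₀ * p.2⌋)).card := by
  have hD := h.pos
  have h1 := card_image_le_of_near S (fun p => ⌊(p.1 : ℝ) + s₀ * p.2⌋) (slopeCoord s₀ s₁ s₂)
    (fun z => (s₁ - s₂) / (s₁ - s₀) * z) (c := 2 * D + 1) (by linarith) (by
      intro p _
      have h2 := abs_sub_floor_le ((s₁ - s₂) / (s₁ - s₀) * (p.1 + s₀ * p.2))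
      have h3 := abs_sub_floor_le ((p.1 : ℝ) + s₀ * p.2)
      have h4 := abs_ratio_le hD (abs_sub_le_two h.abs₁ h.abs₂) h.swap.sep₀₁
      have h5 : |(s₁ - s₂) / (s₁ - s₀) * (((p.1 : ℝ) + s₀ * p.2) - ⌊(p.1 : ℝ) + s₀ * p.2⌋)| ≤
          2 * D * 1 := by
        rw [abs_mul]; gcongr
      have e : (slopeCoord s₀ s₁ s₂ p : ℝ) - (s₁ - s₂) / (s₁ - s₀) * ⌊(p.1 : ℝ) + s₀ * p.2⌋ =
        (s₁ - s₂) / (s₁ - s₀) * (((p.1 : ℝ) + s₀ * p.2) - ⌊(p.1 : ℝ) + s₀ * p.2⌋) -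
        ((s₁ - s₂) / (s₁ - s₀) * (p.1 + s₀ * p.2) - slopeCoord s₀ s₁ s₂ p) := by ring
      rw [e]
      have h6 : |(s₁ - s₂) / (s₁ - s₀) * (p.1 + s₀ * p.2) - slopeCoord s₀ s₁ s₂ p| ≤ 1 := h2
      exact (abs_sub _ _).trans (by linarith))
  refine h1.trans ?_
  gcongr
  nlinarith [h.le]

theorem slopeCoord_add_near (h : SeparatedSlopes D s₀ s₁ s₂) (p : ℤ × ℤ) :
    |(slopeCoord s₀ s₁ s₂ p : ℝ) + slopeCoord s₁ s₀ s₂ p - ⌊(p.1 : ℝ) + s₂ * p.2⌋| ≤ 3 := by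
  have h1 := h.ne₀₁
  have h2 : s₁ - s₀ ≠ 0 := by contrapose! h1; linarith
  have e : (s₁ - s₂) / (s₁ - s₀) * (p.1 + s₀ * p.2) + (s₀ - s₂) / (s₀ - s₁) * (p.1 + s₁ * p.2)
      = (p.1 : ℝ) + s₂ * p.2 := by
    rw [← neg_sub s₁ s₀]
    field_simp
    ring
  have a1 := abs_le.1 (abs_sub_floor_le ((s₁ - s₂) / (s₁ - s₀) * (p.1 + s₀ * p.2)))
  have a2 := abs_le.1 (abs_sub_floor_le ((s₀ - s₂) / (s₀ - s₁) * (p.1 + s₁ * p.2)))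
  have a3 := abs_le.1 (abs_sub_floor_le ((p.1 : ℝ) + s₂ * p.2))
  unfold slopeCoord
  rw [abs_le]
  constructor <;> linarith [a1.1, a1.2, a2.1, a2.2, a3.1, a3.2]

/-- The loss incurred when a point is recovered from two of its projections: each coordinate is
determined up to `5 * D ^ 2`. -/
theorem sq_error_bound_le (h : SeparatedSlopes D s₀ s₁ s₂) :
    (2 * (5 * D ^ 2) + 1) ^ 2 ≤ D ^ 6 := by
  have hD := h.pos
  have h64 := h.le
  calc (2 * (5 * D ^ 2) + 1) ^ 2 ≤ (11 * D ^ 2) ^ 2 := by gcongr; nlinarith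
    _ = 121 * D ^ 4 := by ring
    _ ≤ (64 * 64) * D ^ 4 := by gcongr; norm_num
    _ ≤ (D * D) * D ^ 4 := by gcongr
    _ = D ^ 6 := by ring

theorem card_le_mul_card_image_pair (h : SeparatedSlopes D s₀ s₁ s₂) (S : Finset (ℤ × ℤ)) :
    (S.card : ℝ) ≤ D ^ 6 *
      (S.image (fun p => (slopeCoord s₀ s₁ s₂ p, slopeCoord s₁ s₀ s₂ p))).card := by
  have hD := h.pos
  have h64 := h.le
  have hDD : 64 * D ≤ D ^ 2 := by nlinarith
  set f : ℤ × ℤ → ℤ × ℤ := fun p => (slopeCoord s₀ s₁ s₂ p, slopeCoord s₁ s₀ s₂ p) with hf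
  set u : ℤ × ℤ → ℝ := fun q => (s₁ - s₀) / (s₁ - s₂) * q.1 with hu
  set u' : ℤ × ℤ → ℝ := fun q => (s₀ - s₁) / (s₀ - s₂) * q.2 with hu'
  have h1 : ∀ p : ℤ × ℤ, |(p.1 : ℝ) + s₀ * p.2 - u (f p)| ≤ 2 * D := fun p => by
    have := h.abs_sub_slopeCoord_le (p := p) (X := slopeCoord s₀ s₁ s₂ p) (c := 1)
      (abs_sub_floor_le _)
    rwa [mul_one] at this
  have h2 : ∀ p : ℤ × ℤ, |(p.1 : ℝ) + s₁ * p.2 - u' (f p)| ≤ 2 * D := fun p => by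
    have := h.swap.abs_sub_slopeCoord_le (p := p) (X := slopeCoord s₁ s₀ s₂ p) (c := 1)
      (abs_sub_floor_le _)
    rwa [mul_one] at this
  have key := fun p => abs_sub_le_of_two_projections h.abs₀ h.sep₀₁ hD (h1 p) (h2 p)
  have hc : (0 : ℝ) ≤ 5 * D ^ 2 := by positivity
  have h3 := card_le_mul_card_image S f
    (fun q => u q - s₀ * ((u q - u' q) / (s₀ - s₁))) (fun q => (u q - u' q) / (s₀ - s₁)) hc
    (fun p _ => (key p).1.trans (by nlinarith)) (fun p _ => (key p).2.trans (by nlinarith))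
  refine h3.trans ?_
  gcongr
  exact h.sq_error_bound_le

/-- If `E` is large and has small projections with three separated slopes, then in the coordinates given
by two of them a large part of `E` lies in a product `A × B` with small sumset `A + B`. -/
theorem exists_smallSumset (h : SeparatedSlopes D s₀ s₁ s₂) (E : Finset (ℤ × ℤ)) {K N : ℝ}
    (hN : 0 < N) (hK : 8 * K ≤ D) (hE : N ^ 2 ≤ D ^ 3 * E.card)
    (h₀ : ((E.image (fun p => ⌊(p.1 : ℝ) + s₀ * p.2⌋)).card : ℝ) ≤ K * N)
    (h₁ : ((E.image (fun p => ⌊(p.1 : ℝ) + s₁ * p.2⌋)).card : ℝ) ≤ K * N)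
    (h₂ : ((E.image (fun p => ⌊(p.1 : ℝ) + s₂ * p.2⌋)).card : ℝ) ≤ K * N) :
    ∃ (A B : Finset ℤ) (E' : Finset (ℤ × ℤ)), E' ⊆ E ∧ SmallSumset A B (D ^ 130) N ∧
      N ^ 2 ≤ D ^ 25 * E'.card ∧
      ∀ p ∈ E', slopeCoord s₀ s₁ s₂ p ∈ A ∧ slopeCoord s₁ s₀ s₂ p ∈ B := by
  classical
  have hD := h.pos
  have h64 := h.le
  have hD1 : 1 ≤ D := by linarith
  set X := slopeCoord s₀ s₁ s₂ with hX
  set Y := slopeCoord s₁ s₀ s₂ with hY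
  set Γ := E.image (fun p => (X p, Y p)) with hΓ
  have cX : ((E.image X).card : ℝ) ≤ D ^ 3 * N := by
    calc ((E.image X).card : ℝ) ≤ D ^ 2 * (K * N) := (h.card_image_slopeCoord_le E).trans (by gcongr)
      _ ≤ D ^ 2 * (D * N) := by gcongr; linarith
      _ = _ := by ring
  have cY : ((E.image Y).card : ℝ) ≤ D ^ 3 * N := by
    calc ((E.image Y).card : ℝ) ≤ D ^ 2 * (K * N) :=
          (h.swap.card_image_slopeCoord_le E).trans (by gcongr)
      _ ≤ D ^ 2 * (D * N) := by gcongr; linarith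
      _ = _ := by ring
  have cΓ : N ^ 2 ≤ D ^ 9 * Γ.card := by
    calc N ^ 2 ≤ D ^ 3 * E.card := hE
      _ ≤ D ^ 3 * (D ^ 6 * Γ.card) := by gcongr; exact h.card_le_mul_card_image_pair E
      _ = _ := by ring
  have cS : ((Γ.image (fun q => q.1 + q.2)).card : ℝ) ≤ D * N := by
    have e : Γ.image (fun q => q.1 + q.2) = E.image (fun p => X p + Y p) := by
      rw [hΓ, Finset.image_image]; rfl
    rw [e]
    have := card_image_le_of_near E (fun p => ⌊(p.1 : ℝ) + s₂ * p.2⌋) (fun p => X p + Y p)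
      (fun z => z) (c := 3) (by norm_num) (by
        intro p _
        have := h.slopeCoord_add_near p
        push_cast
        exact this)
    calc _ ≤ (2 * 3 + 1) * _ := this
      _ ≤ (2 * 3 + 1) * (K * N) := by gcongr
      _ = (7 * K) * N := by ring
      _ ≤ D * N := by
          gcongr
          have : 0 ≤ K * N := (Nat.cast_nonneg _).trans h₂
          have : 0 ≤ K := nonneg_of_mul_nonneg_left this hN
          linarith
  have hΓs : Γ ⊆ E.image X ×ˢ E.image Y := by
    intro q hq
    obtain ⟨p, hp, rfl⟩ := Finset.mem_image.1 hq
    exact Finset.mem_product.2 ⟨Finset.mem_image_of_mem _ hp, Finset.mem_image_of_mem _ hp⟩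
  have hm : (0 : ℝ) < D ^ 3 * N := by positivity
  -- The two coordinates take at most `D ^ 3 * N` values each. The graph `Γ` of pairs of coordinates
  -- has at least `N ^ 2 / D ^ 9 = (D ^ 3 * N) ^ 2 / D ^ 15` edges, hence the parameter `D ^ 15`.
  obtain ⟨A, hA, B, hB, hAB, hsum⟩ := exists_small_sumset (E.image X) (E.image Y) Γ hΓs
    (K := D ^ 15) (m := D ^ 3 * N) (one_le_pow₀ hD1) hm cX cY
    (by
      calc (D ^ 3 * N) ^ 2 = D ^ 6 * N ^ 2 := by ring
        _ ≤ D ^ 6 * (D ^ 9 * Γ.card) := by gcongr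
        _ = _ := by ring)
    (by
      refine cS.trans ?_
      calc D * N ≤ D ^ 18 * N := by gcongr; exact le_self_pow₀ hD1 (by norm_num)
        _ = _ := by ring)
  set E' := E.filter (fun p => X p ∈ A ∧ Y p ∈ B) with hE'
  set Γ' := (A ×ˢ B).filter (· ∈ Γ) with hΓ'
  have c1 : N ^ 2 ≤ D ^ 25 * Γ'.card := by
    have h5 : (D ^ 3 * N) ^ 2 ≤ 24 * (D ^ 15) ^ 2 * Γ'.card := by
      rw [div_le_iff₀ (by positivity)] at hAB
      linarith
    have h6 : D ^ 6 * N ^ 2 ≤ D ^ 6 * (D ^ 25 * Γ'.card) := by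
      calc D ^ 6 * N ^ 2 = (D ^ 3 * N) ^ 2 := by ring
        _ ≤ 24 * (D ^ 15) ^ 2 * Γ'.card := h5
        _ ≤ D * (D ^ 15) ^ 2 * Γ'.card := by gcongr; linarith
        _ = D ^ 6 * (D ^ 25 * Γ'.card) := by ring
    exact le_of_mul_le_mul_left h6 (by positivity)
  have hAm : (A.card : ℝ) ≤ D ^ 3 * N := le_trans (by exact_mod_cast Finset.card_le_card hA) cX
  have hBm : (B.card : ℝ) ≤ D ^ 3 * N := le_trans (by exact_mod_cast Finset.card_le_card hB) cY
  have c2 : (Γ'.card : ℝ) ≤ A.card * B.card := by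
    rw [← Nat.cast_mul, ← Finset.card_product]
    exact_mod_cast Finset.card_filter_le _ _
  refine ⟨A, B, E', Finset.filter_subset _ _, ⟨hN, ?_, ?_, ?_⟩, ?_,
    fun p hp => (Finset.mem_filter.1 hp).2⟩
  · have : N * N ≤ (D ^ 28 * A.card) * N := by
      calc N * N = N ^ 2 := by ring
        _ ≤ D ^ 25 * (A.card * B.card) := c1.trans (by gcongr)
        _ ≤ D ^ 25 * (A.card * (D ^ 3 * N)) := by gcongr
        _ = _ := by ring
    refine (le_of_mul_le_mul_right this hN).trans ?_
    gcongr
    norm_num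
  · have : N * N ≤ (D ^ 28 * B.card) * N := by
      calc N * N = N ^ 2 := by ring
        _ ≤ D ^ 25 * (A.card * B.card) := c1.trans (by gcongr)
        _ ≤ D ^ 25 * ((D ^ 3 * N) * B.card) := by gcongr
        _ = _ := by ring
    refine (le_of_mul_le_mul_right this hN).trans ?_
    gcongr
    norm_num
  · calc ((A + B).card : ℝ) ≤ 12288 * (D ^ 15) ^ 8 * (D ^ 3 * N) := hsum
      _ ≤ (64 * 64 * 64) * (D ^ 15) ^ 8 * (D ^ 3 * N) := by gcongr; norm_num
      _ ≤ (D * D * D) * (D ^ 15) ^ 8 * (D ^ 3 * N) := by gcongr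
      _ = D ^ 126 * N := by ring
      _ ≤ D ^ 130 * N := by
          gcongr
          norm_num
  · refine c1.trans ?_
    have : Γ'.card ≤ E'.card := by
      refine le_trans (Finset.card_le_card (t := E'.image (fun p => (X p, Y p))) ?_)
        Finset.card_image_le
      intro q hq
      obtain ⟨h7, h8⟩ := Finset.mem_filter.1 hq
      obtain ⟨p, hp, rfl⟩ := Finset.mem_image.1 h8
      obtain ⟨h9, h10⟩ := Finset.mem_product.1 h7
      exact Finset.mem_image_of_mem (fun p => (X p, Y p)) (Finset.mem_filter.2 ⟨hp, h9, h10⟩)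
    gcongr

end SeparatedSlopes
/-! ### Multipliers from slopes, and non-concentration -/


/-- The cross ratio of the slopes `s₀, s₁, s₂, s`. On a line `x + s y = const` the coordinates
`X = slopeCoord s₀ s₁ s₂` and `Y = slopeCoord s₁ s₀ s₂` satisfy `slopeRatio s₀ s₁ s₂ s * Y + X ≈ const`. -/
noncomputable def slopeRatio (s₀ s₁ s₂ s : ℝ) : ℝ :=
  (s - s₀) / (s₂ - s₀) * ((s₁ - s₂) / (s₁ - s))

namespace SeparatedSlopes

variable {D s₀ s₁ s₂ : ℝ}

/-- The cross ratio does not contract distances by much, so separated slopes give separated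
multipliers. -/
theorem abs_sub_le_mul_slopeRatio (h : SeparatedSlopes D s₀ s₁ s₂) {s s' : ℝ} (hs : |s| ≤ 1)
    (hs' : |s'| ≤ 1) (hs₁ : 1 / D ≤ |s₁ - s|) (hs₁' : 1 / D ≤ |s₁ - s'|) :
    |s - s'| ≤ 8 * D ^ 2 * |slopeRatio s₀ s₁ s₂ s - slopeRatio s₀ s₁ s₂ s'| := by
  have hD := h.pos
  have p1 : 0 < |s₁ - s| := lt_of_lt_of_le (one_div_pos.2 hD) hs₁
  have p2 : 0 < |s₁ - s'| := lt_of_lt_of_le (one_div_pos.2 hD) hs₁'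
  have n1 : s₁ - s ≠ 0 := abs_pos.1 p1
  have n2 : s₁ - s' ≠ 0 := abs_pos.1 p2
  have n3 := h.ne₁₂
  have n4 : s₁ - s₀ ≠ 0 := by have := h.ne₀₁; contrapose! this; linarith
  have n5 : s₂ - s₀ ≠ 0 := by have := h.ne₀₂; contrapose! this; linarith
  have e : s - s' = ((s₂ - s₀) / (s₁ - s₂)) * ((s₁ - s) / (s₁ - s₀)) * (s₁ - s') *
      (slopeRatio s₀ s₁ s₂ s - slopeRatio s₀ s₁ s₂ s') := by
    unfold slopeRatio
    field_simp
    ring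
  calc |s - s'| = |(s₂ - s₀) / (s₁ - s₂)| * |(s₁ - s) / (s₁ - s₀)| * |s₁ - s'| *
      |slopeRatio s₀ s₁ s₂ s - slopeRatio s₀ s₁ s₂ s'| := by
        conv_lhs => rw [e]
        rw [abs_mul, abs_mul, abs_mul]
    _ ≤ (2 * D) * (2 * D) * 2 * |slopeRatio s₀ s₁ s₂ s - slopeRatio s₀ s₁ s₂ s'| := by
        gcongr
        · exact abs_ratio_le hD (abs_sub_le_two h.abs₂ h.abs₀) h.sep₁₂
        · exact abs_ratio_le hD (abs_sub_le_two h.abs₁ hs) h.swap.sep₀₁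
        · exact abs_sub_le_two h.abs₁ hs'
    _ = _ := by ring

/-- A slope `s` away from `s₁`, whose set `G` contains a large part of `E` and has a small projection,
gives a multiplier of `A - A`: the richest fibre of the projection of `E ∩ G` is the graph of a nearly
affine function between the two coordinates, with slope given by the cross ratio. -/
theorem isMultiplier (h : SeparatedSlopes D s₀ s₁ s₂) {A B : Finset ℤ} {E G : Finset (ℤ × ℤ)}
    {K N s : ℝ} (hS : SmallSumset A B (D ^ 130) N) (hE : N ^ 2 ≤ D ^ 25 * E.card)
    (hEAB : ∀ p ∈ E, slopeCoord s₀ s₁ s₂ p ∈ A ∧ slopeCoord s₁ s₀ s₂ p ∈ B)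
    (hK : 1 ≤ K) (hKD : 8 * K ^ 3 ≤ D)
    (hs : |s| ≤ 1) (hs₁ : 1 / D ≤ |s₁ - s|) (hG : (E.card : ℝ) ≤ 8 * K ^ 2 * (E ∩ G).card)
    (hGp : ((G.image (fun p => ⌊(p.1 : ℝ) + s * p.2⌋)).card : ℝ) ≤ K * N) :
    IsMultiplier (A - A) ((D ^ 130) ^ 15) (slopeRatio s₀ s₁ s₂ s) := by
  classical
  have hD := h.pos
  have h64 := h.le
  have hD1 : 1 ≤ D := by linarith
  have hN := hS.pos
  have hK0 : 0 < K := by linarith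
  have p1 : 0 < |s₁ - s| := lt_of_lt_of_le (one_div_pos.2 hD) hs₁
  have n1 : s₁ - s ≠ 0 := abs_pos.1 p1
  have n3 := h.ne₁₂
  have n4 : s₁ - s₀ ≠ 0 := by have := h.ne₀₁; contrapose! this; linarith
  have n4' := h.ne₀₁
  have n5 : s₂ - s₀ ≠ 0 := by have := h.ne₀₂; contrapose! this; linarith
  set q : ℤ × ℤ → ℤ := fun p => ⌊(p.1 : ℝ) + s * p.2⌋ with hq
  set Y := slopeCoord s₁ s₀ s₂ with hY
  have hEpos : (0 : ℝ) < E.card := by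
    have : 0 < D ^ 25 * (E.card : ℝ) := lt_of_lt_of_le (by positivity) hE
    exact pos_of_mul_pos_right this (by positivity)
  have hEG : (E ∩ G).Nonempty := by
    rw [Finset.nonempty_iff_ne_empty]
    intro h0
    rw [h0] at hG
    simp at hG
    rw [hG] at hEpos
    simp at hEpos
  obtain ⟨z, hz, hcard⟩ := exists_card_fiber_ge (E ∩ G) ((E ∩ G).image q) q
    (fun p hp => Finset.mem_image_of_mem _ hp) (hEG.image _)
  set S := (E ∩ G).filter (fun p => q p = z) with hSdef
  have hSE : ∀ p ∈ S, p ∈ E ∧ q p = z := fun p hp => by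
    obtain ⟨h1, h2⟩ := Finset.mem_filter.1 hp
    exact ⟨(Finset.mem_inter.1 h1).1, h2⟩
  have hqz : ∀ p ∈ S, |(p.1 : ℝ) + s * p.2 - z| ≤ 1 := fun p hp => by
    have := abs_sub_floor_le ((p.1 : ℝ) + s * p.2)
    rwa [show ⌊(p.1 : ℝ) + s * p.2⌋ = z from (hSE p hp).2] at this
  have h2 : ∀ p : ℤ × ℤ, |(p.1 : ℝ) + s₁ * p.2 - (s₀ - s₁) / (s₀ - s₂) * (Y p : ℝ)| ≤ 2 * D :=
    fun p => by
      have := h.swap.abs_sub_slopeCoord_le (p := p) (X := slopeCoord s₁ s₀ s₂ p) (c := 1)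
        (abs_sub_floor_le _)
      rwa [mul_one] at this
  have key := fun p (hp : p ∈ S) => abs_sub_le_of_two_projections hs
    (by rwa [abs_sub_comm] at hs₁) hD ((hqz p hp).trans (by linarith : (1 : ℝ) ≤ 2 * D)) (h2 p)
  have hc : (0 : ℝ) ≤ 5 * D ^ 2 := by positivity
  have h3 := card_le_mul_card_image S Y
    (fun y => (z : ℝ) - s * ((z - (s₀ - s₁) / (s₀ - s₂) * (y : ℝ)) / (s - s₁)))
    (fun y => ((z : ℝ) - (s₀ - s₁) / (s₀ - s₂) * (y : ℝ)) / (s - s₁)) hc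
    (fun p hp => (key p hp).1.trans (by nlinarith)) (fun p hp => (key p hp).2.trans (by nlinarith))
  have h3' : (S.card : ℝ) ≤ D ^ 6 * (S.image Y).card :=
    h3.trans (by gcongr; exact h.sq_error_bound_le)
  have himg : (((E ∩ G).image q).card : ℝ) ≤ K * N := by
    refine le_trans ?_ hGp
    exact_mod_cast Finset.card_le_card (Finset.image_subset_image Finset.inter_subset_right)
  have hcount : N ≤ D ^ 130 * (S.image Y).card := by
    have : N * N ≤ (D ^ 32 * (S.image Y).card) * N := by
      calc N * N = N ^ 2 := by ring
        _ ≤ D ^ 25 * E.card := hE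
        _ ≤ D ^ 25 * (8 * K ^ 2 * (E ∩ G).card) := by gcongr
        _ ≤ D ^ 25 * (8 * K ^ 2 * ((K * N) * (D ^ 6 * (S.image Y).card))) := by
            gcongr
            exact hcard.trans (by gcongr)
        _ = (8 * K ^ 3) * (D ^ 31 * (S.image Y).card * N) := by ring
        _ ≤ D * (D ^ 31 * (S.image Y).card * N) := by gcongr
        _ = _ := by ring
    refine (le_of_mul_le_mul_right this hN).trans ?_
    gcongr
    norm_num
  have hex : ∀ y ∈ S.image Y, ∃ p ∈ S, Y p = y := fun y hy => Finset.mem_image.1 hy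
  choose! g hgS hgY using hex
  have r1 : |(s - s₀) / (s₂ - s₀)| ≤ 2 * D :=
    abs_ratio_le hD (abs_sub_le_two hs h.abs₀) (by rw [abs_sub_comm]; exact h.sep₀₂)
  have r2 : |(s₁ - s₂) / (s₁ - s)| ≤ 2 * D := abs_ratio_le hD (abs_sub_le_two h.abs₁ h.abs₂) hs₁
  have r3 : |slopeRatio s₀ s₁ s₂ s| ≤ 4 * D ^ 2 := by
    unfold slopeRatio
    rw [abs_mul]
    calc _ ≤ (2 * D) * (2 * D) := by gcongr
      _ = _ := by ring
  have hQ3 : 4 * D ^ 2 + 1 + 2 * D ≤ D ^ 130 := by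
    calc 4 * D ^ 2 + 1 + 2 * D ≤ 64 * D ^ 2 := by nlinarith
      _ ≤ D * D ^ 2 := by gcongr
      _ = D ^ 3 := by ring
      _ ≤ D ^ 130 := pow_le_pow_right₀ hD1 (by norm_num)
  refine hS.isMultiplier (by nlinarith) (z := (s₁ - s₂) / (s₁ - s) * z) (r3.trans (by linarith))
    (S.image Y) ?_ hcount (fun y => slopeCoord s₀ s₁ s₂ (g y))
    (fun y hy => (hEAB _ (hSE _ (hgS y hy)).1).1) ?_
  · intro y hy
    obtain ⟨p, hp, rfl⟩ := Finset.mem_image.1 hy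
    exact (hEAB p (hSE p hp).1).2
  · intro y hy
    have hg1 := hqz _ (hgS y hy)
    have hg2 := hgY y hy
    set p := g y with hp
    rw [← hg2]
    have a1 := abs_sub_floor_le ((s₁ - s₂) / (s₁ - s₀) * ((p.1 : ℝ) + s₀ * p.2))
    have a2 := abs_sub_floor_le ((s₀ - s₂) / (s₀ - s₁) * ((p.1 : ℝ) + s₁ * p.2))
    have e : slopeRatio s₀ s₁ s₂ s * (Y p : ℝ) + (slopeCoord s₀ s₁ s₂ p : ℝ) -
        (s₁ - s₂) / (s₁ - s) * z =
      (s₁ - s₂) / (s₁ - s) * ((p.1 : ℝ) + s * p.2 - z) -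
      slopeRatio s₀ s₁ s₂ s * ((s₀ - s₂) / (s₀ - s₁) * ((p.1 : ℝ) + s₁ * p.2) - Y p) -
      ((s₁ - s₂) / (s₁ - s₀) * ((p.1 : ℝ) + s₀ * p.2) - slopeCoord s₀ s₁ s₂ p) := by
      have : (s₁ - s₂) / (s₁ - s) * ((p.1 : ℝ) + s * p.2) =
        slopeRatio s₀ s₁ s₂ s * ((s₀ - s₂) / (s₀ - s₁) * ((p.1 : ℝ) + s₁ * p.2)) +
        (s₁ - s₂) / (s₁ - s₀) * ((p.1 : ℝ) + s₀ * p.2) := by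
        unfold slopeRatio
        rw [← neg_sub s₁ s₀, ← neg_sub s₂ s₀]
        field_simp
        ring
      linear_combination -this
    rw [e]
    calc _ ≤ |(s₁ - s₂) / (s₁ - s) * ((p.1 : ℝ) + s * p.2 - z)| +
          |slopeRatio s₀ s₁ s₂ s * ((s₀ - s₂) / (s₀ - s₁) * ((p.1 : ℝ) + s₁ * p.2) - Y p)| +
          |(s₁ - s₂) / (s₁ - s₀) * ((p.1 : ℝ) + s₀ * p.2) - slopeCoord s₀ s₁ s₂ p| :=
          (abs_sub _ _).trans (by gcongr; exact abs_sub _ _)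
      _ ≤ (2 * D) * 1 + (4 * D ^ 2) * 1 + 1 := by
          rw [abs_mul, abs_mul]
          gcongr
          · exact a2
          · exact a1
      _ ≤ D ^ 130 := by linarith

/-- Points whose two coordinates lie in the same cells of length `ℓ` are close to each other. -/
theorem abs_le_of_slopeCoord_near (h : SeparatedSlopes D s₀ s₁ s₂) {ℓ : ℝ} (hℓ : 1 ≤ ℓ)
    {p p' : ℤ × ℤ}
    (hX : ⌊(slopeCoord s₀ s₁ s₂ p : ℝ) / ℓ⌋ = ⌊(slopeCoord s₀ s₁ s₂ p' : ℝ) / ℓ⌋)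
    (hY : ⌊(slopeCoord s₁ s₀ s₂ p : ℝ) / ℓ⌋ = ⌊(slopeCoord s₁ s₀ s₂ p' : ℝ) / ℓ⌋) :
    |(p'.1 : ℝ) - p.1| ≤ 12 * D ^ 2 * ℓ ∧ |(p'.2 : ℝ) - p.2| ≤ 12 * D ^ 2 * ℓ := by
  have hD := h.pos
  have h64 := h.le
  have hℓ0 : 0 < ℓ := by linarith
  have near : ∀ a b : ℝ, ⌊(⌊a⌋ : ℝ) / ℓ⌋ = ⌊(⌊b⌋ : ℝ) / ℓ⌋ → |b - a| ≤ 2 * ℓ := by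
    intro a b hab
    have h1 := Int.floor_le a
    have h2 := Int.lt_floor_add_one a
    have h3 := Int.floor_le b
    have h4 := Int.lt_floor_add_one b
    have h5 := abs_lt.1 (Int.abs_sub_lt_one_of_floor_eq_floor hab)
    have h6 : (⌊a⌋ : ℝ) / ℓ - ⌊b⌋ / ℓ = (⌊a⌋ - ⌊b⌋) / ℓ := by ring
    rw [h6, lt_div_iff₀ hℓ0, div_lt_iff₀ hℓ0] at h5
    rw [abs_le]
    constructor <;> linarith [h5.1, h5.2]
  have n3 := h.ne₁₂
  have n4 : s₁ - s₀ ≠ 0 := by have := h.ne₀₁; contrapose! this; linarith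
  have n4' := h.ne₀₁
  have n5' := h.ne₀₂
  have h1 := h.abs_sub_slopeCoord_le (near _ _ hX)
  have h2 := h.swap.abs_sub_slopeCoord_le (near _ _ hY)
  have e1 : (s₁ - s₀) / (s₁ - s₂) * ((s₁ - s₂) / (s₁ - s₀) * ((p.1 : ℝ) + s₀ * p.2)) =
    (p.1 : ℝ) + s₀ * p.2 := by field_simp
  have e2 : (s₀ - s₁) / (s₀ - s₂) * ((s₀ - s₂) / (s₀ - s₁) * ((p.1 : ℝ) + s₁ * p.2)) =
    (p.1 : ℝ) + s₁ * p.2 := by field_simp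
  rw [e1] at h1
  rw [e2] at h2
  obtain ⟨h3, h4⟩ := abs_sub_le_of_two_projections h.abs₀ h.sep₀₁ hD h1 h2
  have e3 : ((p.1 : ℝ) + s₀ * p.2 - ((p.1 : ℝ) + s₁ * p.2)) / (s₀ - s₁) = p.2 := by
    field_simp; ring
  rw [e3] at h3 h4
  have e4 : (p.1 : ℝ) + s₀ * p.2 - s₀ * p.2 = p.1 := by ring
  rw [e4] at h3
  have hb : 4 * D ≤ D ^ 2 := by nlinarith
  have hb' : 4 * D * ℓ ≤ D ^ 2 * ℓ := by gcongr
  have hb0 : 0 ≤ D ^ 2 * ℓ := by positivity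
  exact ⟨h3.trans (by nlinarith), h4.trans (by nlinarith)⟩

/-- If `A - A` were concentrated on an interval of length `2 R ^ (1 - c₁)`, then `A` and `B` would lie in
few intervals of that length, so that many points of `E` would lie in a small square, contrary to
the non-concentration of `P`. -/
theorem isSmallSpread (h : SeparatedSlopes D s₀ s₁ s₂) {A B : Finset ℤ} {E P : Finset (ℤ × ℤ)}
    {K N R α β c₁ : ℝ} (hS : SmallSumset A B (D ^ 130) N) (hE : N ^ 2 ≤ D ^ 25 * E.card)
    (hEAB : ∀ p ∈ E, slopeCoord s₀ s₁ s₂ p ∈ A ∧ slopeCoord s₁ s₀ s₂ p ∈ B)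
    (hEP : E ⊆ P) (hN : N ^ 2 = P.card) (hR : 1 ≤ R) (hK : 1 ≤ K) (hKD : K ≤ D)
    (hβ1 : β ≤ 1) (hc₁ : 0 < c₁) (hc₁' : 4 * c₁ ≤ 1 - α / 2) (hc₁1 : c₁ ≤ 1)
    (hDR : (D ^ 130) ^ 34 ≤ R ^ (c₁ * β / 2)) (hP : (P.card : ℝ) ≤ K * R ^ α)
    (hPr : ∀ p ∈ P, ∀ r : ℝ, 1 / R ≤ r → ((P.filter (fun p' : ℤ × ℤ =>
      |(p'.1 : ℝ) - p.1| ≤ r * R ∧ |(p'.2 : ℝ) - p.2| ≤ r * R)).card : ℝ) ≤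
      K * r ^ β * P.card) :
    IsSmallSpread (c₁ * β / 4) c₁ R (A - A) := by
  classical
  have hD := h.pos
  have h64 := h.le
  have hD1 : 1 ≤ D := by linarith
  have hR0 : 0 < R := by linarith
  have hN0 := hS.pos
  set Q := D ^ 130 with hQ
  have hQD : D ≤ Q := le_self_pow₀ hD1 (by norm_num)
  have hQ1 : 1 ≤ Q := by linarith
  have hQ0 : 0 < Q := by linarith
  refine ⟨?_, ?_⟩
  · have h1 := hS.card_sub_le hQ1
    have h2 : N ≤ Q * R ^ (α / 2) := by
      refine le_of_sq_le_sq ?_ (by positivity)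
      calc N ^ 2 ≤ K * R ^ α := by rw [hN]; exact hP
        _ ≤ Q ^ 2 * R ^ α := by gcongr; nlinarith
        _ = (Q * R ^ (α / 2)) ^ 2 := by
            rw [mul_pow, ← Real.rpow_natCast (R ^ (α / 2)) 2, ← Real.rpow_mul hR0.le]
            congr 2
            push_cast; ring
    calc _ ≤ Q ^ 7 * N := h1
      _ ≤ Q ^ 7 * (Q * R ^ (α / 2)) := by gcongr
      _ = Q ^ 8 * R ^ (α / 2) := by ring
      _ ≤ Q ^ 34 * R ^ (α / 2) := by gcongr; norm_num
      _ ≤ R ^ (c₁ * β / 2) * R ^ (α / 2) := by gcongr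
      _ = R ^ (c₁ * β / 2 + α / 2) := (Real.rpow_add hR0 _ _).symm
      _ ≤ R ^ (1 - 2 * c₁) := Real.rpow_le_rpow_of_exponent_le hR (by nlinarith)
  · intro x
    by_contra! hcon
    set ℓ := R ^ (1 - c₁) with hℓ
    have hℓ1 : 1 ≤ ℓ := Real.one_le_rpow hR (by linarith)
    obtain ⟨hA, hB⟩ := hS.card_cells_le (x := x) (ℓ := ℓ) (θ := R ^ (-(c₁ * β / 4)))
      (by linarith) (by linarith) (by positivity) hcon
    have hdiv : Q ^ 16 / R ^ (-(c₁ * β / 4)) = Q ^ 16 * R ^ (c₁ * β / 4) := by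
      rw [Real.rpow_neg hR0.le, div_inv_eq_mul]
    rw [hdiv] at hA hB
    set q : ℤ → ℤ := fun a : ℤ => ⌊(a : ℝ) / ℓ⌋ with hq
    obtain ⟨c, hc, hfib⟩ := exists_card_fiber_ge E ((A.image q) ×ˢ (B.image q))
      (fun p => (q (slopeCoord s₀ s₁ s₂ p), q (slopeCoord s₁ s₀ s₂ p)))
      (fun p hp => Finset.mem_product.2 ⟨Finset.mem_image_of_mem _ (hEAB p hp).1,
        Finset.mem_image_of_mem _ (hEAB p hp).2⟩)
      ((hS.left_nonempty.image _).product (hS.right_nonempty.image _))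
    set S := E.filter
      (fun p => (q (slopeCoord s₀ s₁ s₂ p), q (slopeCoord s₁ s₀ s₂ p)) = c) with hSd
    have hEpos : (0 : ℝ) < E.card := by
      have : 0 < D ^ 25 * (E.card : ℝ) := lt_of_lt_of_le (by positivity) hE
      exact pos_of_mul_pos_right this (by positivity)
    have hSne : S.Nonempty := by
      rw [Finset.nonempty_iff_ne_empty]
      intro h0
      rw [h0] at hfib
      simp only [Finset.card_empty, Nat.cast_zero, mul_zero] at hfib
      linarith
    obtain ⟨p, hp⟩ := hSne
    obtain ⟨hpE, hpc⟩ := Finset.mem_filter.1 hp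
    set r := 12 * D ^ 2 * R ^ (-c₁) with hr
    have hrR : r * R = 12 * D ^ 2 * ℓ := by
      rw [hr, hℓ, sub_eq_neg_add, Real.rpow_add hR0, Real.rpow_one]; ring
    have hr1 : 1 / R ≤ r := by
      calc 1 / R = 1 * R ^ (-1 : ℝ) := by rw [Real.rpow_neg_one]; ring
        _ ≤ 12 * D ^ 2 * R ^ (-c₁) := by
            gcongr
            · nlinarith
    have hSP : (S.card : ℝ) ≤ K * r ^ β * P.card := by
      refine le_trans ?_ (hPr p (hEP hpE) r hr1)
      refine Nat.cast_le.2 (Finset.card_le_card fun p' hp' => ?_)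
      obtain ⟨hpE', hpc'⟩ := Finset.mem_filter.1 hp'
      rw [← hpc, Prod.mk.injEq] at hpc'
      refine Finset.mem_filter.2 ⟨hEP hpE', ?_⟩
      rw [hrR]
      exact h.abs_le_of_slopeCoord_near hℓ1 hpc'.1.symm hpc'.2.symm
    have hrβ : r ^ β ≤ D ^ 3 * R ^ (-(c₁ * β)) := by
      rw [hr, Real.mul_rpow (by positivity) (by positivity), ← Real.rpow_mul hR0.le, neg_mul]
      gcongr
      calc (12 * D ^ 2) ^ β ≤ (12 * D ^ 2) ^ (1 : ℝ) :=
            Real.rpow_le_rpow_of_exponent_le (by nlinarith) hβ1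
        _ = 12 * D ^ 2 := Real.rpow_one _
        _ ≤ 64 * D ^ 2 := by gcongr; norm_num
        _ ≤ D * D ^ 2 := by gcongr
        _ = D ^ 3 := by ring
    have hprod : (((A.image q) ×ˢ (B.image q)).card : ℝ) ≤ (Q ^ 16 * R ^ (c₁ * β / 4)) ^ 2 := by
      rw [Finset.card_product, Nat.cast_mul, sq]
      gcongr
    have hmain : N ^ 2 * 1 ≤ N ^ 2 * (Q ^ 33 * R ^ (-(c₁ * β / 2))) := by
      calc N ^ 2 * 1 ≤ D ^ 25 * E.card := by rw [mul_one]; exact hE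
        _ ≤ D ^ 25 * ((Q ^ 16 * R ^ (c₁ * β / 4)) ^ 2 * S.card) := by
            gcongr
            exact hfib.trans (by gcongr)
        _ ≤ D ^ 25 * ((Q ^ 16 * R ^ (c₁ * β / 4)) ^ 2 *
              (D * (D ^ 3 * R ^ (-(c₁ * β))) * N ^ 2)) := by
            gcongr
            refine hSP.trans ?_
            rw [hN]
            gcongr
        _ = N ^ 2 * (Q ^ 32 * D ^ 29 * ((R ^ (c₁ * β / 4)) ^ 2 * R ^ (-(c₁ * β)))) := by ring
        _ = N ^ 2 * (Q ^ 32 * D ^ 29 * R ^ (-(c₁ * β / 2))) := by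
            rw [← Real.rpow_natCast (R ^ (c₁ * β / 4)) 2, ← Real.rpow_mul hR0.le,
              ← Real.rpow_add hR0]
            congr 3
            push_cast; ring
        _ ≤ N ^ 2 * (Q ^ 32 * Q * R ^ (-(c₁ * β / 2))) := by
            gcongr
            rw [hQ]
            exact pow_le_pow_right₀ hD1 (by norm_num)
        _ = _ := by ring
    have h5 := le_of_mul_le_mul_left hmain (by positivity)
    rw [Real.rpow_neg hR0.le, ← div_eq_mul_inv, one_le_div (by positivity)] at h5
    have h6 : Q ^ 34 ≤ Q ^ 33 := hDR.trans h5
    have h7 : Q ^ 34 = Q * Q ^ 33 := by ring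
    have h8 : 0 < Q ^ 33 := by positivity
    have h9 : 64 * Q ^ 33 ≤ Q * Q ^ 33 := by gcongr; linarith
    linarith

end SeparatedSlopes
/-! ### The discrete projection theorem -/


/-- A set `J'` of indices of weight `ω` has many values `t i` that are `r`-separated, if the slopes `s i`
satisfy a Frostman condition and `t` is inverse Lipschitz as a function of `s`: the balls of radius
`C r` around the slopes of a maximal separated set cover `J'`. -/
theorem hasSeparated_of_weights {ι : Type*} (J J' : Finset ι) (hJ : J' ⊆ J) (w s t : ι → ℝ)
    {K R κ C r ω : ℝ} (hw : ∀ i ∈ J, 0 ≤ w i)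
    (hfrost : ∀ x r : ℝ, 1 / R ≤ r → ∑ i ∈ J with |s i - x| ≤ r, w i ≤ K * r ^ κ)
    (hst : ∀ i ∈ J', ∀ j ∈ J', |s i - s j| ≤ C * |t i - t j|) (hC : 1 ≤ C) (hr0 : 0 < r)
    (hr : 1 / R ≤ r) (hJ' : ω ≤ ∑ i ∈ J', w i) (hK : 0 < K) :
    HasSeparated (J'.image t) r (ω / (K * (C * r) ^ κ)) := by
  classical
  obtain ⟨B, hB, h1, h2⟩ := exists_maximal_separated J' (fun i j => |t i - t j|)
    (fun i j => abs_sub_comm _ _) r (fun i => by simpa using hr0)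
  have hCr : 0 < (C * r) ^ κ := Real.rpow_pos_of_pos (by positivity) _
  have hinj : Set.InjOn t B := by
    intro x hx y hy hxy
    by_contra hne
    have := h1 x hx y hy hne
    rw [hxy, sub_self, abs_zero] at this
    linarith
  refine ⟨B.image t, Finset.image_subset_image hB, ?_, ?_⟩
  · rw [Finset.card_image_of_injOn hinj, div_le_iff₀ (by positivity)]
    calc ω ≤ ∑ i ∈ J', w i := hJ'
      _ ≤ ∑ i ∈ J', ∑ b ∈ B, (if |s i - s b| ≤ C * r then w i else 0) := by
          refine Finset.sum_le_sum fun i hi => ?_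
          obtain ⟨b, hb, hib⟩ := h2 i hi
          have h3 : |s i - s b| ≤ C * r := (hst i hi b (hB hb)).trans (by gcongr)
          have h4 := Finset.single_le_sum (s := B)
            (f := fun b => if |s i - s b| ≤ C * r then w i else 0)
            (fun b _ => ite_nonneg (hw i (hJ hi)) le_rfl) hb
          simpa only [h3, if_true] using h4
      _ ≤ ∑ i ∈ J, ∑ b ∈ B, (if |s i - s b| ≤ C * r then w i else 0) :=
          Finset.sum_le_sum_of_subset_of_nonneg hJ fun i hi _ =>
            Finset.sum_nonneg fun b _ => ite_nonneg (hw i hi) le_rfl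
      _ = ∑ b ∈ B, ∑ i ∈ J with |s i - s b| ≤ C * r, w i := by
          rw [Finset.sum_comm]; simp_rw [Finset.sum_filter]
      _ ≤ ∑ b ∈ B, K * (C * r) ^ κ := by
          refine Finset.sum_le_sum fun b _ => hfrost _ _ (hr.trans ?_)
          nlinarith
      _ = _ := by rw [Finset.sum_const, nsmul_eq_mul]
  · intro x hx y hy hxy
    obtain ⟨i, hi, rfl⟩ := Finset.mem_image.1 hx
    obtain ⟨j, hj, rfl⟩ := Finset.mem_image.1 hy
    exact h1 i hi j hj (fun h => hxy (by rw [h]))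

/-- If all points of `E` are popular, then a large part of `E` lies in the sets `G i` of three indices with
separated slopes. The slopes are chosen one after the other. -/
theorem exists_separated_slopes {ι : Type*} (J : Finset ι) (w s : ι → ℝ)
    (G : ι → Finset (ℤ × ℤ)) (E : Finset (ℤ × ℤ)) {ω D : ℝ} (hω : 0 < ω) (hD : 64 ≤ D)
    (hw : ∀ i ∈ J, 0 ≤ w i) (hW : ∑ i ∈ J, w i ≤ 1) (hs : ∀ i ∈ J, |s i| ≤ 1)
    (hE : ∀ p ∈ E, ω ≤ ∑ i ∈ J with p ∈ G i, w i) (hEne : E.Nonempty)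
    (hnear : ∀ x : ℝ, ∑ i ∈ J with |s i - x| ≤ 1 / D, w i ≤ ω / 4) :
    ∃ i₀ ∈ J, ∃ i₁ ∈ J, ∃ i₂ ∈ J, SeparatedSlopes D (s i₀) (s i₁) (s i₂) ∧
      (ω / 4) ^ 3 * E.card ≤ (E ∩ G i₀ ∩ G i₁ ∩ G i₂).card := by
  classical
  have hne : ∀ F : Finset (ℤ × ℤ), F.Nonempty → ∀ F' : Finset (ℤ × ℤ),
      ω / 4 * F.card ≤ F'.card → F'.Nonempty := by
    intro F hF F' h
    rw [← Finset.card_pos] at hF ⊢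
    have : (0 : ℝ) < F.card := by exact_mod_cast hF
    have : (0 : ℝ) < F'.card := lt_of_lt_of_le (by positivity) h
    exact_mod_cast this
  obtain ⟨i₀, hi₀, -, h0⟩ := exists_rich_index J w G E hω hw hW hE (fun _ => False)
    (by intro _; simp; positivity) hEne
  have hE1 := hne E hEne _ h0
  obtain ⟨i₁, hi₁, hs₁, h1⟩ := exists_rich_index J w G (E ∩ G i₀) hω hw hW
    (fun p hp => hE p (Finset.mem_inter.1 hp).1) (fun i => |s i - s i₀| ≤ 1 / D)
    (by
      intro _
      have := hnear (s i₀)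
      refine le_trans (le_of_eq (Finset.sum_congr ?_ fun _ _ => rfl))
        (this.trans (by linarith : ω / 4 ≤ ω / 2))
      ext; simp only [Finset.mem_filter]) hE1
  have hE2 := hne _ hE1 _ h1
  obtain ⟨i₂, hi₂, hs₂, h2⟩ := exists_rich_index J w G (E ∩ G i₀ ∩ G i₁) hω hw hW
    (fun p hp => hE p (Finset.mem_inter.1 (Finset.mem_inter.1 hp).1).1)
    (fun i => |s i - s i₀| ≤ 1 / D ∨ |s i - s i₁| ≤ 1 / D)
    (by
      intro _
      have h3 := hnear (s i₀)
      have h4 := hnear (s i₁)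
      have h5 : ∑ i ∈ J with (|s i - s i₀| ≤ 1 / D ∨ |s i - s i₁| ≤ 1 / D), w i ≤
          ∑ i ∈ J with |s i - s i₀| ≤ 1 / D, w i + ∑ i ∈ J with |s i - s i₁| ≤ 1 / D, w i := by
        rw [Finset.sum_filter, Finset.sum_filter, Finset.sum_filter, ← Finset.sum_add_distrib]
        refine Finset.sum_le_sum fun i hi => ?_
        have := hw i hi
        by_cases a : |s i - s i₀| ≤ 1 / D <;> by_cases b : |s i - s i₁| ≤ 1 / D <;>
          simp only [a, b, or_self, or_true, true_or, if_true, if_false] <;> linarith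
      refine le_trans (le_of_eq (Finset.sum_congr ?_ fun _ _ => rfl))
        (h5.trans (by linarith : _ ≤ ω / 2))
      ext; simp only [Finset.mem_filter]) hE2
  push Not at hs₁ hs₂
  refine ⟨i₀, hi₀, i₁, hi₁, i₂, hi₂, ⟨hD, hs _ hi₀, hs _ hi₁, hs _ hi₂, ?_, ?_, ?_⟩, ?_⟩
  · rw [abs_sub_comm]; exact hs₁.le
  · rw [abs_sub_comm]; exact hs₂.1.le
  · rw [abs_sub_comm]; exact hs₂.2.le
  · calc (ω / 4) ^ 3 * E.card = ω / 4 * (ω / 4 * (ω / 4 * E.card)) := by ring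
      _ ≤ ω / 4 * (ω / 4 * (E ∩ G i₀).card) := by gcongr
      _ ≤ ω / 4 * (E ∩ G i₀ ∩ G i₁).card := by gcongr
      _ ≤ _ := h2

set_option maxHeartbeats 1000000 in
/-- Discrete projection theorem. Given a finite set `P` of points and a weighted family of slopes, both
non-concentrated, and for every slope a large subset `G i` of `P`, some `G i` has a projection with
more than `K * √|P|` values. -/
theorem exists_large_projection {α β κ : ℝ} (hα : α < 2) (hα0 : 0 < α) (hβ : 0 < β) (hβ1 : β ≤ 1)
    (hκ : 0 < κ) (hκ1 : κ ≤ 1) :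
    ∃ γ : ℝ, 0 < γ ∧ ∃ R₀ : ℝ, 1 ≤ R₀ ∧ ∀ R : ℝ, R₀ ≤ R → ∀ K : ℝ, 2 ≤ K → K ≤ R ^ γ →
    ∀ {ι : Type} (J : Finset ι) (w s : ι → ℝ) (G : ι → Finset (ℤ × ℤ)) (P : Finset (ℤ × ℤ)),
      P.Nonempty → (∀ i ∈ J, 0 ≤ w i) → (∀ i ∈ J, |s i| ≤ 1) →
      1 / K ≤ ∑ i ∈ J, w i → ∑ i ∈ J, w i ≤ 1 →
      (∀ x r : ℝ, 1 / R ≤ r → ∑ i ∈ J with |s i - x| ≤ r, w i ≤ K * r ^ κ) →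
      (P.card : ℝ) ≤ K * R ^ α →
      (∀ p ∈ P, ∀ r : ℝ, 1 / R ≤ r → ((P.filter (fun p' : ℤ × ℤ =>
        |(p'.1 : ℝ) - p.1| ≤ r * R ∧ |(p'.2 : ℝ) - p.2| ≤ r * R)).card : ℝ) ≤
        K * r ^ β * P.card) →
      (∀ i ∈ J, G i ⊆ P) → (∀ i ∈ J, (P.card : ℝ) ≤ K * (G i).card) →
      ∃ i ∈ J, K * √(P.card) < ((G i).image (fun p => ⌊(p.1 : ℝ) + s i * p.2⌋)).card := by
  classical
  set c₁ : ℝ := (1 - α / 2) / 4 with hc₁d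
  have hc₁ : 0 < c₁ := by rw [hc₁d]; linarith
  have hc₁1 : c₁ ≤ 1 := by rw [hc₁d]; linarith
  obtain ⟨γ', hγ', R₀, hR₀, hcore⟩ := exists_no_multipliers (c₀ := c₁ * β / 4) (c₁ := c₁)
    (by positivity) (by nlinarith) hκ hκ1
  -- The separation `D` of the slopes will be at most `R ^ g`, and the losses in the argument are
  -- at most `(D ^ 130) ^ 34 = D ^ 4420`.
  set g : ℝ := min (min γ' (c₁ * β / 2)) 1 / 4420 with hg
  have hg0 : 0 < g := by positivity
  have hg1 : 4420 * g ≤ γ' := by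
    rw [hg]; have := (min_le_left (min γ' (c₁ * β / 2)) 1).trans (min_le_left _ _); linarith
  have hg2 : 4420 * g ≤ c₁ * β / 2 := by
    rw [hg]; have := (min_le_left (min γ' (c₁ * β / 2)) 1).trans (min_le_right _ _); linarith
  have hg3 : g ≤ 1 := by
    rw [hg]; have := min_le_right (min γ' (c₁ * β / 2)) 1; linarith
  refine ⟨κ * g / 6, by positivity, R₀, hR₀, ?_⟩
  intro R hR K hK hKR ι J w s G P hPne hw hs hwK hw1 hfrost hP hPr hGP hGK
  by_contra! hproj
  have hR1 : 1 ≤ R := hR₀.trans hR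
  have hR0 : 0 < R := by linarith
  have hK0 : 0 < K := by linarith
  -- the separation of the slopes: by the Frostman condition an interval of radius `1 / D` has
  -- weight at most `K * D ^ (-κ) = 1 / (8 * K ^ 2)`, a quarter of the weight of a popular point
  set D : ℝ := (8 * K ^ 3) ^ (1 / κ) with hD
  have h8K : 64 ≤ 8 * K ^ 3 := by
    have : (2 : ℝ) ^ 3 ≤ K ^ 3 := by gcongr
    linarith
  have hKD : 8 * K ^ 3 ≤ D := by
    rw [hD]
    exact Real.self_le_rpow_of_one_le (by linarith) (by rw [le_div_iff₀ hκ]; linarith)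
  have hD64 : 64 ≤ D := h8K.trans hKD
  have hD0 : 0 < D := by linarith
  have hD1 : 1 ≤ D := by linarith
  have hDκ : D ^ κ = 8 * K ^ 3 := by
    rw [hD, ← Real.rpow_mul (by positivity), one_div_mul_cancel hκ.ne', Real.rpow_one]
  have hDg : D ≤ R ^ g := by
    calc D ≤ (R ^ (κ * g)) ^ (1 / κ) := by
          refine Real.rpow_le_rpow (by positivity) ?_ (by positivity)
          calc 8 * K ^ 3 = 2 ^ 3 * K ^ 3 := by norm_num
            _ ≤ K ^ 3 * K ^ 3 := by gcongr
            _ = K ^ 6 := by ring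
            _ ≤ (R ^ (κ * g / 6)) ^ 6 := by gcongr
            _ = R ^ (κ * g) := by
                rw [← Real.rpow_natCast (R ^ (κ * g / 6)) 6, ← Real.rpow_mul hR0.le]
                congr 1; push_cast; ring
      _ = R ^ g := by
          rw [← Real.rpow_mul hR0.le]; congr 1; field_simp
  have hDpow : (D ^ 130) ^ 34 ≤ R ^ (4420 * g) := by
    calc (D ^ 130) ^ 34 = D ^ 4420 := by rw [← pow_mul]
      _ ≤ (R ^ g) ^ 4420 := by gcongr
      _ = R ^ (4420 * g) := by
          rw [← Real.rpow_natCast (R ^ g) 4420, ← Real.rpow_mul hR0.le]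
          congr 1; push_cast; ring
  have hDR : D ≤ R := hDg.trans (by
    calc R ^ g ≤ R ^ (1 : ℝ) := Real.rpow_le_rpow_of_exponent_le hR1 hg3
      _ = R := Real.rpow_one R)
  have hK1 : 1 ≤ K := by linarith
  have hKK : K ≤ 8 * K ^ 3 := by
    have : K ≤ K ^ 3 := le_self_pow₀ hK1 (by norm_num)
    linarith
  -- the weight of a popular point
  set ω : ℝ := 1 / (2 * K ^ 2) with hω
  have hω0 : 0 < ω := by positivity
  have hω4 : ω / 4 = 1 / (8 * K ^ 2) := by rw [hω]; field_simp; norm_num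
  obtain ⟨E, hEP, hEc, hEw⟩ := exists_popular_points J w G P hK0 hw hw1 hwK hGP hGK
  have hPpos : (0 : ℝ) < P.card := by exact_mod_cast hPne.card_pos
  have hEne : E.Nonempty := by
    rw [← Finset.card_pos]
    have h1 : 0 < 2 * K ^ 2 * (E.card : ℝ) := lt_of_lt_of_le hPpos hEc
    exact_mod_cast pos_of_mul_pos_right h1 (by positivity)
  have hnear : ∀ x : ℝ, ∑ i ∈ J with |s i - x| ≤ 1 / D, w i ≤ ω / 4 := by
    intro x
    refine (hfrost x (1 / D) (by gcongr)).trans (le_of_eq ?_)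
    rw [Real.div_rpow zero_le_one hD0.le, Real.one_rpow, hDκ, hω4]
    field_simp
  obtain ⟨i₀, hi₀, i₁, hi₁, i₂, hi₂, hsep, hcard⟩ := exists_separated_slopes J w s G E hω0 hD64
    hw hw1 hs hEw hEne hnear
  set E₁ := E ∩ G i₀ ∩ G i₁ ∩ G i₂ with hE₁
  set N := √(P.card : ℝ) with hN
  have hN0 : 0 < N := Real.sqrt_pos.2 hPpos
  have hNsq : N ^ 2 = P.card := Real.sq_sqrt hPpos.le
  have himg : ∀ i ∈ J, ∀ F ⊆ G i,
      ((F.image (fun p => ⌊(p.1 : ℝ) + s i * p.2⌋)).card : ℝ) ≤ K * N := by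
    intro i hi F hF
    refine le_trans ?_ (hproj i hi)
    exact_mod_cast Finset.card_le_card (Finset.image_subset_image hF)
  have hE₁c : N ^ 2 ≤ D ^ 3 * E₁.card := by
    rw [hω4, div_pow, one_pow, one_div_mul_eq_div, div_le_iff₀' (by positivity)] at hcard
    calc N ^ 2 ≤ 2 * K ^ 2 * E.card := by rw [hNsq]; exact hEc
      _ ≤ 2 * K ^ 2 * ((8 * K ^ 2) ^ 3 * E₁.card) := mul_le_mul_of_nonneg_left hcard (by positivity)
      _ = 8 ^ 3 * (2 * K ^ 8) * E₁.card := by ring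
      _ ≤ 8 ^ 3 * (K * K ^ 8) * E₁.card := by gcongr
      _ = (8 * K ^ 3) ^ 3 * E₁.card := by ring
      _ ≤ D ^ 3 * E₁.card := by gcongr
  obtain ⟨A, B, E', hE'E, hS, hE'c, hE'AB⟩ := hsep.exists_smallSumset E₁ hN0
    (K := K) (by
      have : K ≤ K ^ 3 := le_self_pow₀ hK1 (by norm_num)
      linarith) hE₁c
    (himg i₀ hi₀ _ (by
      intro p hp; simp only [hE₁, Finset.mem_inter] at hp; tauto))
    (himg i₁ hi₁ _ (by
      intro p hp; simp only [hE₁, Finset.mem_inter] at hp; tauto))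
    (himg i₂ hi₂ _ (by
      intro p hp; simp only [hE₁, Finset.mem_inter] at hp; tauto))
  have hE'E0 : E' ⊆ E := by
    intro p hp
    have := hE'E hp
    simp only [hE₁, Finset.mem_inter] at this
    tauto
  have hE'ne : E'.Nonempty := by
    rw [← Finset.card_pos]
    have h1 : 0 < D ^ 25 * (E'.card : ℝ) := lt_of_lt_of_le (by positivity) hE'c
    exact_mod_cast pos_of_mul_pos_right h1 (by positivity)
  -- the slopes that see a large part of `E'`
  have hrich := weight_of_rich_indices J w G E' hω0 hw hw1 (fun p hp => hEw p (hE'E0 hp))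
    (fun i => |s i - s i₁| ≤ 1 / D) ((hnear _).trans (by linarith)) hE'ne
  set J' := J.filter (fun i => ¬ |s i - s i₁| ≤ 1 / D ∧ ω / 4 * E'.card ≤ (E' ∩ G i).card) with hJ'
  set t : ι → ℝ := fun i => slopeRatio (s i₀) (s i₁) (s i₂) (s i) with ht
  have hfar : ∀ i ∈ J', 1 / D ≤ |s i₁ - s i| := fun i hi => by
    have := (Finset.mem_filter.1 hi).2.1
    rw [abs_sub_comm]; exact (not_le.1 this).le
  have hD130 : 64 ≤ D ^ 130 := hD64.trans (le_self_pow₀ hD1 (by norm_num))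
  have hL15 : (D ^ 130) ^ 15 ≤ (D ^ 130) ^ 16 := pow_le_pow_right₀ (by linarith) (by norm_num)
  have hL1 : D ^ 130 ≤ (D ^ 130) ^ 16 := le_self_pow₀ (by linarith) (by norm_num)
  refine hcore R hR ((D ^ 130) ^ 16) (by linarith) ?_ (A - A) (insert 0 (J'.image t))
    ((hS.isApproxGroup (by linarith)).mono (pow_le_pow_right₀ (by linarith) (by norm_num)))
    (hsep.isSmallSpread hS hE'c hE'AB (hE'E0.trans hEP) hNsq hR1 hK1 (by linarith) hβ1 hc₁
      (by rw [hc₁d]; linarith) hc₁1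
      (hDpow.trans (Real.rpow_le_rpow_of_exponent_le hR1 hg2)) hP hPr) ?_
    (Finset.mem_insert_self _ _) ?_
  · calc (D ^ 130) ^ 16 ≤ (D ^ 130) ^ 34 := pow_le_pow_right₀ (by linarith) (by norm_num)
      _ ≤ R ^ (4420 * g) := hDpow
      _ ≤ R ^ γ' := Real.rpow_le_rpow_of_exponent_le hR1 hg1
  · intro a ha
    rcases Finset.mem_insert.1 ha with rfl | ha
    · exact IsMultiplier.zero (hS.isApproxGroup (by linarith)) (by linarith)
    · obtain ⟨i, hi, rfl⟩ := Finset.mem_image.1 ha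
      obtain ⟨hiJ, _, hic⟩ := Finset.mem_filter.1 hi
      refine (hsep.isMultiplier hS hE'c hE'AB hK1 hKD (hs i hiJ) (hfar i hi) (G := G i) ?_
        (himg i hiJ _ subset_rfl)).mono hL15
      rw [hω4, one_div_mul_eq_div, div_le_iff₀ (by positivity)] at hic
      linarith
  · intro r hr _
    have hr0 : 0 < r := lt_of_lt_of_le (by positivity) hr
    refine (hasSeparated_of_weights J J' (Finset.filter_subset _ _) w s t hw hfrost
      (C := 8 * D ^ 2) (fun i hi j hj => hsep.abs_sub_le_mul_slopeRatio
        (hs i (Finset.mem_filter.1 hi).1) (hs j (Finset.mem_filter.1 hj).1) (hfar i hi)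
        (hfar j hj)) (by nlinarith) hr0 hr hrich hK0).mono
      (Finset.subset_insert _ _) le_rfl ?_
    have h1 : (8 * D ^ 2 * r) ^ κ ≤ D ^ 3 * r ^ κ := by
      rw [Real.mul_rpow (by positivity) hr0.le]
      gcongr
      calc (8 * D ^ 2) ^ κ ≤ (8 * D ^ 2) ^ (1 : ℝ) :=
            Real.rpow_le_rpow_of_exponent_le (by nlinarith) hκ1
        _ = 8 * D ^ 2 := Real.rpow_one _
        _ ≤ D * D ^ 2 := by gcongr; linarith
        _ = D ^ 3 := by ring
    rw [Real.rpow_neg hr0.le, div_le_div_iff₀ (by positivity) (by positivity), hω4]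
    have hrκ : 0 < r ^ κ := by positivity
    calc (r ^ κ)⁻¹ * (K * (8 * D ^ 2 * r) ^ κ) ≤ (r ^ κ)⁻¹ * (K * (D ^ 3 * r ^ κ)) := by gcongr
      _ = 1 / (8 * K ^ 2) * ((8 * K ^ 3) * D ^ 3) := by field_simp
      _ ≤ 1 / (8 * K ^ 2) * (D * D ^ 3) := by gcongr
      _ = 1 / (8 * K ^ 2) * D ^ 4 := by ring
      _ ≤ 1 / (8 * K ^ 2) * (D ^ 130) ^ 16 := by
          refine mul_le_mul_of_nonneg_left ?_ (by positivity)
          rw [← pow_mul]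
          exact pow_le_pow_right₀ hD1 (by norm_num)
/-! ### Cells of a square grid -/


/-- The Euclidean plane. -/
abbrev Plane : Type := EuclideanSpace ℝ (Fin 2)

theorem Plane.univ_sum {k j : Fin 2} (hkj : k ≠ j) (f : Fin 2 → ℝ) : ∑ i, f i = f k + f j := by
  rw [Fin.sum_univ_two]
  fin_cases k <;> fin_cases j <;> simp_all [add_comm]

theorem Plane.dist_sq {k j : Fin 2} (hkj : k ≠ j) (x y : Plane) :
    dist x y ^ 2 = (x k - y k) ^ 2 + (x j - y j) ^ 2 := by
  rw [EuclideanSpace.dist_eq, Real.sq_sqrt (Finset.sum_nonneg fun i _ => sq_nonneg _),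
    Plane.univ_sum hkj]
  simp [Real.dist_eq, sq_abs]

theorem Plane.abs_sub_le_dist {k j : Fin 2} (hkj : k ≠ j) (x y : Plane) : |x k - y k| ≤ dist x y := by
  refine abs_le_of_sq_le_sq ?_ dist_nonneg
  rw [Plane.dist_sq hkj]
  nlinarith [sq_nonneg (x j - y j)]

theorem Plane.dist_le {k j : Fin 2} (hkj : k ≠ j) (x y : Plane) :
    dist x y ≤ |x k - y k| + |x j - y j| := by
  refine le_of_sq_le_sq ?_ (by positivity)
  rw [Plane.dist_sq hkj, add_sq, sq_abs, sq_abs]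
  have : 0 ≤ |x k - y k| * |x j - y j| := by positivity
  linarith

/-- The index of the square of side `δ` that contains `x`, with the coordinate `k` listed first and the
coordinate `j` second. For directions `θ` whose coordinate `k` dominates, the projection is then
`x + s y` with the slope `s = θ j / θ k ∈ [-1, 1]`. -/
noncomputable def gridCell (δ : ℝ) (k j : Fin 2) (x : Plane) : ℤ × ℤ := (⌊x k / δ⌋, ⌊x j / δ⌋)

theorem measurable_gridCell (δ : ℝ) (k j : Fin 2) : Measurable (gridCell δ k j) := by
  unfold gridCell
  fun_prop

theorem abs_sub_le_of_floor_eq {δ a b : ℝ} (hδ : 0 < δ) (h : ⌊a / δ⌋ = ⌊b / δ⌋) : |a - b| ≤ δ := by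
  have h5 := abs_lt.1 (Int.abs_sub_lt_one_of_floor_eq_floor h)
  rw [← sub_div, lt_div_iff₀ hδ, div_lt_iff₀ hδ] at h5
  rw [abs_le]
  constructor <;> linarith [h5.1, h5.2]

section Grid

variable {δ : ℝ} {k j : Fin 2}

theorem dist_le_of_gridCell_eq (hδ : 0 < δ) (hkj : k ≠ j) {x y : Plane}
    (h : gridCell δ k j x = gridCell δ k j y) : dist x y ≤ 2 * δ := by
  simp only [gridCell, Prod.mk.injEq] at h
  have h1 := abs_sub_le_of_floor_eq hδ h.1
  have h2 := abs_sub_le_of_floor_eq hδ h.2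
  linarith [Plane.dist_le hkj x y]

theorem finite_image_gridCell (hδ : 0 < δ) (hkj : k ≠ j) {M : ℝ} {S : Set Plane}
    (hS : S ⊆ Metric.closedBall 0 M) : (gridCell δ k j '' S).Finite := by
  refine ((Finset.Icc ⌊-M / δ⌋ ⌊M / δ⌋) ×ˢ (Finset.Icc ⌊-M / δ⌋ ⌊M / δ⌋)).finite_toSet.subset ?_
  rintro _ ⟨x, hx, rfl⟩
  have h0 := Metric.mem_closedBall.1 (hS hx)
  have h1 := abs_le.1 ((Plane.abs_sub_le_dist hkj x 0).trans h0)
  have h2 := abs_le.1 ((Plane.abs_sub_le_dist hkj.symm x 0).trans h0)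
  simp only [PiLp.zero_apply, sub_zero] at h1 h2
  simp only [gridCell, Finset.coe_product, Finset.coe_Icc, Set.mem_prod, Set.mem_Icc]
  refine ⟨⟨?_, ?_⟩, ?_, ?_⟩ <;> refine Int.floor_le_floor ?_ <;> gcongr <;> linarith [h1.1, h1.2, h2.1, h2.2]

/-- The centre of the square of side `δ` with index `p`, the first entry of `p` belonging to the
coordinate `k`. -/
noncomputable def cellCenter (δ : ℝ) (k : Fin 2) (p : ℤ × ℤ) : Plane :=
  WithLp.toLp 2 (fun i => if i = k then (p.1 + 1 / 2) * δ else (p.2 + 1 / 2) * δ)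

theorem dist_cellCenter_le (hδ : 0 < δ) (hkj : k ≠ j) (x : Plane) :
    dist x (cellCenter δ k (gridCell δ k j x)) ≤ δ := by
  have key : ∀ a : ℝ, |a - ((⌊a / δ⌋ : ℝ) + 1 / 2) * δ| ≤ δ / 2 := by
    intro a
    have h1 := Int.floor_le (a / δ)
    have h2 := Int.lt_floor_add_one (a / δ)
    rw [le_div_iff₀ hδ] at h1
    rw [div_lt_iff₀ hδ] at h2
    rw [abs_le]
    constructor <;> linarith
  refine (Plane.dist_le hkj _ _).trans ?_
  have h1 := key (x k)
  have h2 := key (x j)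
  simp only [cellCenter, gridCell, if_true, hkj.symm, if_false]
  linarith

theorem covNum_le_card (hδ : 0 < δ) (hkj : k ≠ j) {S : Set Plane} {T : Finset (ℤ × ℤ)}
    (hT : ∀ x ∈ S, gridCell δ k j x ∈ T) : covNum δ S ≤ T.card := by
  classical
  have hc : Metric.IsCover δ.toNNReal S
      ((T.image (cellCenter δ k) : Finset Plane) : Set Plane) := by
    intro x hx
    refine ⟨cellCenter δ k (gridCell δ k j x), ?_, ?_⟩
    · exact Finset.mem_coe.2 (Finset.mem_image_of_mem _ (hT x hx))
    · have := dist_cellCenter_le hδ hkj x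
      simp only [Set.mem_ofPred_eq]
      rw [edist_dist]
      exact ENNReal.ofReal_le_ofReal this
  have h1 := hc.externalCoveringNumber_le_encard
  have h2 : ((T.image (cellCenter δ k) : Finset Plane) : Set Plane).encard ≤ (T.card : ℕ∞) := by
    rw [Set.encard_coe_eq_coe_finsetCard]
    exact_mod_cast Finset.card_image_le
  unfold covNum
  have h3 : ((Metric.externalCoveringNumber δ.toNNReal S : ℕ∞) : ℝ≥0∞) ≤ ((T.card : ℕ∞) : ℝ≥0∞) :=
    ENat.toENNReal_le.2 (h1.trans h2)
  simpa using h3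

theorem volume_le_mul_card (hδ : 0 < δ) (hkj : k ≠ j) {S : Set Plane} {T : Finset (ℤ × ℤ)}
    (hT : ∀ x ∈ S, gridCell δ k j x ∈ T) : volume S ≤ ENNReal.ofReal (4 * δ ^ 2 * T.card) := by
  have h1 : S ⊆ ⋃ p ∈ T, Metric.closedBall (cellCenter δ k p) δ := by
    intro x hx
    exact Set.mem_biUnion (Finset.mem_coe.2 (hT x hx))
      (Metric.mem_closedBall.2 (dist_cellCenter_le hδ hkj x))
  calc volume S ≤ volume (⋃ p ∈ T, Metric.closedBall (cellCenter δ k p) δ) := measure_mono h1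
    _ ≤ ∑ p ∈ T, volume (Metric.closedBall (cellCenter δ k p) δ) :=
        measure_biUnion_finset_le _ _
    _ ≤ ∑ p ∈ T, ENNReal.ofReal (4 * δ ^ 2) := by
        refine Finset.sum_le_sum fun p _ => ?_
        rw [EuclideanSpace.volume_closedBall_fin_two, ← ENNReal.ofReal_pow hδ.le,
          ← ENNReal.ofReal_mul (by positivity)]
        refine ENNReal.ofReal_le_ofReal ?_
        nlinarith [Real.pi_le_four, sq_nonneg δ]
    _ = ENNReal.ofReal (4 * δ ^ 2 * T.card) := by
        rw [Finset.sum_const, nsmul_eq_mul, mul_comm,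
          ENNReal.ofReal_mul (p := 4 * δ ^ 2) (by positivity), ENNReal.ofReal_natCast]

theorem exists_subinterval_of_cell (hδ : 0 < δ) (y : ℝ) :
    ∃ z : ℝ, |z - y| ≤ δ / 4 ∧ ∀ t, |t - z| ≤ δ / 4 → ⌊t / δ⌋ = ⌊y / δ⌋ := by
  have h1 := Int.floor_le (y / δ)
  have h2 := Int.lt_floor_add_one (y / δ)
  rw [le_div_iff₀ hδ] at h1
  rw [div_lt_iff₀ hδ] at h2
  by_cases h : y < ((⌊y / δ⌋ : ℝ) + 1 / 2) * δ
  · refine ⟨y + δ / 4, by rw [abs_le]; constructor <;> linarith, fun t ht => ?_⟩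
    have := abs_le.1 ht
    rw [Int.floor_eq_iff, le_div_iff₀ hδ, div_lt_iff₀ hδ]
    constructor <;> nlinarith [this.1, this.2]
  · refine ⟨y - δ / 4, by rw [abs_le]; constructor <;> linarith, fun t ht => ?_⟩
    have := abs_le.1 ht
    rw [Int.floor_eq_iff, le_div_iff₀ hδ, div_lt_iff₀ hδ]
    constructor <;> nlinarith [this.1, this.2]

/-- The cell of `y` contains a ball of radius `δ / 4`, and this ball is contained in the ball of radius
`δ` around `y`. -/
theorem exists_ball_in_cell (hδ : 0 < δ) (hkj : k ≠ j) (y : Plane) :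
    ∃ z : Plane, ∀ x ∈ Metric.closedBall z (δ / 4), gridCell δ k j x = gridCell δ k j y ∧
      dist x y ≤ δ := by
  obtain ⟨a, ha, ha'⟩ := exists_subinterval_of_cell hδ (y k)
  obtain ⟨b, hb, hb'⟩ := exists_subinterval_of_cell hδ (y j)
  refine ⟨WithLp.toLp 2 (fun i => if i = k then a else b), fun x hx => ?_⟩
  have hx := Metric.mem_closedBall.1 hx
  have h1 := (Plane.abs_sub_le_dist hkj _ _).trans hx
  have h2 := (Plane.abs_sub_le_dist hkj.symm _ _).trans hx
  simp only [if_true, hkj.symm, if_false] at h1 h2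
  refine ⟨by simp only [gridCell, ha' _ h1, hb' _ h2], (Plane.dist_le hkj _ _).trans ?_⟩
  have h3 := abs_sub_le (x k) a (y k)
  have h4 := abs_sub_le (x j) b (y j)
  linarith

/-- A union `E` of `δ`-balls fills a positive proportion of the cells that it meets. A cell met by `E`
near `a` is one of the nine cells in and around the cell of some centre `y`; the latter contains a ball
of radius `δ / 4` inside `E`, and these balls are disjoint for different cells. -/
theorem card_mul_le_volume (hδ : 0 < δ) (hkj : k ≠ j) {E : Set Plane} {F : Finset Plane}
    (hE : E = ⋃ x ∈ F, Metric.closedBall x δ) {T : Finset (ℤ × ℤ)} {a : Plane} {ρ : ℝ}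
    (hT : ∀ p ∈ T, ∃ x ∈ E, gridCell δ k j x = p ∧ dist x a ≤ ρ) :
    ENNReal.ofReal (δ ^ 2 * T.card) ≤ 72 * volume (E ∩ Metric.closedBall a (ρ + 2 * δ)) := by
  classical
  have hex : ∀ p ∈ T, ∃ y ∈ F, dist y a ≤ ρ + δ ∧ |(gridCell δ k j y).1 - p.1| ≤ 1 ∧
      |(gridCell δ k j y).2 - p.2| ≤ 1 := by
    intro p hp
    obtain ⟨x, hx, rfl, hxa⟩ := hT p hp
    rw [hE] at hx
    simp only [Set.mem_iUnion, Metric.mem_closedBall] at hx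
    obtain ⟨y, hy, hxy⟩ := hx
    have key : ∀ s t : ℝ, |s - t| ≤ δ → |⌊t / δ⌋ - ⌊s / δ⌋| ≤ 1 := by
      intro s t hst
      have h0 := abs_le.1 hst
      have h1 : ⌊t / δ⌋ ≤ ⌊s / δ + 1⌋ := by
        refine Int.floor_le_floor ?_
        rw [div_add_one hδ.ne']
        gcongr; linarith [h0.1]
      have h2 : ⌊s / δ⌋ ≤ ⌊t / δ + 1⌋ := by
        refine Int.floor_le_floor ?_
        rw [div_add_one hδ.ne']
        gcongr; linarith [h0.2]
      rw [Int.floor_add_one] at h1 h2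
      rw [abs_le]
      constructor <;> linarith
    refine ⟨y, hy, ?_, key _ _ ((Plane.abs_sub_le_dist hkj _ _).trans hxy),
      key _ _ ((Plane.abs_sub_le_dist hkj.symm _ _).trans hxy)⟩
    have := dist_triangle y x a
    rw [dist_comm y x] at this
    linarith
  choose! y hyF hya hy1 hy2 using hex
  set q : ℤ × ℤ → ℤ × ℤ := fun p => gridCell δ k j (y p) with hq
  have hcard : T.card ≤ 9 * (T.image q).card := by
    refine Finset.card_le_mul_card_image T 9 fun b hb => ?_
    have h1 : T.filter (fun p => q p = b) ⊆
        Finset.Icc (b.1 - 1) (b.1 + 1) ×ˢ Finset.Icc (b.2 - 1) (b.2 + 1) := by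
      intro p hp
      obtain ⟨hpT, rfl⟩ := Finset.mem_filter.1 hp
      have a1 := abs_le.1 (hy1 p hpT)
      have a2 := abs_le.1 (hy2 p hpT)
      simp only [Finset.mem_product, Finset.mem_Icc, hq]
      omega
    refine (Finset.card_le_card h1).trans ?_
    rw [Finset.card_product, Int.card_Icc, Int.card_Icc]
    have e1 : b.1 + 1 + 1 - (b.1 - 1) = 3 := by ring
    have e2 : b.2 + 1 + 1 - (b.2 - 1) = 3 := by ring
    rw [e1, e2]
    decide
  have hrep : ∀ c ∈ T.image q, ∃ z : Plane, ∀ x ∈ Metric.closedBall z (δ / 4),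
      gridCell δ k j x = c ∧ x ∈ E ∩ Metric.closedBall a (ρ + 2 * δ) := by
    intro c hc
    obtain ⟨p, hp, rfl⟩ := Finset.mem_image.1 hc
    obtain ⟨z, hz⟩ := exists_ball_in_cell hδ hkj (y p)
    refine ⟨z, fun x hx => ⟨(hz x hx).1, ?_, ?_⟩⟩
    · rw [hE]
      exact Set.mem_biUnion (Finset.mem_coe.2 (hyF p hp)) (Metric.mem_closedBall.2 (hz x hx).2)
    · have := dist_triangle x (y p) a
      have := (hz x hx).2
      have := hya p hp
      rw [Metric.mem_closedBall]
      linarith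
  choose! z hz using hrep
  have hsum : ∑ c ∈ T.image q, volume (Metric.closedBall (z c) (δ / 4)) ≤
      volume (E ∩ Metric.closedBall a (ρ + 2 * δ)) := by
    rw [← measure_biUnion_finset]
    · refine measure_mono (Set.iUnion₂_subset fun c hc x hx => (hz c hc x hx).2)
    · intro c hc c' hc' hne
      refine Set.disjoint_left.2 fun x hx hx' => hne ?_
      rw [← (hz c hc x hx).1, (hz c' hc' x hx').1]
    · exact fun c _ => Metric.isClosed_closedBall.measurableSet
  calc ENNReal.ofReal (δ ^ 2 * T.card) ≤ ENNReal.ofReal (72 * ((T.image q).card * (δ ^ 2 / 8))) := by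
        refine ENNReal.ofReal_le_ofReal ?_
        have : (T.card : ℝ) ≤ 9 * (T.image q).card := by exact_mod_cast hcard
        nlinarith [sq_nonneg δ]
    _ = 72 * ∑ c ∈ T.image q, ENNReal.ofReal (δ ^ 2 / 8) := by
        rw [ENNReal.ofReal_mul (by norm_num), ENNReal.ofReal_mul (by positivity), Finset.sum_const,
          nsmul_eq_mul, ENNReal.ofReal_natCast]
        norm_num
    _ ≤ 72 * ∑ c ∈ T.image q, volume (Metric.closedBall (z c) (δ / 4)) := by
        gcongr with c _
        rw [EuclideanSpace.volume_closedBall_fin_two, ← ENNReal.ofReal_pow (by positivity),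
          ← ENNReal.ofReal_mul (by positivity)]
        refine ENNReal.ofReal_le_ofReal ?_
        nlinarith [Real.pi_gt_three, sq_nonneg δ]
    _ ≤ _ := by gcongr

end Grid
/-! ### Directions and projections in the plane -/


section Directions

variable {δ : ℝ} {k j : Fin 2}

theorem dirProj_eq (hkj : k ≠ j) (θ x : Plane) : dirProj θ x = θ k * x k + θ j * x j := by
  unfold dirProj
  rw [PiLp.inner_apply, Plane.univ_sum hkj]
  simp

/-- The infimum in the definition of `covNum` is attained. -/
theorem exists_cover_of_covNum_le (hδ : 0 < δ) {S : Set ℝ} {M : ℝ} (hM : 0 ≤ M)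
    (h : covNum δ S ≤ ENNReal.ofReal M) :
    ∃ C : Finset ℝ, (C.card : ℝ) ≤ M ∧ ∀ x ∈ S, ∃ t ∈ C, |x - t| ≤ δ := by
  classical
  unfold covNum at h
  have hne : Metric.externalCoveringNumber δ.toNNReal S ≠ ⊤ := by
    intro h0
    rw [h0] at h
    simp at h
  obtain ⟨C, hC, hCc⟩ : ∃ C : Set ℝ, Metric.IsCover δ.toNNReal S C ∧
      C.encard = Metric.externalCoveringNumber δ.toNNReal S := by
    have : Nonempty {C : Set ℝ // Metric.IsCover δ.toNNReal S C} := ⟨S, by simp⟩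
    obtain ⟨C, hC⟩ := ENat.exists_eq_iInf
      (fun C : {C : Set ℝ // Metric.IsCover δ.toNNReal S C} => (C : Set ℝ).encard)
    refine ⟨C, C.2, ?_⟩
    rw [hC, Metric.externalCoveringNumber, iInf_subtype]
  have hfin : C.Finite := by
    rw [← Set.encard_ne_top_iff, hCc]; exact hne
  refine ⟨hfin.toFinset, ?_, ?_⟩
  · rw [← hCc, hfin.encard_eq_coe_toFinset_card] at h
    have h2 : ((hfin.toFinset.card : ℝ≥0∞)) ≤ ENNReal.ofReal M := by simpa using h
    rw [← ENNReal.ofReal_natCast] at h2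
    exact (ENNReal.ofReal_le_ofReal_iff hM).1 h2
  · intro x hx
    obtain ⟨t, ht, hxt⟩ := hC hx
    refine ⟨t, hfin.mem_toFinset.2 ht, ?_⟩
    simp only [Set.mem_ofPred_eq] at hxt
    rw [edist_dist, Real.dist_eq] at hxt
    exact (ENNReal.ofReal_le_ofReal_iff hδ.le).1 hxt

/-- The projections of the cells that meet `G` take few values if the projection of `G` has a small
covering number. -/
theorem card_image_floor_le (hδ : 0 < δ) (hkj : k ≠ j) {G : Set Plane} {T : Finset (ℤ × ℤ)}
    {θ : Plane} (hθ : 1 / 2 ≤ |θ k|) (hθ' : |θ j| ≤ |θ k|)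
    (hT : ∀ p ∈ T, ∃ x ∈ G, gridCell δ k j x = p) {M : ℝ} (hM : 0 ≤ M)
    (h : covNum δ (dirProj θ '' G) ≤ ENNReal.ofReal M) :
    ((T.image (fun p => ⌊(p.1 : ℝ) + θ j / θ k * p.2⌋)).card : ℝ) ≤ 11 * M := by
  classical
  obtain ⟨C, hC, hcov⟩ := exists_cover_of_covNum_le hδ hM h
  have hk : 0 < |θ k| := by linarith
  have hk0 : θ k ≠ 0 := abs_pos.1 hk
  have hs : |θ j / θ k| ≤ 1 := by
    rw [abs_div, div_le_one hk]; exact hθ'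
  choose! x hxG hx using hT
  have hex : ∀ p ∈ T, ∃ t ∈ C, |dirProj θ (x p) - t| ≤ δ := fun p hp =>
    hcov _ (Set.mem_image_of_mem _ (hxG p hp))
  choose! t htC ht using hex
  have triangle : ∀ {a a' b b' f t : ℝ}, |a + b - t| ≤ 2 → |a - a'| ≤ 1 → |b - b'| ≤ 1 →
      |a' + b' - f| ≤ 1 → |f - t| ≤ 5 := by
    intro a a' b b' f t h1 h2 h3 h4
    rw [abs_le] at *
    constructor <;> linarith [h1.1, h1.2, h2.1, h2.2, h3.1, h3.2, h4.1, h4.2]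
  have h1 := card_image_le_of_near T t (fun p => ⌊(p.1 : ℝ) + θ j / θ k * p.2⌋)
    (fun t => t / (θ k * δ)) (c := 5) (by norm_num) (by
      intro p hp
      have a1 := ht p hp
      have a2 := hx p hp
      rw [dirProj_eq hkj] at a1
      have b1 : |(θ k * x p k + θ j * x p j) / (θ k * δ) - t p / (θ k * δ)| ≤ 2 := by
        rw [← sub_div, abs_div, abs_mul, abs_of_pos hδ, div_le_iff₀ (by positivity)]
        nlinarith
      have b2 : (θ k * x p k + θ j * x p j) / (θ k * δ) = x p k / δ + θ j / θ k * (x p j / δ) := by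
        field_simp
      have c1 := abs_sub_floor_le (x p k / δ)
      have c2 := abs_sub_floor_le (x p j / δ)
      have b3 := abs_sub_floor_le ((p.1 : ℝ) + θ j / θ k * p.2)
      rw [show ⌊x p k / δ⌋ = p.1 from congrArg Prod.fst a2] at c1
      rw [show ⌊x p j / δ⌋ = p.2 from congrArg Prod.snd a2] at c2
      have c3 : |θ j / θ k * (x p j / δ - p.2)| ≤ 1 := by
        rw [abs_mul]
        calc _ ≤ 1 * (1 : ℝ) := by gcongr
          _ = 1 := one_mul 1
      rw [b2] at b1
      rw [mul_sub] at c3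
      exact triangle b1 c1 c3 b3)
  have h2 : ((T.image t).card : ℝ) ≤ C.card := by
    refine Nat.cast_le.2 (Finset.card_le_card fun z hz => ?_)
    obtain ⟨p, hp, rfl⟩ := Finset.mem_image.1 hz
    exact htC p hp
  linarith

theorem Plane.sq_add_sq (hkj : k ≠ j) {u : Plane} (hu : u ∈ Metric.sphere (0 : Plane) 1) :
    u k ^ 2 + u j ^ 2 = 1 := by
  have h := Plane.dist_sq hkj u 0
  rw [Metric.mem_sphere.1 hu] at h
  simp only [PiLp.zero_apply, sub_zero] at h
  linarith

/-- On an arc of the circle where the coordinate `k` dominates and has the sign `σ`, the slope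
determines the direction in a Lipschitz way. -/
theorem dist_le_of_slope_near (hkj : k ≠ j) {u v : Plane} {σ r : ℝ} (hσ : σ = 1 ∨ σ = -1)
    (hu : u ∈ Metric.sphere (0 : Plane) 1) (hv : v ∈ Metric.sphere (0 : Plane) 1)
    (hu' : |u j| ≤ σ * u k) (hv' : |v j| ≤ σ * v k) (hr : |u j / u k - v j / v k| ≤ r) :
    dist u v ≤ 2 * r := by
  have hu1 := Plane.sq_add_sq hkj hu
  have hv1 := Plane.sq_add_sq hkj hv
  have hr0 : 0 ≤ r := (abs_nonneg _).trans hr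
  have hσ2 : σ ^ 2 = 1 := by rcases hσ with rfl | rfl <;> norm_num
  have hpos : ∀ w : Plane, w k ^ 2 + w j ^ 2 = 1 → |w j| ≤ σ * w k → 0 < σ * w k := by
    intro w hw hw'
    refine lt_of_le_of_ne ((abs_nonneg _).trans hw') fun h0 => ?_
    rw [← h0] at hw'
    have h1 : w j = 0 := abs_nonpos_iff.1 hw'
    have h2 : w k = 0 := by
      have : σ * (σ * w k) = 0 := by rw [← h0, mul_zero]
      linear_combination this - w k * hσ2
    rw [h1, h2] at hw
    norm_num at hw
  have hku := hpos u hu1 hu'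
  have hkv := hpos v hv1 hv'
  have hku0 : u k ≠ 0 := by rintro h0; rw [h0, mul_zero] at hku; exact lt_irrefl _ hku
  have hkv0 : v k ≠ 0 := by rintro h0; rw [h0, mul_zero] at hkv; exact lt_irrefl _ hkv
  have huv : 0 ≤ u k * v k + u j * v j := by
    have h1 : |u j| * |v j| ≤ (σ * u k) * (σ * v k) := by gcongr
    rw [← abs_mul] at h1
    have h2 := (abs_le.1 h1).1
    have h3 : (σ * u k) * (σ * v k) = u k * v k := by linear_combination u k * v k * hσ2
    linarith
  have hprod : |u k * v k| ≤ 1 := by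
    rw [abs_le]; constructor <;> nlinarith [sq_nonneg (u k - v k), sq_nonneg (u k + v k), sq_nonneg (u j), sq_nonneg (v j)]
  have hcross : (u k * v j - u j * v k) ^ 2 ≤ r ^ 2 := by
    have e : u k * v j - u j * v k = -(u k * v k * (u j / u k - v j / v k)) := by
      field_simp; ring
    rw [e, neg_sq, ← sq_abs]
    gcongr
    rw [abs_mul]
    calc _ ≤ 1 * r := by gcongr
      _ = r := one_mul r
  have hd1 : u k * v k + u j * v j ≤ 1 := by
    nlinarith [sq_nonneg (u k - v k), sq_nonneg (u j - v j)]
  have hid : (u k * v j - u j * v k) ^ 2 = 1 - (u k * v k + u j * v j) ^ 2 := by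
    linear_combination (v k ^ 2 + v j ^ 2) * hu1 + hv1
  refine le_of_sq_le_sq ?_ (by positivity)
  rw [Plane.dist_sq hkj]
  nlinarith

theorem half_le_abs (hkj : k ≠ j) {u : Plane} {σ : ℝ} (hσ : σ = 1 ∨ σ = -1)
    (hu : u ∈ Metric.sphere (0 : Plane) 1) (hu' : |u j| ≤ σ * u k) :
    1 / 2 ≤ |u k| ∧ |u j| ≤ |u k| := by
  have h1 := Plane.sq_add_sq hkj hu
  have h2 : σ * u k ≤ |u k| := by
    rcases hσ with rfl | rfl
    · rw [one_mul]; exact le_abs_self _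
    · rw [neg_one_mul]; exact neg_le_abs _
  have h3 := hu'.trans h2
  refine ⟨?_, h3⟩
  by_contra! hlt
  have h4 : |u j| < 1 / 2 := h3.trans_lt hlt
  rw [← sq_abs (u k), ← sq_abs (u j)] at h1
  nlinarith [abs_nonneg (u k), abs_nonneg (u j)]

end Directions

/-- The exponent of a Frostman measure may be lowered to at most `1`. -/
theorem IsFrostmanMeasure.min_one {d : ℕ} {κ C : ℝ} (hκ : 0 < κ) (hC : 1 ≤ C)
    {μ : Measure (EuclideanSpace ℝ (Fin d))} (h : IsFrostmanMeasure κ C μ) :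
    IsFrostmanMeasure (min κ 1) C μ := by
  have := h.1
  refine ⟨h.1, fun x hx r hr => ?_⟩
  by_cases hr1 : r ≤ 1
  · refine (h.2 x hx r hr).trans (ENNReal.ofReal_le_ofReal ?_)
    exact mul_le_mul_of_nonneg_left
      (Real.rpow_le_rpow_of_exponent_ge hr hr1 (min_le_left _ _)) (by linarith)
  · refine prob_le_one.trans ?_
    rw [← ENNReal.ofReal_one]
    exact ENNReal.ofReal_le_ofReal
      (one_le_mul_of_one_le_of_one_le hC (Real.one_le_rpow (by linarith) (by positivity)))

/-- The exponent of a `(δ, β, C)`-set may be lowered to at most `1`. -/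
theorem IsDeltaSet.min_one {d : ℕ} {δ β C : ℝ} (hδ : 0 < δ) (hβ : 0 < β) (hC : 1 ≤ C)
    {A : Set (EuclideanSpace ℝ (Fin d))} (h : IsDeltaSet δ β C A) :
    IsDeltaSet δ (min β 1) C A := by
  refine ⟨h.1, fun x hx r hr => ?_⟩
  have hr0 : 0 < r := hδ.trans_le hr
  by_cases hr1 : r ≤ 1
  · refine (h.2 x hx r hr).trans (mul_le_mul_left (ENNReal.ofReal_le_ofReal ?_) _)
    exact mul_le_mul_of_nonneg_left
      (Real.rpow_le_rpow_of_exponent_ge hr0 hr1 (min_le_left _ _)) (by linarith)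
  · have h1 : (1 : ℝ) ≤ C * r ^ min β 1 :=
      one_le_mul_of_one_le_of_one_le hC (Real.one_le_rpow (by linarith) (by positivity))
    calc volume (A ∩ Metric.closedBall x r) ≤ 1 * volume A := by
          rw [one_mul]; exact measure_mono Set.inter_subset_left
      _ ≤ _ := by
          gcongr
          rw [← ENNReal.ofReal_one]
          exact ENNReal.ofReal_le_ofReal h1
/-! ### From measures to finite sets -/


theorem mul_rpow_le_mul {c r β : ℝ} (hc : 1 ≤ c) (hr : 0 ≤ r) (hβ1 : β ≤ 1) :
    (c * r) ^ β ≤ c * r ^ β := by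
  rw [Real.mul_rpow (by linarith) hr]
  gcongr
  calc c ^ β ≤ c ^ (1 : ℝ) := Real.rpow_le_rpow_of_exponent_le hc hβ1
    _ = c := Real.rpow_one c

section Cells

variable {δ β C : ℝ} {k j : Fin 2} {E : Set Plane} {P : Finset (ℤ × ℤ)}

/-- The cells of a `(δ, β, C)`-set inherit its non-concentration. -/
theorem IsDeltaSet.card_filter_cells_le (hδ : 0 < δ) (hkj : k ≠ j) (hβ1 : β ≤ 1) (hC : 0 ≤ C)
    (hE : IsDeltaSet δ β C E) (hP : ∀ p, p ∈ P ↔ ∃ x ∈ E, gridCell δ k j x = p) {p : ℤ × ℤ}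
    (hp : p ∈ P) {r : ℝ} (hr : δ ≤ r) :
    ((P.filter (fun p' : ℤ × ℤ => |(p'.1 : ℝ) - p.1| ≤ r * δ⁻¹ ∧
      |(p'.2 : ℝ) - p.2| ≤ r * δ⁻¹)).card : ℝ) ≤ 1728 * C * r ^ β * P.card := by
  set T := P.filter (fun p' : ℤ × ℤ => |(p'.1 : ℝ) - p.1| ≤ r * δ⁻¹ ∧
      |(p'.2 : ℝ) - p.2| ≤ r * δ⁻¹) with hT
  have hr0 : 0 < r := hδ.trans_le hr
  obtain ⟨F, hF⟩ := hE.1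
  obtain ⟨x, hx, rfl⟩ := (hP p).1 hp
  have key : ∀ a b : ℝ, |(⌊b / δ⌋ : ℝ) - ⌊a / δ⌋| ≤ r * δ⁻¹ → |b - a| ≤ 2 * r := by
    intro a b h
    have h1 := Int.floor_le (a / δ)
    have h2 := Int.lt_floor_add_one (a / δ)
    have h3 := Int.floor_le (b / δ)
    have h4 := Int.lt_floor_add_one (b / δ)
    rw [le_div_iff₀ hδ] at h1 h3
    rw [div_lt_iff₀ hδ] at h2 h4
    rw [← div_eq_mul_inv, le_div_iff₀ hδ, ← abs_of_pos hδ, ← abs_mul, abs_of_pos hδ] at h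
    have h5 := abs_le.1 h
    rw [abs_le]
    constructor <;> nlinarith [h5.1, h5.2]
  have h1 := card_mul_le_volume (T := T) (a := x) (ρ := 4 * r) hδ hkj hF (fun p' hp' => by
    obtain ⟨hp1, hp2, hp3⟩ := Finset.mem_filter.1 hp'
    obtain ⟨x', hx', rfl⟩ := (hP p').1 hp1
    refine ⟨x', hx', rfl, (Plane.dist_le hkj _ _).trans ?_⟩
    have := key _ _ hp2
    have := key _ _ hp3
    linarith)
  have h2 : volume (E ∩ Metric.closedBall x (4 * r + 2 * δ)) ≤
      ENNReal.ofReal (C * (6 * r) ^ β) * ENNReal.ofReal (4 * δ ^ 2 * P.card) := by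
    calc _ ≤ volume (E ∩ Metric.closedBall x (6 * r)) :=
          measure_mono (Set.inter_subset_inter_right _ (Metric.closedBall_subset_closedBall (by linarith)))
      _ ≤ ENNReal.ofReal (C * (6 * r) ^ β) * volume E := hE.2 x hx _ (by linarith)
      _ ≤ _ := by
          gcongr
          exact volume_le_mul_card hδ hkj fun y hy => (hP _).2 ⟨y, hy, rfl⟩
  have h3 : ENNReal.ofReal (δ ^ 2 * T.card) ≤
      ENNReal.ofReal (72 * ((C * (6 * r) ^ β) * (4 * δ ^ 2 * P.card))) := by
    rw [ENNReal.ofReal_mul (p := 72) (by norm_num), ENNReal.ofReal_mul (p := C * (6 * r) ^ β)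
      (by positivity)]
    refine h1.trans ?_
    rw [ENNReal.ofReal_ofNat]
    gcongr
  rw [ENNReal.ofReal_le_ofReal_iff (by positivity)] at h3
  have h4 := mul_rpow_le_mul (c := 6) (by norm_num) hr0.le hβ1
  have h5 : δ ^ 2 * (T.card : ℝ) ≤ δ ^ 2 * (1728 * C * r ^ β * P.card) := by
    calc _ ≤ 72 * ((C * (6 * r) ^ β) * (4 * δ ^ 2 * P.card)) := h3
      _ ≤ 72 * ((C * (6 * r ^ β)) * (4 * δ ^ 2 * P.card)) := by gcongr
      _ = _ := by ring
  exact le_of_mul_le_mul_left h5 (by positivity)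

theorem card_cells_mul_le_volume (hδ : 0 < δ) (hkj : k ≠ j) (hE : IsDeltaSet δ β C E) {M : ℝ}
    (hEM : E ⊆ Metric.closedBall 0 M) (hP : ∀ p, p ∈ P ↔ ∃ x ∈ E, gridCell δ k j x = p) :
    ENNReal.ofReal (δ ^ 2 * P.card) ≤ 72 * volume E := by
  obtain ⟨F, hF⟩ := hE.1
  refine (card_mul_le_volume (T := P) (a := 0) (ρ := M) hδ hkj hF fun p hp => ?_).trans ?_
  · obtain ⟨x, hx, rfl⟩ := (hP p).1 hp
    exact ⟨x, hx, rfl, Metric.mem_closedBall.1 (hEM hx)⟩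
  · gcongr
    exact Set.inter_subset_left

end Cells

/-- The directions for which some large subset `G` of `E` has a projection with covering number
at most `δ ^ (-ε) * |E|_δ ^ (1 / 2)`. The same exponent `ε` serves for the gain and for the
size of `G`. -/
def badDirections (δ ε : ℝ) (E : Set Plane) : Set Plane :=
  {θ | ∃ G ⊆ E, ENNReal.ofReal (δ ^ ε) * volume E < volume G ∧
    covNum δ (dirProj θ '' G) ≤ ENNReal.ofReal (δ ^ (-ε)) * covNum δ E ^ (1 / 2 : ℝ)}

/-- The slopes of representatives `θ i` of cells of the circle, weighted by the measures of the cells,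
satisfy a Frostman condition at scales `r ≥ δ`. -/
theorem sum_weights_near_le {δ κ C σ : ℝ} {k j : Fin 2} (hδ : 0 < δ) (hkj : k ≠ j)
    (hκ1 : κ ≤ 1) (hC : 0 ≤ C) (hσ : σ = 1 ∨ σ = -1) {μ : Measure Plane} [IsProbabilityMeasure μ]
    (hμ : IsFrostmanMeasure κ C μ) (hμS : μ.support ⊆ Metric.sphere 0 1) (J : Finset (ℤ × ℤ))
    (θ : ℤ × ℤ → Plane) (hθ : ∀ i ∈ J, θ i ∈ μ.support) (hθσ : ∀ i ∈ J, |θ i j| ≤ σ * θ i k)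
    (hθi : ∀ i ∈ J, gridCell δ k j (θ i) = i) {x r : ℝ} (hr : δ ≤ r) :
    ∑ i ∈ J with |θ i j / θ i k - x| ≤ r, μ.real (gridCell δ k j ⁻¹' {i}) ≤
      6 * C * r ^ κ := by
  have hr0 : 0 < r := hδ.trans_le hr
  set J₀ := J.filter (fun i => |θ i j / θ i k - x| ≤ r) with hJ₀
  rcases J₀.eq_empty_or_nonempty with h0 | ⟨i₀, hi₀⟩
  · rw [h0, Finset.sum_empty]; positivity
  obtain ⟨hi₀J, hi₀x⟩ := Finset.mem_filter.1 hi₀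
  rw [sum_measureReal_preimage_singleton J₀
    (fun y _ => measurable_gridCell δ k j (measurableSet_singleton y))]
  have hsub : gridCell δ k j ⁻¹' (J₀ : Set (ℤ × ℤ)) ⊆ Metric.closedBall (θ i₀) (6 * r) := by
    intro y hy
    obtain ⟨hiJ, hix⟩ := Finset.mem_filter.1 (Finset.mem_coe.1 hy)
    set i := gridCell δ k j y with hi
    have h1 : dist y (θ i) ≤ 2 * δ := dist_le_of_gridCell_eq hδ hkj (by rw [hθi i hiJ])
    have h2 : dist (θ i) (θ i₀) ≤ 2 * (2 * r) := by
      refine dist_le_of_slope_near hkj hσ (hμS (hθ i hiJ)) (hμS (hθ i₀ hi₀J)) (hθσ i hiJ)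
        (hθσ i₀ hi₀J) ?_
      rw [abs_le] at hix hi₀x ⊢
      constructor <;> linarith [hix.1, hix.2, hi₀x.1, hi₀x.2]
    rw [Metric.mem_closedBall]
    linarith [dist_triangle y (θ i) (θ i₀)]
  have h3 := (measure_mono hsub).trans (hμ.2 (θ i₀) (hθ i₀ hi₀J) (6 * r) (by positivity))
  have h4 : μ.real (gridCell δ k j ⁻¹' (J₀ : Set (ℤ × ℤ))) ≤ C * (6 * r) ^ κ :=
    ENNReal.toReal_le_of_le_ofReal (by positivity) h3
  calc _ ≤ C * (6 * r) ^ κ := h4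
    _ ≤ C * (6 * r ^ κ) := by gcongr; exact mul_rpow_le_mul (by norm_num) hr0.le hκ1
    _ = _ := by ring

set_option maxHeartbeats 1000000 in
/-- The bad directions in one of the four arcs of the circle have small measure: otherwise
`exists_large_projection` applies to the cells that meet `E`, to one bad direction from each cell of
the arc that contains one, and to the sets `G` of these directions. -/
theorem measure_badDirections_quadrant_lt {α β κ : ℝ} (hα0 : 0 < α) (hα2 : α < 2) (hβ : 0 < β)
    (hβ1 : β ≤ 1) (hκ : 0 < κ) (hκ1 : κ ≤ 1) :
    ∃ ε δ₀ : ℝ, (0 < ε ∧ ε ≤ 1) ∧ (0 < δ₀ ∧ δ₀ ≤ 1) ∧ ∀ δ : ℝ, 0 < δ → δ < δ₀ →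
      ∀ (μ : Measure Plane) (E : Set Plane), IsFrostmanMeasure κ (δ ^ (-ε)) μ →
      μ.support ⊆ Metric.sphere 0 1 → E ⊆ Metric.closedBall 0 (δ ^ (-ε)) →
      IsDeltaSet δ β (δ ^ (-ε)) E → volume E ≤ ENNReal.ofReal (δ ^ (2 - α)) →
      ∀ (k j : Fin 2) (σ : ℝ), k ≠ j → σ = 1 ∨ σ = -1 →
        μ (badDirections δ ε E ∩ μ.support ∩ {θ | |θ j| ≤ σ * θ k}) <
          ENNReal.ofReal (δ ^ ε / 4) := by
  classical
  obtain ⟨γ, hγ, R₀, hR₀, hmain⟩ := exists_large_projection hα2 hα0 hβ hβ1 hκ hκ1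
  obtain ⟨ε, hε0, hε1, hεγ⟩ : ∃ ε : ℝ, 0 < ε ∧ ε ≤ 1 ∧ ε ≤ γ / 2 :=
    ⟨min (γ / 2) 1, by positivity, min_le_right _ _, min_le_left _ _⟩
  refine ⟨ε, min (1 / R₀) ((1 / 2000) ^ (2 / γ)), ⟨hε0, hε1⟩,
    ⟨by positivity, (min_le_left _ _).trans (by rw [div_le_one (by linarith)]; exact hR₀)⟩, ?_⟩
  intro δ hδ hδδ μ E hμ hμS hEb hE hEvol k j σ hkj hσ
  by_contra! hbad
  have hprob := hμ.1
  have hδR : δ ≤ 1 / R₀ := hδδ.le.trans (min_le_left _ _)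
  have hδγ : δ ≤ (1 / 2000) ^ (2 / γ) := hδδ.le.trans (min_le_right _ _)
  have hδ1 : δ ≤ 1 := hδR.trans (by rw [div_le_one (by linarith)]; exact hR₀)
  set H := badDirections δ ε E ∩ μ.support ∩ {θ | |θ j| ≤ σ * θ k} with hH
  have hδε : 0 < δ ^ ε := by positivity
  have hδε' : 1 ≤ δ ^ (-ε) := Real.one_le_rpow_of_pos_of_le_one_of_nonpos hδ hδ1 (by linarith)
  -- the finite set of cells that meet the bad directions
  have hHfin : (gridCell δ k j '' H).Finite :=
    finite_image_gridCell hδ hkj (M := 1) fun θ hθ => Metric.sphere_subset_closedBall (hμS hθ.1.2)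
  set J := hHfin.toFinset with hJ
  have hJmem : ∀ i ∈ J, ∃ θ, θ ∈ μ.support ∧ |θ j| ≤ σ * θ k ∧ gridCell δ k j θ = i ∧
      ∃ G ⊆ E, ENNReal.ofReal (δ ^ ε) * volume E < volume G ∧
        covNum δ (dirProj θ '' G) ≤ ENNReal.ofReal (δ ^ (-ε)) * covNum δ E ^ (1 / 2 : ℝ) := by
    intro i hi
    obtain ⟨θ, ⟨⟨hθ1, hθ2⟩, hθ3⟩, rfl⟩ := hHfin.mem_toFinset.1 hi
    exact ⟨θ, hθ2, hθ3, rfl, hθ1⟩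
  choose! θ hθS hθσ hθi G hGE hGvol hGcov using hJmem
  -- the cells that meet `E` and its subsets
  have hfinE : ∀ S ⊆ E, (gridCell δ k j '' S).Finite := fun S hS =>
    finite_image_gridCell hδ hkj (hS.trans hEb)
  have hcells : ∀ S ⊆ E, ∃ T : Finset (ℤ × ℤ), ∀ p, p ∈ T ↔ ∃ x ∈ S, gridCell δ k j x = p :=
    fun S hS => ⟨(hfinE S hS).toFinset, fun p => by rw [(hfinE S hS).mem_toFinset]; rfl⟩
  obtain ⟨P, hP⟩ := hcells E subset_rfl
  have hT : ∀ i ∈ J, ∃ T : Finset (ℤ × ℤ), ∀ p, p ∈ T ↔ ∃ x ∈ G i, gridCell δ k j x = p :=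
    fun i hi => hcells _ (hGE i hi)
  choose! T hT using hT
  have hEfin : volume E ≠ ∞ := (hEvol.trans_lt ENNReal.ofReal_lt_top).ne
  set v : ℝ := (volume E).toReal with hv
  have hvE : volume E = ENNReal.ofReal v := (ENNReal.ofReal_toReal hEfin).symm
  have hv0 : 0 ≤ v := ENNReal.toReal_nonneg
  have hPv : δ ^ 2 * P.card ≤ 72 * v := by
    have h1 := card_cells_mul_le_volume hδ hkj hE hEb hP
    rw [hvE, ← ENNReal.ofReal_ofNat 72, ← ENNReal.ofReal_mul (by norm_num),
      ENNReal.ofReal_le_ofReal_iff (by positivity)] at h1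
    exact h1
  have hvα : v ≤ δ ^ (2 - α) := by
    rw [hvE, ENNReal.ofReal_le_ofReal_iff (by positivity)] at hEvol
    exact hEvol
  have hGv : ∀ i ∈ J, δ ^ ε * v < 4 * δ ^ 2 * (T i).card := by
    intro i hi
    have h1 := (hGvol i hi).trans_le
      (volume_le_mul_card hδ hkj (T := T i) fun x hx => (hT i hi _).2 ⟨x, hx, rfl⟩)
    rw [hvE, ← ENNReal.ofReal_mul hδε.le] at h1
    exact (ENNReal.ofReal_lt_ofReal_iff_of_nonneg (by positivity)).1 h1
  -- there are bad directions, so `E` is not empty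
  have hJne : J.Nonempty := by
    have hHne : H.Nonempty := by
      rw [Set.nonempty_iff_ne_empty]
      intro h0
      rw [h0, measure_empty, nonpos_iff_eq_zero, ENNReal.ofReal_eq_zero] at hbad
      linarith
    obtain ⟨θ', hθ'⟩ := hHne
    exact ⟨_, hHfin.mem_toFinset.2 (Set.mem_image_of_mem _ hθ')⟩
  have hPne : P.Nonempty := by
    obtain ⟨i, hi⟩ := hJne
    have h1 : 0 < volume (G i) := pos_of_gt (hGvol i hi)
    obtain ⟨x, hx⟩ := nonempty_of_measure_ne_zero h1.ne'
    exact ⟨_, (hP _).2 ⟨x, hGE i hi hx, rfl⟩⟩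
  set K : ℝ := 2000 * δ ^ (-ε) with hK
  have hKc : ∀ c : ℝ, c ≤ 2000 → c * δ ^ (-ε) ≤ K := fun c hc =>
    mul_le_mul_of_nonneg_right hc (by linarith)
  have hK2 : 2 ≤ K := by rw [hK]; linarith
  have hKR : K ≤ (δ⁻¹) ^ γ := by
    have h1 : δ ^ (-ε) ≤ δ ^ (-(γ / 2)) :=
      Real.rpow_le_rpow_of_exponent_ge hδ hδ1 (by linarith)
    have h2 : (2000 : ℝ) ≤ δ ^ (-(γ / 2)) := by
      rw [Real.rpow_neg hδ.le, le_inv_comm₀ (by norm_num) (by positivity)]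
      calc δ ^ (γ / 2) ≤ ((1 / 2000) ^ (2 / γ)) ^ (γ / 2) := by gcongr
        _ = (2000 : ℝ)⁻¹ := by
            rw [← Real.rpow_mul (by norm_num)]
            have : 2 / γ * (γ / 2) = 1 := by field_simp
            rw [this, Real.rpow_one, one_div]
    calc K ≤ δ ^ (-(γ / 2)) * δ ^ (-(γ / 2)) := by rw [hK]; gcongr
      _ = δ ^ (-γ) := by rw [← Real.rpow_add hδ]; congr 1; ring
      _ = (δ⁻¹) ^ γ := by rw [Real.inv_rpow hδ.le, Real.rpow_neg hδ.le]
  clear_value K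
  have hslope : ∀ i ∈ J, 1 / 2 ≤ |θ i k| ∧ |θ i j| ≤ |θ i k| := fun i hi =>
    half_le_abs hkj hσ (hμS (hθS i hi)) (hθσ i hi)
  have hsum : ∑ i ∈ J, μ.real (gridCell δ k j ⁻¹' {i}) = μ.real (gridCell δ k j ⁻¹' J) :=
    sum_measureReal_preimage_singleton J
      (fun y _ => measurable_gridCell δ k j (measurableSet_singleton y))
  have hδεinv : δ ^ ε * δ ^ (-ε) = 1 := by
    rw [← Real.rpow_add hδ, add_neg_cancel, Real.rpow_zero]
  obtain ⟨i, hi, hlarge⟩ := hmain δ⁻¹ (by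
      rw [le_inv_comm₀ (by linarith) hδ, ← one_div]; exact hδR) K hK2 hKR J
    (fun i => μ.real (gridCell δ k j ⁻¹' {i})) (fun i => θ i j / θ i k) T P hPne
    (fun i _ => measureReal_nonneg)
    (fun i hi => by
      obtain ⟨h1, h2⟩ := hslope i hi
      rw [abs_div, div_le_one (by linarith)]; exact h2)
    (by
      rw [hsum]
      have h1 : H ⊆ gridCell δ k j ⁻¹' (J : Set (ℤ × ℤ)) := fun x hx =>
        Finset.mem_coe.2 (hHfin.mem_toFinset.2 (Set.mem_image_of_mem _ hx))
      have h2 := hbad.trans (measure_mono h1)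
      rw [ENNReal.ofReal_le_iff_le_toReal (measure_ne_top _ _)] at h2
      refine le_trans ?_ h2
      rw [hK, div_le_iff₀ (by positivity)]
      linarith)
    (by rw [hsum]; exact measureReal_le_one)
    (fun x r hr => by
      rw [one_div, inv_inv] at hr
      refine (sum_weights_near_le hδ hkj hκ1 (by linarith) hσ hμ hμS J θ hθS hθσ hθi hr).trans ?_
      have : 0 < r := hδ.trans_le hr
      gcongr
      exact hKc _ (by norm_num))
    (by
      have h1 : δ ^ 2 * (P.card : ℝ) ≤ δ ^ 2 * (K * (δ⁻¹) ^ α) := by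
        calc _ ≤ 72 * v := hPv
          _ ≤ 72 * δ ^ (2 - α) := by gcongr
          _ = δ ^ 2 * (72 * (δ⁻¹) ^ α) := by
              rw [Real.rpow_sub hδ, Real.inv_rpow hδ.le, Real.rpow_ofNat]; ring
          _ ≤ _ := by
              gcongr
              rw [hK]; linarith
      exact le_of_mul_le_mul_left h1 (by positivity))
    (fun p hp r hr => by
      rw [one_div, inv_inv] at hr
      refine (hE.card_filter_cells_le hδ hkj hβ1 (by linarith) hP hp hr).trans ?_
      have : 0 < r := hδ.trans_le hr
      refine mul_le_mul_of_nonneg_right (mul_le_mul_of_nonneg_right (hKc _ (by norm_num)) ?_)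
        (Nat.cast_nonneg _)
      positivity)
    (fun i hi p hp => by
      obtain ⟨x, hx, rfl⟩ := (hT i hi p).1 hp
      exact (hP _).2 ⟨x, hGE i hi hx, rfl⟩)
    (fun i hi => by
      have h1 := (hGv i hi).le
      have h2 : v ≤ δ ^ (-ε) * (4 * δ ^ 2 * (T i).card) := by
        calc v = δ ^ (-ε) * (δ ^ ε * v) := by rw [← mul_assoc, mul_comm (δ ^ (-ε)), hδεinv, one_mul]
          _ ≤ _ := by gcongr
      have h3 : δ ^ 2 * (P.card : ℝ) ≤ δ ^ 2 * (K * (T i).card) := by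
        calc _ ≤ 72 * (δ ^ (-ε) * (4 * δ ^ 2 * (T i).card)) := hPv.trans (by gcongr)
          _ = δ ^ 2 * (288 * δ ^ (-ε) * (T i).card) := by ring
          _ ≤ _ := mul_le_mul_of_nonneg_left
              (mul_le_mul_of_nonneg_right (hKc _ (by norm_num)) (Nat.cast_nonneg _)) (sq_nonneg δ)
      exact le_of_mul_le_mul_left h3 (by positivity))
  -- the projections of the sets `G i` are too small
  obtain ⟨h1, h2⟩ := hslope i hi
  have hcovE : covNum δ E ≤ P.card := covNum_le_card hδ hkj fun x hx => (hP _).2 ⟨x, hx, rfl⟩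
  have h3 : covNum δ (dirProj (θ i) '' G i) ≤ ENNReal.ofReal (δ ^ (-ε) * √(P.card : ℝ)) := by
    refine (hGcov i hi).trans ?_
    rw [ENNReal.ofReal_mul (p := δ ^ (-ε)) (by positivity), Real.sqrt_eq_rpow,
      ← ENNReal.ofReal_rpow_of_nonneg (Nat.cast_nonneg P.card) (by norm_num), ENNReal.ofReal_natCast]
    gcongr
  have h4 := card_image_floor_le hδ hkj h1 h2 (fun p hp => (hT i hi p).1 hp)
    (mul_nonneg (by linarith) (Real.sqrt_nonneg _)) h3
  have h5 : 11 * (δ ^ (-ε) * √(P.card : ℝ)) ≤ K * √(P.card : ℝ) := by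
    rw [← mul_assoc]
    exact mul_le_mul_of_nonneg_right (hKc _ (by norm_num)) (Real.sqrt_nonneg _)
  linarith

theorem theorem3 (α β κ : ℝ) (hα0 : 0 < α) (hα2 : α < 2) (hβ : 0 < β) (hκ : 0 < κ) :
    ∃ η ε δ₀ : ℝ, 0 < η ∧ (0 < ε ∧ ε ≤ 1) ∧ (0 < δ₀ ∧ δ₀ ≤ 1) ∧
      ∀ δ : ℝ, 0 < δ → δ < δ₀ →
        ∀ (μ : Measure (EuclideanSpace ℝ (Fin 2))) (E : Set (EuclideanSpace ℝ (Fin 2))),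
          IsFrostmanMeasure κ (δ ^ (-ε)) μ →
          μ.support ⊆ Metric.sphere 0 1 →
          E ⊆ Metric.closedBall 0 (δ ^ (-ε)) →
          IsDeltaSet δ β (δ ^ (-ε)) E →
          volume E ≤ ENNReal.ofReal (δ ^ (2 - α)) →
          ∃ Θ : Set (EuclideanSpace ℝ (Fin 2)),
            MeasurableSet Θ ∧ Θ ⊆ μ.support ∧
            ENNReal.ofReal (1 - δ ^ ε) < μ Θ ∧
            ∀ θ ∈ Θ, ∀ G : Set (EuclideanSpace ℝ (Fin 2)), G ⊆ E →
              ENNReal.ofReal (δ ^ ε) * volume E < volume G →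
              ENNReal.ofReal (δ ^ (-η)) * covNum δ E ^ (1 / 2 : ℝ)
                < covNum δ (dirProj θ '' G) := by
  obtain ⟨ε, δ₀, hε, hδ₀, hmain⟩ := measure_badDirections_quadrant_lt hα0 hα2
    (lt_min hβ one_pos) (min_le_right β 1) (lt_min hκ one_pos) (min_le_right κ 1)
  refine ⟨ε, ε, δ₀, hε.1, hε, hδ₀, ?_⟩
  intro δ hδ hδδ μ E hμ hμS hEb hE hEvol
  have hprob := hμ.1
  have hδ1 : δ ≤ 1 := hδδ.le.trans hδ₀.2
  have hC : 1 ≤ δ ^ (-ε) :=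
    Real.one_le_rpow_of_pos_of_le_one_of_nonpos hδ hδ1 (by linarith [hε.1])
  have hquad := hmain δ hδ hδδ μ E (hμ.min_one hκ hC) hμS hEb (hE.min_one hδ hβ hC) hEvol
  set B := badDirections δ ε E ∩ μ.support with hB
  -- the circle is the union of four arcs on which one coordinate dominates with a given sign
  have hBlt : μ B < ENNReal.ofReal (δ ^ ε) := by
    have hsub : B ⊆ (B ∩ {θ | |θ 1| ≤ 1 * θ 0} ∪ B ∩ {θ | |θ 1| ≤ -1 * θ 0}) ∪
        (B ∩ {θ | |θ 0| ≤ 1 * θ 1} ∪ B ∩ {θ | |θ 0| ≤ -1 * θ 1}) := by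
      intro θ hθ
      rw [← Set.inter_union_distrib_left, ← Set.inter_union_distrib_left,
        ← Set.inter_union_distrib_left]
      refine ⟨hθ, ?_⟩
      rcases le_total |θ 1| |θ 0| with h | h
      · left
        rcases abs_choice (θ 0) with h' | h'
        · left; show |θ 1| ≤ 1 * θ 0; linarith
        · right; show |θ 1| ≤ -1 * θ 0; linarith
      · right
        rcases abs_choice (θ 1) with h' | h'
        · left; show |θ 0| ≤ 1 * θ 1; linarith
        · right; show |θ 0| ≤ -1 * θ 1; linarith
    have q1 := hquad 0 1 1 (by decide) (Or.inl rfl)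
    have q2 := hquad 0 1 (-1) (by decide) (Or.inr rfl)
    have q3 := hquad 1 0 1 (by decide) (Or.inl rfl)
    have q4 := hquad 1 0 (-1) (by decide) (Or.inr rfl)
    have hsplit : ENNReal.ofReal (δ ^ ε) =
        (ENNReal.ofReal (δ ^ ε / 4) + ENNReal.ofReal (δ ^ ε / 4)) +
        (ENNReal.ofReal (δ ^ ε / 4) + ENNReal.ofReal (δ ^ ε / 4)) := by
      have : 0 ≤ δ ^ ε / 4 := by positivity
      rw [← ENNReal.ofReal_add this this, ← ENNReal.ofReal_add (by positivity) (by positivity)]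
      congr 1; ring
    rw [hsplit]
    refine ((measure_mono hsub).trans (measure_union_le _ _)).trans_lt ?_
    exact ENNReal.add_lt_add ((measure_union_le _ _).trans_lt (ENNReal.add_lt_add q1 q2))
      ((measure_union_le _ _).trans_lt (ENNReal.add_lt_add q3 q4))
  have hsuppm : MeasurableSet μ.support := Measure.isClosed_support.measurableSet
  have hsupp : μ μ.support = 1 := (prob_compl_eq_zero_iff hsuppm).1 Measure.measure_compl_support
  -- the set `B` need not be measurable, so its measurable hull is removed
  refine ⟨μ.support \ toMeasurable μ B, hsuppm.diff (measurableSet_toMeasurable _ _),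
    Set.sdiff_subset, ?_, ?_⟩
  · have h1 : (1 : ℝ≥0∞) ≤ μ (μ.support \ toMeasurable μ B) + μ B := by
      rw [← hsupp, ← measure_toMeasurable B]
      refine (measure_mono fun x hx => ?_).trans (measure_union_le _ _)
      by_cases h : x ∈ toMeasurable μ B
      · exact Or.inr h
      · exact Or.inl ⟨hx, h⟩
    have hδε : δ ^ ε ≤ 1 := Real.rpow_le_one hδ.le hδ1 hε.1.le
    refine lt_of_add_lt_add_right (a := μ B) (lt_of_lt_of_le ?_ h1)
    calc ENNReal.ofReal (1 - δ ^ ε) + μ B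
        < ENNReal.ofReal (1 - δ ^ ε) + ENNReal.ofReal (δ ^ ε) :=
          ENNReal.add_lt_add_left ENNReal.ofReal_ne_top hBlt
      _ = 1 := by
          rw [← ENNReal.ofReal_add (by linarith) (by positivity), sub_add_cancel,
            ENNReal.ofReal_one]
  · rintro θ ⟨hθ, hθB⟩ G hGE hG
    by_contra! hcon
    exact hθB (subset_toMeasurable μ B ⟨⟨G, hGE, hG, hcon⟩, hθ⟩)
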